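/- Let $\Gamma$ be a torsion-free Fuchsian group, so that $\Sigma=\mathbb H/\Gamma$ is a complete orientable hyperbolic surface (for instance a closed one), let $\beta_1,\beta_2$ be oriented closed geodesics of $\Sigma$ that cross at a point $y$ (possibly $\beta_1=\beta_2$, at a self-crossing), and let $\alpha$ be a simple closed geodesic different from $\beta_1$ and from $\beta_2$. For $t\in\mathbb R$ let $\rho_t:\Gamma\to \mathrm{PSL}(2,\mathbb R)$ be the representation obtained from the inclusion $\Gamma\subset \mathrm{PSL}(2,\mathbb R)$ by the time $t$ Fenchel--Nielsen twist along $\alpha$. Choose lifts $\hat\beta_1\neq\hat\beta_2$ of $\beta_1,\beta_2$ through a common lift $\hat y$ of $y$, and hyperbolic $b_1,b_2\in\Gamma$ that translate along them in the direction of their orientation. Then, after reversing the orientation of $\beta_2$ (replacing $b_2$ by $b_2^{-1}$) if necessary, there is $\varepsilon>0$ such that for every $t\in\mathbb R$ the elements $\rho_t(b_1),\rho_t(b_2)$ are hyperbolic, their axes are distinct and cross at a point $y_t$, and the angle in $[0,\pi]$ between these axes at $y_t$, oriented in the directions of translation, satisfies $$\beta_1\angle_{y_t}\beta_2\le \pi-\varepsilon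 .$$ No reversal is necessary unless $\hat\beta_1$ and $\hat\beta_2$ cross some lift of $\alpha$ to $\mathbb H$ in opposite directions. -/

import Mathlib

open scoped MatrixGroups

namespace FenchelNielsen

noncomputable section

open UpperHalfPlane

/-- The one-parameter subgroup `diag(e^{t/2}, e^{-t/2})` of `SL(2, ℝ)`: it acts on the upper half
plane as the translation `z ↦ e^t z` of length `t` along the imaginary axis, towards `∞`. -/
def flow (t : ℝ) : SL(2, ℝ) :=
  ⟨!![Real.exp (t / 2), 0; 0, Real.exp (-(t / 2))], by
    rw [Matrix.det_fin_two_of, ← Real.exp_add]; simp⟩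

/-- The rotation by `π` about `i`, that is `z ↦ -1 / z`. -/
def halfTurn : SL(2, ℝ) :=
  ⟨!![0, -1; 1, 0], by simp [Matrix.det_fin_two_of]⟩

/-- The oriented unit-speed geodesic `s ↦ g • (e^s i)` of the hyperbolic plane. Every oriented
unit-speed geodesic has this form, with `g` unique up to sign. It passes through `g • i` at
time `0`; the geodesic of `g * halfTurn` is the same line with the opposite orientation. -/
def geodesic (g : SL(2, ℝ)) (s : ℝ) : ℍ := (g * flow s) • I

/-- The underlying line (complete unoriented geodesic). -/
def line (g : SL(2, ℝ)) : Set ℍ := Set.range (geodesic g)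

/-- The open half plane to the left of the oriented geodesic of `g`. -/
def leftSide (g : SL(2, ℝ)) : Set ℍ := {z | (g⁻¹ • z).re < 0}

/-- The open half plane to the right of the oriented geodesic of `g`. -/
def rightSide (g : SL(2, ℝ)) : Set ℍ := {z | 0 < (g⁻¹ • z).re}

/-- Translation of length `t` along the oriented geodesic of `g`, in its direction. -/
def translation (g : SL(2, ℝ)) (t : ℝ) : SL(2, ℝ) := g * flow t * g⁻¹

/-- `b` acts as a hyperbolic isometry and the oriented geodesic of `g` is its axis, oriented in
the direction of translation. -/
def IsOrientedAxis (b g : SL(2, ℝ)) : Prop :=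
  ∃ l : ℝ, 0 < l ∧ (b = translation g l ∨ b = -translation g l)

/-- The velocity at time `0` of the geodesic of `g`, a tangent vector at `g • i`, in the
(conformal) coordinate of the upper half plane. -/
def velocity (g : SL(2, ℝ)) : ℂ := deriv (fun s : ℝ => (geodesic g s : ℂ)) 0

/-- `b` and `c` act as hyperbolic isometries, their axes are distinct and cross in a (necessarily
unique) point, and `θ` is the angle at that point between the axes, oriented in the directions
of translation. -/
def IsCrossingAngle (b c : SL(2, ℝ)) (θ : ℝ) : Prop :=
  ∃ g h : SL(2, ℝ), IsOrientedAxis b g ∧ IsOrientedAxis c h ∧ g • I = h • I ∧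
    line g ≠ line h ∧ θ = InnerProductGeometry.angle (velocity g) (velocity h)

/-- The oriented geodesic of `h` crosses the line of `g` from its left to its right. -/
def CrossesToRight (h g : SL(2, ℝ)) : Prop :=
  ∃ s s' : ℝ, s < s' ∧ geodesic h s ∈ leftSide g ∧ geodesic h s' ∈ rightSide g

/-- The closed geodesic of `ℍ / Γ` which is the image of the line of `g` is simple:
any two of its lifts are equal or disjoint. -/
def IsSimple (Γ : Subgroup SL(2, ℝ)) (g : SL(2, ℝ)) : Prop :=
  ∀ γ ∈ Γ, line (γ * g) = line g ∨ Disjoint (line (γ * g)) (line g)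

/-- `k` gives a lift, with one of its two orientations, of the closed geodesic of `ℍ / Γ`
which is the image of the line of `g`. -/
def IsLift (Γ : Subgroup SL(2, ℝ)) (g k : SL(2, ℝ)) : Prop :=
  ∃ γ ∈ Γ, k = γ * g ∨ k = γ * g * halfTurn

/-- `L` lists the lifts of the closed geodesic that separate `x` from `z`, each of them once, in
the order in which the segment from `x` to `z` crosses them, and each of them oriented so that it
has `x` on its left and `z` on its right. -/
def IsCrossingList (Γ : Subgroup SL(2, ℝ)) (g : SL(2, ℝ)) (x z : ℍ)
    (L : List SL(2, ℝ)) : Prop :=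
  (∀ k ∈ L, IsLift Γ g k ∧ x ∈ leftSide k ∧ z ∈ rightSide k) ∧
  (∀ k, IsLift Γ g k → x ∈ leftSide k → z ∈ rightSide k →
    ∃ k' ∈ L, rightSide k' = rightSide k) ∧
  L.Pairwise (fun k k' => rightSide k' ⊂ rightSide k)

open Classical in
/-- Cut the hyperbolic plane along all lifts of the simple closed geodesic and glue it back after a
left twist of distance `t` along each of them, keeping the piece that contains `x` fixed:
`twistIsometry Γ g t x z` is the isometry by which the piece that contains `z` is moved. It is the
product `φ₁ φ₂ ⋯ φₙ` of the translations of length `t` along the successive lifts crossed between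
`x` and `z`, where `φᵢ` moves the far side to the left, as seen from `x`. -/
def twistIsometry (Γ : Subgroup SL(2, ℝ)) (g : SL(2, ℝ)) (t : ℝ) (x z : ℍ) : SL(2, ℝ) :=
  if h : ∃ L, IsCrossingList Γ g x z L then
    (h.choose.map (fun k => translation k t)).prod
  else 1

/-- The holonomy representation `ρ_t : Γ → SL(2, ℝ)` of the surface obtained from `ℍ / Γ` by the
time `t` Fenchel-Nielsen twist along the image of the line of `g`. The lift `τ` of the twist that
fixes the piece containing `x` satisfies `τ (γ • z) = ρ_t γ • τ z`. -/
def twist (Γ : Subgroup SL(2, ℝ)) (g : SL(2, ℝ)) (x : ℍ) (t : ℝ) (γ : SL(2, ℝ)) : SL(2, ℝ) :=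
  twistIsometry Γ g t x (γ • x) * γ

/-- Along the whole twist orbit the oriented closed geodesics of `b` and `c` keep meeting in the
point given by the crossing of their axes, at an angle bounded away from `π`. -/
def AngleBoundedAwayFromPi (Γ : Subgroup SL(2, ℝ)) (g : SL(2, ℝ)) (x : ℍ)
    (b c : SL(2, ℝ)) : Prop :=
  ∃ ε : ℝ, 0 < ε ∧ ∀ t : ℝ, ∃ θ : ℝ,
    IsCrossingAngle (twist Γ g x t b) (twist Γ g x t c) θ ∧ θ ≤ Real.pi - ε

end

end FenchelNielsen

/-! The argument has three steps: both holonomies stay hyperbolic, their axes keep crossing, and the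
cosine of the angle has limits other than -1 as t → ±∞. A continuous function with values greater
than -1 and with such limits is bounded away from -1 (`exists_lower_bound`), so the angle is bounded
away from π.

Nesting and positivity. Lifts of a simple closed geodesic are equal or disjoint, and discreteness
forbids distinct ones a common end. Hence, if `k`, `k'` are lifts and the right side of `k'` lies
strictly inside that of `k`, all entries of `k⁻¹ * k'` have one sign. With the base point on the
axis of `b` and off the lifts, the twisted holonomy is a product of translations along the lifts
crossed in one period, times `b`. If no lift is crossed it is constant. Otherwise, read in the frame
of the first lift, it is a product of positive matrices (up to sign) and diagonal flows, so its
trace exceeds 2 in absolute value (`posUpToSign_word`, `twist_axis`).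

Crossing. Two hyperbolic axes cross exactly when the commutator has trace less than 2
(`trace_commutator_lt_iff`). The twist is a homomorphism on Γ, so the commutator of the twisted
elements is the twist of one fixed element of Γ. Its trace is continuous in t, starts below 2 and
never equals 2 (`twist_trace_ne_two`): there are no nontrivial elliptics, the trace of a parabolic
or of an element whose axis is a lift does not change, and that of any other hyperbolic element is
constant or stays above 2 in absolute value. For parabolics and axes along lifts a point is found in
the cusp or the collar which the element moves without crossing any lift.

Limits. `cosAngle` is invariant under rescaling and equals 2R - 1, with R a cross ratio of the four
ends (`cosAngle_eq`). As t → ±∞ the rescaled holonomy tends to a rank one matrix whose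
eigendirections are ends of the first lift `k` of the period and of the last lift `κ` of the
preceding one. The limit of the cosine is -1 only if the attracting direction of one element equals
the repelling direction of the other. By discreteness this needs two lifts on one line with opposite
orientations, `κ₂` against `k₁` or `κ₁` against `k₂` (`wedge_ne_zero_of_lifts`), so that the two
geodesics cross some lift in opposite directions. In that case reversing `β₂` helps: a coincidence
after the reversal would force one geodesic to cross a single line in both directions
(`CrossesToRight.not_opposite`). -/

namespace FenchelNielsen
open UpperHalfPlane

/-! ### Sides of an oriented geodesic -/

/-- The numerator of the real part of `m • z`. -/
def reNum (m : SL(2, ℝ)) (z : ℍ) : ℝ :=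
  m 0 0 * m 1 0 * Complex.normSq z + (m 0 0 * m 1 1 + m 0 1 * m 1 0) * z.re + m 0 1 * m 1 1

theorem det_eq (m : SL(2, ℝ)) : m 0 0 * m 1 1 - m 0 1 * m 1 0 = 1 := by
  have := m.det_coe
  rwa [Matrix.det_fin_two] at this

theorem inv_00 (m : SL(2, ℝ)) : m⁻¹ 0 0 = m 1 1 := by
  rw [Matrix.SpecialLinearGroup.SL2_inv_expl]; rfl

theorem inv_01 (m : SL(2, ℝ)) : m⁻¹ 0 1 = -m 0 1 := by
  rw [Matrix.SpecialLinearGroup.SL2_inv_expl]; rfl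

theorem inv_10 (m : SL(2, ℝ)) : m⁻¹ 1 0 = -m 1 0 := by
  rw [Matrix.SpecialLinearGroup.SL2_inv_expl]; rfl

theorem inv_11 (m : SL(2, ℝ)) : m⁻¹ 1 1 = m 0 0 := by
  rw [Matrix.SpecialLinearGroup.SL2_inv_expl]; rfl

theorem mul_entry (m n : SL(2, ℝ)) (i j : Fin 2) :
    (m * n) i j = m i 0 * n 0 j + m i 1 * n 1 j := by
  rw [Matrix.SpecialLinearGroup.coe_mul, Matrix.mul_apply, Fin.sum_univ_two]

theorem ext_entries {m n : SL(2, ℝ)} (h00 : m 0 0 = n 0 0) (h01 : m 0 1 = n 0 1)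
    (h10 : m 1 0 = n 1 0) (h11 : m 1 1 = n 1 1) : m = n := by
  ext i j
  fin_cases i <;> fin_cases j <;> assumption

@[simp] theorem flow_00 (t : ℝ) : flow t 0 0 = Real.exp (t / 2) := rfl
@[simp] theorem flow_01 (t : ℝ) : flow t 0 1 = 0 := rfl
@[simp] theorem flow_10 (t : ℝ) : flow t 1 0 = 0 := rfl
@[simp] theorem flow_11 (t : ℝ) : flow t 1 1 = Real.exp (-(t / 2)) := rfl
@[simp] theorem halfTurn_00 : halfTurn 0 0 = 0 := rfl
@[simp] theorem halfTurn_01 : halfTurn 0 1 = -1 := rfl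
@[simp] theorem halfTurn_10 : halfTurn 1 0 = 1 := rfl
@[simp] theorem halfTurn_11 : halfTurn 1 1 = 0 := rfl

theorem neg_entry (m : SL(2, ℝ)) (i j : Fin 2) : (-m) i j = -m i j := by
  rw [Matrix.SpecialLinearGroup.coe_neg, Matrix.neg_apply]

theorem one_00 : (1 : SL(2, ℝ)) 0 0 = 1 := by simp
theorem one_01 : (1 : SL(2, ℝ)) 0 1 = 0 := by simp
theorem one_10 : (1 : SL(2, ℝ)) 1 0 = 0 := by simp
theorem one_11 : (1 : SL(2, ℝ)) 1 1 = 1 := by simp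

theorem flow_add (s t : ℝ) : flow (s + t) = flow s * flow t := by
  apply ext_entries <;> simp only [mul_entry, flow_00, flow_01, flow_10, flow_11] <;>
    simp only [mul_zero, zero_mul, add_zero, zero_add, ← Real.exp_add] <;> ring_nf

theorem flow_zero : flow 0 = 1 := by
  apply ext_entries <;> simp

theorem flow_neg (t : ℝ) : flow (-t) = (flow t)⁻¹ := by
  rw [eq_inv_iff_mul_eq_one, ← flow_add, neg_add_cancel, flow_zero]

theorem halfTurn_mul_self : halfTurn * halfTurn = -1 := by
  apply ext_entries <;> simp [mul_entry, neg_entry]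

theorem flow_mul_halfTurn (t : ℝ) : flow t * halfTurn = halfTurn * flow (-t) := by
  apply ext_entries <;> simp [mul_entry, neg_div]

/-- The denominator is `|cz + d|²`. Questions about sides thereby become questions about the sign of
the polynomial `reNum`. -/
theorem exists_denom (m : SL(2, ℝ)) (z : ℍ) : ∃ D : ℝ, 0 < D ∧ (m • z).re = reNum m z / D := by
  refine ⟨Complex.normSq (m 1 0 * z + m 1 1), ?_, ?_⟩
  · rw [Complex.normSq_pos]
    intro h
    have him := congrArg Complex.im h
    have hre := congrArg Complex.re h
    simp at him hre
    have hz : z.im ≠ 0 := z.im_pos.ne'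
    have h10 : m 1 0 = 0 := him.resolve_right hz
    have h11 : m 1 1 = 0 := by rw [h10] at hre; simpa using hre
    have := det_eq m
    rw [h10, h11] at this
    simp at this
  · rw [← UpperHalfPlane.coe_re, UpperHalfPlane.coe_specialLinearGroup_apply, Complex.div_re,
      ← add_div]
    congr 1
    simp [reNum, Complex.normSq_apply]
    ring

theorem re_smul_neg_iff (m : SL(2, ℝ)) (z : ℍ) : (m • z).re < 0 ↔ reNum m z < 0 := by
  obtain ⟨D, hD, h⟩ := exists_denom m z
  rw [h, div_lt_iff₀ hD, zero_mul]

theorem re_smul_pos_iff (m : SL(2, ℝ)) (z : ℍ) : 0 < (m • z).re ↔ 0 < reNum m z := by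
  obtain ⟨D, hD, h⟩ := exists_denom m z
  rw [h, lt_div_iff₀ hD, zero_mul]

theorem smul_mem_leftSide (m k : SL(2, ℝ)) (z : ℍ) :
    m • z ∈ leftSide (m * k) ↔ z ∈ leftSide k := by
  simp [leftSide, mul_smul]

theorem smul_mem_rightSide (m k : SL(2, ℝ)) (z : ℍ) :
    m • z ∈ rightSide (m * k) ↔ z ∈ rightSide k := by
  simp [rightSide, mul_smul]

theorem mem_leftSide_mul (m k : SL(2, ℝ)) (z : ℍ) :
    z ∈ leftSide (m * k) ↔ m⁻¹ • z ∈ leftSide k := by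
  simp [leftSide, mul_smul]

theorem mem_rightSide_mul (m k : SL(2, ℝ)) (z : ℍ) :
    z ∈ rightSide (m * k) ↔ m⁻¹ • z ∈ rightSide k := by
  simp [rightSide, mul_smul]

theorem leftSide_halfTurn (k : SL(2, ℝ)) : leftSide (k * halfTurn) = rightSide k := by
  ext z
  rw [mem_leftSide_mul]
  change _ ↔ 0 < (k⁻¹ • z).re
  have : (k * halfTurn)⁻¹ • z ∈ (Set.univ : Set ℍ) := trivial
  rw [← mem_leftSide_mul, leftSide, Set.mem_ofPred_eq, mul_inv_rev, mul_smul, re_smul_neg_iff]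
  simp [reNum, inv_00, inv_01, inv_10, inv_11]

theorem rightSide_halfTurn (k : SL(2, ℝ)) : rightSide (k * halfTurn) = leftSide k := by
  ext z
  rw [rightSide, Set.mem_ofPred_eq, mul_inv_rev, mul_smul, re_smul_pos_iff]
  simp [reNum, inv_00, inv_01, inv_10, inv_11, leftSide]

theorem reNum_flow (s : ℝ) (z : ℍ) : reNum (flow s) z = z.re := by
  simp [reNum, ← Real.exp_add]

theorem leftSide_flow (k : SL(2, ℝ)) (s : ℝ) : leftSide (k * flow s) = leftSide k := by
  ext z
  rw [leftSide, Set.mem_ofPred_eq, mul_inv_rev, mul_smul, re_smul_neg_iff, ← flow_neg, reNum_flow]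
  rfl

theorem rightSide_flow (k : SL(2, ℝ)) (s : ℝ) : rightSide (k * flow s) = rightSide k := by
  ext z
  rw [rightSide, Set.mem_ofPred_eq, mul_inv_rev, mul_smul, re_smul_pos_iff, ← flow_neg, reNum_flow]
  rfl

theorem neg_smul' (k : SL(2, ℝ)) (z : ℍ) : (-k) • z = k • z := by
  apply UpperHalfPlane.ext
  rw [UpperHalfPlane.coe_specialLinearGroup_apply, UpperHalfPlane.coe_specialLinearGroup_apply]
  simp only [neg_entry, Algebra.algebraMap_self, RingHom.id_apply, Complex.ofReal_neg]
  rw [← neg_div_neg_eq]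
  congr 1 <;> ring

theorem neg_inv' (k : SL(2, ℝ)) : (-k)⁻¹ = -k⁻¹ := by
  rw [inv_eq_iff_mul_eq_one]; simp

theorem leftSide_neg (k : SL(2, ℝ)) : leftSide (-k) = leftSide k := by
  simp [leftSide, neg_smul']

theorem rightSide_neg (k : SL(2, ℝ)) : rightSide (-k) = rightSide k := by
  simp [rightSide, neg_smul']

theorem line_neg (k : SL(2, ℝ)) : line (-k) = line k := by
  simp [line, geodesic, neg_smul', Set.range, neg_mul]

theorem not_mem_left_of_mem_right {k : SL(2, ℝ)} {z : ℍ} (h : z ∈ rightSide k) :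
    z ∉ leftSide k := fun h' => lt_asymm (show 0 < (k⁻¹ • z).re from h) (show (k⁻¹ • z).re < 0 from h')

theorem coe_flow_smul_I (s : ℝ) : ((flow s • I : ℍ) : ℂ) = Real.exp s * Complex.I := by
  rw [UpperHalfPlane.coe_specialLinearGroup_apply]
  simp only [flow_00, flow_01, flow_10, flow_11, Algebra.algebraMap_self, RingHom.id_apply,
    UpperHalfPlane.coe_I, Complex.ofReal_zero, zero_mul, zero_add, add_zero]
  rw [mul_div_right_comm, ← Complex.ofReal_div, ← Real.exp_sub]
  congr 3
  ring

theorem mem_line_iff (k : SL(2, ℝ)) (z : ℍ) : z ∈ line k ↔ (k⁻¹ • z).re = 0 := by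
  constructor
  · rintro ⟨s, rfl⟩
    rw [geodesic, mul_smul, inv_smul_smul, ← UpperHalfPlane.coe_re, coe_flow_smul_I]
    simp
  · intro h
    refine ⟨Real.log (k⁻¹ • z).im, ?_⟩
    rw [geodesic, mul_smul, ← eq_inv_smul_iff]
    apply UpperHalfPlane.ext
    rw [coe_flow_smul_I, Real.exp_log (UpperHalfPlane.im_pos _)]
    apply Complex.ext <;> simp [h]

theorem side_cases (k : SL(2, ℝ)) (z : ℍ) : z ∈ leftSide k ∨ z ∈ line k ∨ z ∈ rightSide k := by
  rw [mem_line_iff]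
  exact lt_trichotomy (k⁻¹ • z).re 0

theorem not_mem_line_of_left {k : SL(2, ℝ)} {z : ℍ} (h : z ∈ leftSide k) : z ∉ line k := by
  rw [mem_line_iff]; exact ne_of_lt h

theorem not_mem_line_of_right {k : SL(2, ℝ)} {z : ℍ} (h : z ∈ rightSide k) : z ∉ line k := by
  rw [mem_line_iff]; exact ne_of_gt h

theorem mem_right_of_not_left {k : SL(2, ℝ)} {z : ℍ} (h : z ∉ line k) (h' : z ∉ leftSide k) :
    z ∈ rightSide k := ((side_cases k z).resolve_left h').resolve_left h

theorem smul_mem_line (m k : SL(2, ℝ)) (z : ℍ) : m • z ∈ line (m * k) ↔ z ∈ line k := by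
  simp [mem_line_iff, mul_smul]

theorem line_halfTurn (k : SL(2, ℝ)) : line (k * halfTurn) = line k := by
  ext z
  constructor
  · intro h
    by_contra h'
    rcases side_cases k z with h1 | h1 | h1
    · rw [← rightSide_halfTurn] at h1; exact not_mem_line_of_right h1 h
    · exact h' h1
    · rw [← leftSide_halfTurn] at h1; exact not_mem_line_of_left h1 h
  · intro h
    by_contra h'
    rcases side_cases (k * halfTurn) z with h1 | h1 | h1
    · rw [leftSide_halfTurn] at h1; exact not_mem_line_of_right h1 h
    · exact h' h1
    · rw [rightSide_halfTurn] at h1; exact not_mem_line_of_left h1 h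

/-! ### Intersections of two geodesics -/

/-- Up to a positive factor, the real part of `m • (e^s i)`. -/
noncomputable def crossFun (m : SL(2, ℝ)) (s : ℝ) : ℝ :=
  m 0 0 * m 1 0 * Real.exp s + m 0 1 * m 1 1 * Real.exp (-s)

theorem reNum_mul_flow_I (m : SL(2, ℝ)) (s : ℝ) : reNum (m * flow s) I = crossFun m s := by
  have h1 : Real.exp (s / 2) * Real.exp (s / 2) = Real.exp s := by rw [← Real.exp_add]; ring_nf
  have h2 : Real.exp (-(s / 2)) * Real.exp (-(s / 2)) = Real.exp (-s) := by
    rw [← Real.exp_add]; ring_nf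
  simp only [reNum, mul_entry, flow_00, flow_01, flow_10, flow_11, mul_zero, add_zero, zero_add,
    UpperHalfPlane.I_re, UpperHalfPlane.coe_I, Complex.normSq_I, crossFun]
  rw [← h1, ← h2]
  ring

theorem inv_smul_geodesic (k h : SL(2, ℝ)) (s : ℝ) :
    k⁻¹ • geodesic h s = (k⁻¹ * h * flow s) • I := by
  rw [geodesic, ← mul_smul, mul_assoc]

theorem geodesic_mem_left (k h : SL(2, ℝ)) (s : ℝ) :
    geodesic h s ∈ leftSide k ↔ crossFun (k⁻¹ * h) s < 0 := by
  rw [leftSide, Set.mem_ofPred_eq, inv_smul_geodesic, re_smul_neg_iff, reNum_mul_flow_I]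

theorem geodesic_mem_right (k h : SL(2, ℝ)) (s : ℝ) :
    geodesic h s ∈ rightSide k ↔ 0 < crossFun (k⁻¹ * h) s := by
  rw [rightSide, Set.mem_ofPred_eq, inv_smul_geodesic, re_smul_pos_iff, reNum_mul_flow_I]

theorem geodesic_mem_line (k h : SL(2, ℝ)) (s : ℝ) :
    geodesic h s ∈ line k ↔ crossFun (k⁻¹ * h) s = 0 := by
  constructor
  · intro h1
    by_contra h2
    rcases lt_or_gt_of_ne h2 with h3 | h3
    · exact not_mem_line_of_left ((geodesic_mem_left _ _ _).2 h3) h1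
    · exact not_mem_line_of_right ((geodesic_mem_right _ _ _).2 h3) h1
  · intro h1
    rcases side_cases k (geodesic h s) with h2 | h2 | h2
    · rw [geodesic_mem_left] at h2; exact absurd h1 h2.ne
    · exact h2
    · rw [geodesic_mem_right] at h2; exact absurd h1 h2.ne'

theorem exp_sub_mul (s s' : ℝ) (hs : s < s') : Real.exp s < Real.exp s' ∧
    Real.exp (-s') < Real.exp (-s) ∧ 0 < Real.exp s ∧ 0 < Real.exp (-s') :=
  ⟨Real.exp_lt_exp.2 hs, Real.exp_lt_exp.2 (neg_lt_neg hs), Real.exp_pos _, Real.exp_pos _⟩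

/-- A geodesic that has crossed from left to right stays on the right. -/
theorem mem_right_of_crossed {k h : SL(2, ℝ)} {s s' u : ℝ} (hs : s < s')
    (h1 : geodesic h s ∈ leftSide k) (h2 : geodesic h s' ∈ rightSide k) (hu : s' ≤ u) :
    geodesic h u ∈ rightSide k := by
  rw [geodesic_mem_left, crossFun] at h1
  rw [geodesic_mem_right, crossFun] at h2 ⊢
  set A := (k⁻¹ * h) 0 0 * (k⁻¹ * h) 1 0
  set B := (k⁻¹ * h) 0 1 * (k⁻¹ * h) 1 1
  obtain ⟨e1, e2, e3, e4⟩ := exp_sub_mul s s' hs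
  have e5 : Real.exp s' ≤ Real.exp u := Real.exp_le_exp.2 hu
  have e6 : Real.exp (-u) ≤ Real.exp (-s') := Real.exp_le_exp.2 (neg_le_neg hu)
  have e7 := Real.exp_pos (-u)
  -- If `A ≤ 0`, then positivity at `s'` forces `B > 0`, so the function is decreasing and cannot be
  -- negative at the earlier time `s`.
  have hA : 0 < A := by
    by_contra hA
    push Not at hA
    have hB : 0 < B := by
      by_contra hB
      push Not at hB
      nlinarith
    nlinarith
  by_cases hB : 0 ≤ B
  · nlinarith [Real.exp_pos u, mul_pos hA (Real.exp_pos u), mul_nonneg hB e7.le]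
  · push Not at hB
    nlinarith

/-- A geodesic that will cross from left to right was on the left before. -/
theorem mem_left_of_crossed {k h : SL(2, ℝ)} {s s' u : ℝ} (hs : s < s')
    (h1 : geodesic h s ∈ leftSide k) (h2 : geodesic h s' ∈ rightSide k) (hu : u ≤ s) :
    geodesic h u ∈ leftSide k := by
  by_contra h3
  rw [geodesic_mem_left, crossFun] at h1 h3
  rw [geodesic_mem_right, crossFun] at h2
  set A := (k⁻¹ * h) 0 0 * (k⁻¹ * h) 1 0
  set B := (k⁻¹ * h) 0 1 * (k⁻¹ * h) 1 1
  push Not at h3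
  obtain ⟨e1, e2, e3, e4⟩ := exp_sub_mul s s' hs
  have e5 : Real.exp u ≤ Real.exp s := Real.exp_le_exp.2 hu
  have e6 : Real.exp (-s) ≤ Real.exp (-u) := Real.exp_le_exp.2 (neg_le_neg hu)
  have e7 := Real.exp_pos u
  have hA : 0 < A := by
    by_contra hA
    push Not at hA
    have hB : 0 < B := by
      by_contra hB
      push Not at hB
      nlinarith
    nlinarith
  have hB : B < 0 := by
    by_contra hB
    push Not at hB
    nlinarith [mul_pos hA e3, mul_nonneg hB (Real.exp_pos (-s)).le]
  nlinarith

/-- Eliminating one coefficient of `A * exp s + B * exp (-s)` between two zeros leaves the other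
times a nonzero difference of exponentials. -/
theorem crossFun_zero_zero {m : SL(2, ℝ)} {s s' : ℝ} (hs : s ≠ s') (h : crossFun m s = 0)
    (h' : crossFun m s' = 0) : m 0 0 * m 1 0 = 0 ∧ m 0 1 * m 1 1 = 0 := by
  wlog hlt : s < s' generalizing s s'
  · exact this hs.symm h' h (lt_of_le_of_ne (not_lt.1 hlt) hs.symm)
  rw [crossFun] at h h'
  set A := m 0 0 * m 1 0
  set B := m 0 1 * m 1 1
  obtain ⟨e1, e2, e3, e4⟩ := exp_sub_mul s s' hlt
  have e5 : Real.exp s * Real.exp (-s) = 1 := by rw [← Real.exp_add]; simp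
  have e6 : Real.exp s' * Real.exp (-s') = 1 := by rw [← Real.exp_add]; simp
  have hA2 : A * (Real.exp s' * Real.exp (-s) - Real.exp s * Real.exp (-s')) = 0 := by
    linear_combination Real.exp (-s) * h' - Real.exp (-s') * h
  have hA : A = 0 := by
    rcases mul_eq_zero.1 hA2 with h0 | h0
    · exact h0
    · nlinarith [Real.exp_pos s', Real.exp_pos (-s)]
  refine ⟨hA, ?_⟩
  rw [hA, zero_mul, zero_add] at h
  exact (mul_eq_zero.1 h).resolve_right (Real.exp_pos _).ne'

theorem diag_or_anti {m : SL(2, ℝ)} (hA : m 0 0 * m 1 0 = 0) (hB : m 0 1 * m 1 1 = 0) :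
    (m 0 1 = 0 ∧ m 1 0 = 0) ∨ (m 0 0 = 0 ∧ m 1 1 = 0) := by
  have hd := det_eq m
  rcases mul_eq_zero.1 hA with h | h <;> rcases mul_eq_zero.1 hB with h' | h'
  · rw [h, h'] at hd; simp at hd
  · exact Or.inr ⟨h, h'⟩
  · exact Or.inl ⟨h', h⟩
  · rw [h, h'] at hd; simp at hd

theorem eq_flow_of_diag {m : SL(2, ℝ)} (h : m 0 1 = 0) (h' : m 1 0 = 0) :
    ∃ s, m = flow s ∨ m = -flow s := by
  have hd := det_eq m
  rw [h, zero_mul, sub_zero] at hd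
  have h0 : m 0 0 ≠ 0 := fun h0 => by simp [h0] at hd
  have h2 : m 1 1 = (m 0 0)⁻¹ := eq_inv_of_mul_eq_one_right hd
  refine ⟨2 * Real.log |m 0 0|, ?_⟩
  have e : Real.exp (Real.log |m 0 0|) = |m 0 0| := Real.exp_log (abs_pos.2 h0)
  have e' : 2 * Real.log |m 0 0| / 2 = Real.log |m 0 0| := by ring
  rcases lt_or_gt_of_ne h0 with h1 | h1
  · right
    apply ext_entries
    · rw [neg_entry, flow_00, e', e, abs_of_neg h1, neg_neg]
    · rw [neg_entry, flow_01, h, neg_zero]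
    · rw [neg_entry, flow_10, h', neg_zero]
    · rw [neg_entry, flow_11, e', Real.exp_neg, e, abs_of_neg h1, h2, inv_neg, neg_neg]
  · left
    apply ext_entries
    · rw [flow_00, e', e, abs_of_pos h1]
    · rw [flow_01, h]
    · rw [flow_10, h']
    · rw [flow_11, e', Real.exp_neg, e, abs_of_pos h1, h2]

theorem eq_flow_halfTurn_of_anti {m : SL(2, ℝ)} (h : m 0 0 = 0) (h' : m 1 1 = 0) :
    ∃ s, m = flow s * halfTurn ∨ m = -(flow s * halfTurn) := by
  have h1 : (m * halfTurn) 0 1 = 0 := by simp [mul_entry, h]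
  have h2 : (m * halfTurn) 1 0 = 0 := by simp [mul_entry, h']
  have key : m = -(m * halfTurn * halfTurn) := by
    rw [mul_assoc, halfTurn_mul_self]; simp
  obtain ⟨s, hs | hs⟩ := eq_flow_of_diag h1 h2
  · exact ⟨s, Or.inr (by rw [key, hs])⟩
  · exact ⟨s, Or.inl (by rw [key, hs]; simp)⟩

theorem line_flow (k : SL(2, ℝ)) (s : ℝ) : line (k * flow s) = line k := by
  ext z
  constructor
  · rintro ⟨u, rfl⟩
    exact ⟨s + u, by simp [geodesic, flow_add, mul_assoc]⟩
  · rintro ⟨u, rfl⟩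
    exact ⟨-s + u, by simp [geodesic, flow_add, flow_neg, mul_assoc]⟩

theorem line_eq_of_diag {k h : SL(2, ℝ)} (h0 : (k⁻¹ * h) 0 1 = 0) (h1 : (k⁻¹ * h) 1 0 = 0) :
    line h = line k := by
  have e : h = k * (k⁻¹ * h) := by simp
  obtain ⟨s, hs | hs⟩ := eq_flow_of_diag h0 h1
  · rw [e, hs, line_flow]
  · rw [e, hs, mul_neg, line_neg, line_flow]

theorem line_eq_of_anti {k h : SL(2, ℝ)} (h0 : (k⁻¹ * h) 0 0 = 0) (h1 : (k⁻¹ * h) 1 1 = 0) :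
    line h = line k := by
  have e : h = k * (k⁻¹ * h) := by simp
  obtain ⟨s, hs | hs⟩ := eq_flow_halfTurn_of_anti h0 h1
  · rw [e, hs, ← mul_assoc, line_halfTurn, line_flow]
  · rw [e, hs, mul_neg, line_neg, ← mul_assoc, line_halfTurn, line_flow]

/-- Two lines with two common points are equal. -/
theorem line_eq_of_crossFun {k h : SL(2, ℝ)} {s s' : ℝ} (hs : s ≠ s')
    (h1 : geodesic h s ∈ line k) (h2 : geodesic h s' ∈ line k) : line h = line k := by
  rw [geodesic_mem_line] at h1 h2
  obtain ⟨hA, hB⟩ := crossFun_zero_zero hs h1 h2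
  rcases diag_or_anti hA hB with ⟨h3, h4⟩ | ⟨h3, h4⟩
  · exact line_eq_of_diag h3 h4
  · exact line_eq_of_anti h3 h4

theorem diag_or_anti_of_line_eq {k h : SL(2, ℝ)} (e : line h = line k) :
    ((k⁻¹ * h) 0 1 = 0 ∧ (k⁻¹ * h) 1 0 = 0) ∨ ((k⁻¹ * h) 0 0 = 0 ∧ (k⁻¹ * h) 1 1 = 0) := by
  have h0 : geodesic h 0 ∈ line k := e ▸ Set.mem_range_self 0
  have h1 : geodesic h 1 ∈ line k := e ▸ Set.mem_range_self 1
  rw [geodesic_mem_line] at h0 h1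
  obtain ⟨hA, hB⟩ := crossFun_zero_zero zero_ne_one h0 h1
  exact diag_or_anti hA hB

/-! ### Positive matrices and nested half planes -/

/-- All entries are positive. -/
def PosMat (m : SL(2, ℝ)) : Prop := ∀ i j, 0 < m i j

/-- All entries are nonzero and have the same sign. -/
def PosUpToSign (m : SL(2, ℝ)) : Prop := PosMat m ∨ PosMat (-m)

theorem posMat_of {m : SL(2, ℝ)} (h00 : 0 < m 0 0) (h01 : 0 < m 0 1) (h10 : 0 < m 1 0)
    (h11 : 0 < m 1 1) : PosMat m := by
  intro i j
  fin_cases i <;> fin_cases j <;> assumption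

theorem PosMat.mul {m n : SL(2, ℝ)} (hm : PosMat m) (hn : PosMat n) : PosMat (m * n) := by
  intro i j
  rw [mul_entry]
  exact add_pos (mul_pos (hm _ _) (hn _ _)) (mul_pos (hm _ _) (hn _ _))

/-- Inserting flows does not disturb positivity, whatever the sign of `t`; this makes the trace
estimate valid along the whole twist orbit. -/
theorem PosMat.flow_mul {m : SL(2, ℝ)} (hm : PosMat m) (t : ℝ) : PosMat (flow t * m) := by
  have e := Real.exp_pos (t / 2)
  have e' := Real.exp_pos (-(t / 2))
  apply posMat_of <;> simp only [mul_entry, flow_00, flow_01, flow_10, flow_11, zero_mul, add_zero,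
    zero_add] <;> first | exact mul_pos e (hm _ _) | exact mul_pos e' (hm _ _)

theorem PosUpToSign.neg {m : SL(2, ℝ)} (hm : PosUpToSign m) : PosUpToSign (-m) := by
  rcases hm with h | h
  · right; rwa [neg_neg]
  · left; exact h

theorem PosUpToSign.mul {m n : SL(2, ℝ)} (hm : PosUpToSign m) (hn : PosUpToSign n) :
    PosUpToSign (m * n) := by
  rcases hm with h | h <;> rcases hn with h' | h'
  · exact Or.inl (h.mul h')
  · right; rw [← mul_neg]; exact h.mul h'
  · right; rw [← neg_mul]; exact h.mul h'
  · left; rw [← neg_mul_neg]; exact h.mul h'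

theorem PosUpToSign.flow_mul {m : SL(2, ℝ)} (hm : PosUpToSign m) (t : ℝ) :
    PosUpToSign (flow t * m) := by
  rcases hm with h | h
  · exact Or.inl (h.flow_mul t)
  · right; rw [← mul_neg]; exact h.flow_mul t

theorem PosUpToSign.ne_zero {m : SL(2, ℝ)} (hm : PosUpToSign m) (i j : Fin 2) : m i j ≠ 0 := by
  rcases hm with h | h
  · exact (h i j).ne'
  · have := h i j
    rw [neg_entry] at this
    linarith

/-- With positive entries, `ad = 1 + bc > 1` and `(a + d)² ≥ 4ad`. -/
theorem PosUpToSign.trace {m : SL(2, ℝ)} (hm : PosUpToSign m) : 2 < |m 0 0 + m 1 1| := by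
  wlog h : PosMat m generalizing m
  · have h' := hm.resolve_left h
    have := this hm.neg h'
    rwa [neg_entry, neg_entry, ← neg_add, abs_neg] at this
  rw [lt_abs]
  left
  have := det_eq m
  nlinarith [mul_pos (h 0 1) (h 1 0), sq_nonneg (m 0 0 - m 1 1), h 0 0, h 1 1]

theorem reNum_neg (m : SL(2, ℝ)) (z : ℍ) : reNum (-m) z = reNum m z := by
  simp [reNum, neg_entry]

/-- A matrix with entries of one sign maps the boundary interval `[0, ∞]` into `(0, ∞)`, and this
interval bounds the right side of the imaginary axis. Positivity is thus the algebraic form of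
strict nesting. -/
theorem PosUpToSign.nested {k k' : SL(2, ℝ)} (hm : PosUpToSign (k⁻¹ * k')) :
    rightSide k' ⊆ rightSide k ∧ leftSide k ⊆ leftSide k' := by
  constructor
  · intro z hz
    have e : k⁻¹ • z = (k⁻¹ * k') • (k'⁻¹ • z) := by simp [mul_smul]
    change 0 < (k⁻¹ • z).re
    rw [e, re_smul_pos_iff]
    have hw : 0 < (k'⁻¹ • z).re := hz
    have hn := Complex.normSq_nonneg ((k'⁻¹ • z : ℍ) : ℂ)
    rcases hm with h | h
    · rw [reNum]
      have := mul_pos (h 0 0) (h 1 0)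
      have := mul_pos (h 0 1) (h 1 1)
      have := mul_pos (add_pos (mul_pos (h 0 0) (h 1 1)) (mul_pos (h 0 1) (h 1 0))) hw
      positivity
    · rw [← reNum_neg, reNum]
      have := mul_pos (h 0 0) (h 1 0)
      have := mul_pos (h 0 1) (h 1 1)
      have := mul_pos (add_pos (mul_pos (h 0 0) (h 1 1)) (mul_pos (h 0 1) (h 1 0))) hw
      positivity
  · intro z hz
    have e : k'⁻¹ • z = (k⁻¹ * k')⁻¹ • (k⁻¹ • z) := by simp [mul_smul]
    change (k'⁻¹ • z).re < 0
    rw [e, re_smul_neg_iff, reNum, inv_00, inv_01, inv_10, inv_11]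
    have hw : (k⁻¹ • z).re < 0 := hz
    have hn := Complex.normSq_nonneg ((k⁻¹ • z : ℍ) : ℂ)
    have key : ∀ m : SL(2, ℝ), PosMat m → m 1 1 * -m 1 0 * Complex.normSq ((k⁻¹ • z : ℍ) : ℂ) +
        (m 1 1 * m 0 0 + -m 0 1 * -m 1 0) * (k⁻¹ • z).re + -m 0 1 * m 0 0 < 0 := by
      intro m h
      have h1 := mul_nonneg (mul_pos (h 1 1) (h 1 0)).le hn
      have h2 := mul_pos (h 0 1) (h 0 0)
      have h3 := mul_neg_of_pos_of_neg
        (add_pos (mul_pos (h 0 0) (h 1 1)) (mul_pos (h 0 1) (h 1 0))) hw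
      nlinarith
    rcases hm with h | h
    · exact key _ h
    · have := key _ h
      simp only [neg_entry] at this
      linarith

theorem exists_crossFun_eq_zero {m : SL(2, ℝ)} (h : (m 0 0 * m 1 0) * (m 0 1 * m 1 1) < 0) :
    ∃ s, crossFun m s = 0 := by
  simp only [crossFun]
  set A := m 0 0 * m 1 0
  set B := m 0 1 * m 1 1
  have hA : A ≠ 0 := fun hA => by simp [hA] at h
  have hp : 0 < -B / A := by
    have : -B / A = -(A * B) / A ^ 2 := by field_simp
    rw [this]
    exact div_pos (by linarith) (by positivity)
  -- The zero of `A * exp s + B * exp (-s)` is where `exp (2 * s) = -B / A`.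
  refine ⟨Real.log (-B / A) / 2, ?_⟩
  set s := Real.log (-B / A) / 2
  have e : Real.exp s * Real.exp s = -B / A := by
    rw [← Real.exp_add, add_halves, Real.exp_log hp]
  have e2 : Real.exp s * Real.exp (-s) = 1 := by rw [← Real.exp_add]; simp
  have e3 : (A * Real.exp s + B * Real.exp (-s)) * Real.exp s = 0 := by
    have : A * (Real.exp s * Real.exp s) = -B := by rw [e]; field_simp
    linear_combination this + B * e2
  exact (mul_eq_zero.1 e3).resolve_right (Real.exp_pos s).ne'

/-- The ends of `k'` in the frame of `k` are the quotients of the entries in each column of `k⁻¹ *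
k'`. A negative product would put them on opposite sides of the imaginary axis. -/
theorem mul_nonneg_of_disjoint {k k' : SL(2, ℝ)} (h : Disjoint (line k') (line k)) :
    0 ≤ ((k⁻¹ * k') 0 0 * (k⁻¹ * k') 1 0) * ((k⁻¹ * k') 0 1 * (k⁻¹ * k') 1 1) := by
  by_contra hc
  obtain ⟨s, hs⟩ := exists_crossFun_eq_zero (not_le.1 hc)
  rw [← geodesic_mem_line] at hs
  exact Set.disjoint_left.1 h (Set.mem_range_self s) hs

/-! ### Discreteness -/

theorem translation_halfTurn (k : SL(2, ℝ)) (t : ℝ) :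
    translation (k * halfTurn) t = (translation k t)⁻¹ := by
  have e : (flow t)⁻¹ = halfTurn * flow t * halfTurn⁻¹ := by
    rw [← flow_neg, eq_mul_inv_iff_mul_eq, flow_mul_halfTurn, neg_neg]
  have e' : (k * flow t * k⁻¹)⁻¹ = k * (flow t)⁻¹ * k⁻¹ := by group
  rw [translation, translation, e', e]
  group

theorem IsOrientedAxis.inv {b g : SL(2, ℝ)} (h : IsOrientedAxis b g) :
    IsOrientedAxis b⁻¹ (g * halfTurn) := by
  obtain ⟨l, hl, h⟩ := h
  refine ⟨l, hl, ?_⟩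
  rw [translation_halfTurn]
  rcases h with rfl | rfl
  · exact Or.inl rfl
  · exact Or.inr (neg_inv' _)

theorem IsOrientedAxis.conj {b g : SL(2, ℝ)} (h : IsOrientedAxis b g) (c : SL(2, ℝ)) :
    IsOrientedAxis (c * b * c⁻¹) (c * g) := by
  obtain ⟨l, hl, h⟩ := h
  refine ⟨l, hl, ?_⟩
  rcases h with rfl | rfl
  · left; simp only [translation]; group
  · right; simp only [translation]; rw [mul_neg, neg_mul]; group

theorem translation_zpow_conj (g c : SL(2, ℝ)) (l : ℝ) (n : ℕ) :
    (translation g l ^ n)⁻¹ * c * translation g l ^ n =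
      g * ((flow (n * l))⁻¹ * (g⁻¹ * c * g) * flow (n * l)) * g⁻¹ := by
  have : translation g l ^ n = translation g (n * l) := by
    induction n with
    | zero => simp [translation, flow_zero]
    | succ n ih =>
      rw [pow_succ, ih, translation, translation, translation, Nat.cast_succ, add_mul, one_mul,
        flow_add]
      group
  rw [this, translation]
  group

/-- If `c` fixes the attracting end of `a` but not the repelling one, the conjugates `a⁻ʲ * c * aʲ`
are pairwise distinct and only their off-diagonal entry changes, decaying like `exp (-(j * l))`.
Infinitely many elements of Γ would then move `g • I` into a compact arc. -/
theorem upper_of_axis (Γ : Subgroup SL(2, ℝ)) [ProperlyDiscontinuousSMul Γ ℍ] {a g c : SL(2, ℝ)}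
    (ha : a ∈ Γ) (hc : c ∈ Γ) (hg : IsOrientedAxis a g) (h10 : (g⁻¹ * c * g) 1 0 = 0) :
    (g⁻¹ * c * g) 0 1 = 0 := by
  obtain ⟨l, hl, hal⟩ := hg
  set n := g⁻¹ * c * g with hn
  by_contra h01
  have hd := det_eq n
  rw [h10, mul_zero, sub_zero] at hd
  let mat : ℝ → SL(2, ℝ) := fun v => ⟨!![n 0 0, n 0 1 * v; 0, n 1 1], by
    rw [Matrix.det_fin_two_of]; linarith⟩
  have hmat : Continuous mat := by
    apply Continuous.subtype_mk
    refine continuous_matrix fun i j => ?_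
    fin_cases i <;> fin_cases j <;> simp <;> fun_prop
  let K : Set ℍ := (fun v => g • mat v • I) '' Set.Icc 0 1
  have hK : IsCompact K := isCompact_Icc.image (by fun_prop)
  have hfin := ProperlyDiscontinuousSMul.finite_disjoint_inter_image (Γ := Γ)
    (isCompact_singleton (x := g • I)) hK
  let x : ℕ → Γ := fun j => ⟨(a ^ j)⁻¹ * c * a ^ j,
    Γ.mul_mem (Γ.mul_mem (Γ.inv_mem (Γ.pow_mem ha j)) hc) (Γ.pow_mem ha j)⟩
  have hx : ∀ j, (x j : SL(2, ℝ)) = g * mat (Real.exp (-(j * l))) * g⁻¹ := by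
    intro j
    have e1 : (a ^ j)⁻¹ * c * a ^ j = (translation g l ^ j)⁻¹ * c * translation g l ^ j := by
      rcases hal with rfl | rfl
      · rfl
      · rcases neg_one_pow_eq_or SL(2, ℝ) j with h | h
        · rw [neg_pow, h, one_mul]
        · rw [neg_pow, h, neg_one_mul, neg_inv']; simp only [neg_mul, mul_neg, neg_neg]
    change (a ^ j)⁻¹ * c * a ^ j = _
    rw [e1, translation_zpow_conj, ← hn]
    congr 2
    have e : Real.exp (j * l / 2) * Real.exp (-(j * l / 2)) = 1 := by rw [← Real.exp_add]; simp
    have e' : Real.exp (-(j * l / 2)) * Real.exp (-(j * l / 2)) = Real.exp (-(j * l)) := by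
      rw [← Real.exp_add]; ring_nf
    apply ext_entries <;>
      simp only [mul_entry, inv_00, inv_01, inv_10, inv_11, flow_00, flow_01, flow_10, flow_11, h10]
    · change _ = n 0 0
      linear_combination n 0 0 * e
    · change _ = n 0 1 * _
      linear_combination n 0 1 * e'
    · change _ = (0 : ℝ)
      ring
    · change _ = n 1 1
      linear_combination n 1 1 * e
  have hinj : Function.Injective x := by
    intro i j hij
    have h1 : (x i : SL(2, ℝ)) = x j := by rw [hij]
    rw [hx, hx, mul_left_inj, mul_right_inj] at h1
    have h2 : n 0 1 * Real.exp (-(i * l)) = n 0 1 * Real.exp (-(j * l)) :=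
      congrArg (fun m : SL(2, ℝ) => m 0 1) h1
    have h3 := Real.exp_injective (mul_left_cancel₀ h01 h2)
    have h4 : (i : ℝ) = j := mul_right_cancel₀ hl.ne' (neg_injective h3)
    exact_mod_cast h4
  refine Set.infinite_range_of_injective hinj (hfin.subset ?_)
  rintro _ ⟨j, rfl⟩
  refine ⟨g • mat (Real.exp (-(j * l))) • I, ⟨g • I, rfl, ?_⟩, _, ⟨(Real.exp_pos _).le, ?_⟩, rfl⟩
  · change (x j : SL(2, ℝ)) • g • I = _
    rw [hx]
    simp [mul_smul]
  · rw [Real.exp_le_one_iff]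
    have : 0 ≤ (j : ℝ) * l := by positivity
    linarith

theorem halfTurn_conj_01 (n : SL(2, ℝ)) : (halfTurn⁻¹ * n * halfTurn) 0 1 = -n 1 0 := by
  simp only [mul_entry, inv_00, inv_01, halfTurn_01,
    halfTurn_11]
  ring

theorem halfTurn_conj_10 (n : SL(2, ℝ)) : (halfTurn⁻¹ * n * halfTurn) 1 0 = -n 0 1 := by
  simp only [mul_entry, inv_10, inv_11, halfTurn_00, halfTurn_10]
  ring

theorem lower_of_axis (Γ : Subgroup SL(2, ℝ)) [ProperlyDiscontinuousSMul Γ ℍ] {a g c : SL(2, ℝ)}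
    (ha : a ∈ Γ) (hc : c ∈ Γ) (hg : IsOrientedAxis a g) (h01 : (g⁻¹ * c * g) 0 1 = 0) :
    (g⁻¹ * c * g) 1 0 = 0 := by
  have e : (g * halfTurn)⁻¹ * c * (g * halfTurn) = halfTurn⁻¹ * (g⁻¹ * c * g) * halfTurn := by
    group
  have := upper_of_axis Γ (Γ.inv_mem ha) hc hg.inv (by rw [e, halfTurn_conj_10, h01, neg_zero])
  rwa [e, halfTurn_conj_01, neg_eq_zero] at this

/-- Axes of a discrete group with a common endpoint are equal. -/
theorem axes_cases (Γ : Subgroup SL(2, ℝ)) [ProperlyDiscontinuousSMul Γ ℍ] {a b g h : SL(2, ℝ)}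
    (ha : a ∈ Γ) (hb : b ∈ Γ) (hg : IsOrientedAxis a g) (hh : IsOrientedAxis b h) :
    ((g⁻¹ * h) 0 1 = 0 ∧ (g⁻¹ * h) 1 0 = 0) ∨ ((g⁻¹ * h) 0 0 = 0 ∧ (g⁻¹ * h) 1 1 = 0) ∨
      ∀ i j, (g⁻¹ * h) i j ≠ 0 := by
  have hu := upper_of_axis Γ ha hb hg
  have hv := lower_of_axis Γ ha hb hg
  obtain ⟨l, hl, hbl⟩ := hh
  set m := g⁻¹ * h with hm
  set δ := Real.exp (l / 2) - Real.exp (-(l / 2)) with hδ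
  have hδ0 : δ ≠ 0 := sub_ne_zero.2 (Real.exp_lt_exp.2 (by linarith)).ne'
  have e : g⁻¹ * translation h l * g = m * flow l * m⁻¹ := by
    rw [hm, translation]; group
  have e01 : (m * flow l * m⁻¹) 0 1 = -(δ * (m 0 0 * m 0 1)) := by
    simp only [mul_entry, inv_01, inv_11, flow_00, flow_01, flow_10, flow_11]
    rw [hδ]; ring
  have e10 : (m * flow l * m⁻¹) 1 0 = δ * (m 1 0 * m 1 1) := by
    simp only [mul_entry, inv_00, inv_10, flow_00, flow_01, flow_10, flow_11]
    rw [hδ]; ring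
  -- The left side says that 0 is an end of the second axis in the frame of the first, the right
  -- side that ∞ is. By discreteness `b` fixes both or neither.
  have iff : m 0 0 * m 0 1 = 0 ↔ m 1 0 * m 1 1 = 0 := by
    have h1 : (g⁻¹ * b * g) 0 1 = 0 ↔ m 0 0 * m 0 1 = 0 := by
      rcases hbl with rfl | rfl
      · rw [e, e01, neg_eq_zero, mul_eq_zero, or_iff_right hδ0]
      · rw [mul_neg, neg_mul, e, neg_entry, e01, neg_neg, mul_eq_zero, or_iff_right hδ0]
    have h2 : (g⁻¹ * b * g) 1 0 = 0 ↔ m 1 0 * m 1 1 = 0 := by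
      rcases hbl with rfl | rfl
      · rw [e, e10, mul_eq_zero, or_iff_right hδ0]
      · rw [mul_neg, neg_mul, e, neg_entry, e10, neg_eq_zero, mul_eq_zero, or_iff_right hδ0]
    rw [← h1, ← h2]
    exact ⟨hv, hu⟩
  by_cases h0 : m 0 0 * m 0 1 = 0
  · have hd := det_eq m
    rcases mul_eq_zero.1 h0 with h1 | h1 <;> rcases mul_eq_zero.1 (iff.1 h0) with h2 | h2
    · rw [h1, h2] at hd; simp at hd
    · exact Or.inr (Or.inl ⟨h1, h2⟩)
    · exact Or.inl ⟨h1, h2⟩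
    · rw [h1, h2] at hd; simp at hd
  · right; right
    have h1 := mt iff.2 h0
    rw [mul_eq_zero, not_or] at h0 h1
    intro i j
    fin_cases i <;> fin_cases j
    exacts [h0.1, h0.2, h1.1, h1.2]

theorem axes_ne_zero (Γ : Subgroup SL(2, ℝ)) [ProperlyDiscontinuousSMul Γ ℍ] {a b g h : SL(2, ℝ)}
    (ha : a ∈ Γ) (hb : b ∈ Γ) (hg : IsOrientedAxis a g) (hh : IsOrientedAxis b h)
    (hne : line g ≠ line h) : ∀ i j, (g⁻¹ * h) i j ≠ 0 := by
  rcases axes_cases Γ ha hb hg hh with ⟨h0, h1⟩ | ⟨h0, h1⟩ | h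
  · exact absurd (line_eq_of_diag h0 h1).symm hne
  · exact absurd (line_eq_of_anti h0 h1).symm hne
  · exact h

/-! ### Relative position of two lifts -/

/-- The line of `g` covers a simple closed geodesic of `ℍ / Γ`. -/
structure IsSimpleAxis (Γ : Subgroup SL(2, ℝ)) (g : SL(2, ℝ)) : Prop where
  axis : ∃ a ∈ Γ, IsOrientedAxis a g
  simple : IsSimple Γ g

/-- `k` is a lift up to sign. -/
def IsSignedLift (Γ : Subgroup SL(2, ℝ)) (g k : SL(2, ℝ)) : Prop :=
  IsLift Γ g k ∨ IsLift Γ g (-k)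

section Lifts

variable {Γ : Subgroup SL(2, ℝ)} {g : SL(2, ℝ)}

theorem IsSignedLift.neg {k : SL(2, ℝ)} (h : IsSignedLift Γ g k) : IsSignedLift Γ g (-k) := by
  rw [IsSignedLift, neg_neg]
  exact h.symm

theorem IsLift.mul {k γ : SL(2, ℝ)} (h : IsLift Γ g k) (hγ : γ ∈ Γ) : IsLift Γ g (γ * k) := by
  obtain ⟨c, hc, h | h⟩ := h
  · exact ⟨γ * c, Γ.mul_mem hγ hc, Or.inl (by rw [h, mul_assoc])⟩
  · exact ⟨γ * c, Γ.mul_mem hγ hc, Or.inr (by rw [h]; simp only [mul_assoc])⟩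

theorem IsSignedLift.mul {k γ : SL(2, ℝ)} (h : IsSignedLift Γ g k) (hγ : γ ∈ Γ) :
    IsSignedLift Γ g (γ * k) := by
  rcases h with h | h
  · exact Or.inl (h.mul hγ)
  · right; rw [← mul_neg]; exact h.mul hγ

/-- Because of this sign the set of lifts is stable under reversal only up to sign, which is the
reason for working with `IsSignedLift`. -/
theorem mul_halfTurn_halfTurn (k : SL(2, ℝ)) : k * halfTurn * halfTurn = -k := by
  rw [mul_assoc, halfTurn_mul_self, mul_neg, mul_one]

theorem IsLift.halfTurn {k : SL(2, ℝ)} (h : IsLift Γ g k) : IsSignedLift Γ g (k * halfTurn) := by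
  obtain ⟨c, hc, h | h⟩ := h
  · exact Or.inl ⟨c, hc, Or.inr (by rw [h])⟩
  · exact Or.inr ⟨c, hc, Or.inl (by rw [h, mul_halfTurn_halfTurn, neg_neg])⟩

theorem IsSignedLift.halfTurn {k : SL(2, ℝ)} (h : IsSignedLift Γ g k) :
    IsSignedLift Γ g (k * halfTurn) := by
  rcases h with h | h
  · exact h.halfTurn
  · have := h.halfTurn.neg
    rwa [neg_mul, neg_neg] at this

theorem isOrientedAxis_neg {b k : SL(2, ℝ)} (h : IsOrientedAxis b k) : IsOrientedAxis b (-k) := by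
  obtain ⟨l, hl, h⟩ := h
  have : translation (-k) l = translation k l := by simp [translation]
  exact ⟨l, hl, by rwa [this]⟩

theorem IsSignedLift.axis {k : SL(2, ℝ)} (hS : IsSimpleAxis Γ g) (h : IsSignedLift Γ g k) :
    ∃ a ∈ Γ, IsOrientedAxis a k := by
  obtain ⟨a, ha, hax⟩ := hS.axis
  have key : ∀ k, IsLift Γ g k → ∃ a ∈ Γ, IsOrientedAxis a k := by
    rintro k ⟨c, hc, rfl | rfl⟩
    · exact ⟨_, Γ.mul_mem (Γ.mul_mem hc ha) (Γ.inv_mem hc), hax.conj c⟩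
    · exact ⟨_, Γ.inv_mem (Γ.mul_mem (Γ.mul_mem hc ha) (Γ.inv_mem hc)), (hax.conj c).inv⟩
  rcases h with h | h
  · exact key k h
  · obtain ⟨b, hb, hbk⟩ := key _ h
    exact ⟨b, hb, by simpa using isOrientedAxis_neg hbk⟩

theorem IsSignedLift.line_eq {k : SL(2, ℝ)} (h : IsSignedLift Γ g k) :
    ∃ γ ∈ Γ, line k = line (γ * g) := by
  rcases h with ⟨c, hc, h | h⟩ | ⟨c, hc, h | h⟩
  · exact ⟨c, hc, by rw [h]⟩
  · exact ⟨c, hc, by rw [h, line_halfTurn]⟩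
  · exact ⟨c, hc, by rw [← line_neg, h]⟩
  · exact ⟨c, hc, by rw [← line_neg, h, line_halfTurn]⟩

theorem line_mul (m k : SL(2, ℝ)) : line (m * k) = (m • ·) '' line k := by
  ext z
  constructor
  · intro h
    exact ⟨m⁻¹ • z, by rwa [← smul_mem_line m, smul_inv_smul], smul_inv_smul _ _⟩
  · rintro ⟨w, hw, rfl⟩
    exact (smul_mem_line m k w).2 hw

theorem rightSide_mul (m k : SL(2, ℝ)) : rightSide (m * k) = (m • ·) '' rightSide k := by
  ext z
  rw [mem_rightSide_mul]
  exact ⟨fun hz => ⟨_, hz, smul_inv_smul _ _⟩, by rintro ⟨w, hw, rfl⟩; simpa using hw⟩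

theorem leftSide_mul (m k : SL(2, ℝ)) : leftSide (m * k) = (m • ·) '' leftSide k := by
  rw [← rightSide_halfTurn, ← rightSide_halfTurn, mul_assoc, rightSide_mul]

theorem lines_eq_or_disjoint {k k' : SL(2, ℝ)} (hS : IsSimpleAxis Γ g) (hk : IsSignedLift Γ g k)
    (hk' : IsSignedLift Γ g k') : line k' = line k ∨ Disjoint (line k') (line k) := by
  obtain ⟨c, hc, e⟩ := hk.line_eq
  obtain ⟨c', hc', e'⟩ := hk'.line_eq
  have e1 : c' * g = c * ((c⁻¹ * c') * g) := by group
  rw [e, e', e1, line_mul c, line_mul c g]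
  rcases hS.simple (c⁻¹ * c') (Γ.mul_mem (Γ.inv_mem hc) hc') with h | h
  · left; rw [h]
  · right
    exact (Set.disjoint_image_iff (MulAction.injective c)).2 h

/-- The six possible positions of two lifts. -/
theorem lift_cases [ProperlyDiscontinuousSMul Γ ℍ] {k k' : SL(2, ℝ)} (hS : IsSimpleAxis Γ g)
    (hk : IsSignedLift Γ g k) (hk' : IsSignedLift Γ g k') :
    (∃ s, k' = k * flow s ∨ k' = -(k * flow s)) ∨
    (∃ s, k' = k * flow s * halfTurn ∨ k' = -(k * flow s * halfTurn)) ∨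
    PosUpToSign (k⁻¹ * k') ∨ PosUpToSign (k'⁻¹ * k) ∨
    PosUpToSign (k⁻¹ * (k' * halfTurn)) ∨ PosUpToSign ((k * halfTurn)⁻¹ * k') := by
  obtain ⟨a, ha, hak⟩ := hk.axis hS
  obtain ⟨a', ha', hak'⟩ := hk'.axis hS
  have e : k' = k * (k⁻¹ * k') := by simp
  rcases axes_cases Γ ha ha' hak hak' with ⟨h0, h1⟩ | ⟨h0, h1⟩ | h
  · left
    obtain ⟨s, hs | hs⟩ := eq_flow_of_diag h0 h1
    · exact ⟨s, Or.inl (by rw [← hs, ← e])⟩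
    · exact ⟨s, Or.inr (by rw [← mul_neg, ← hs, ← e])⟩
  · right; left
    obtain ⟨s, hs | hs⟩ := eq_flow_halfTurn_of_anti h0 h1
    · exact ⟨s, Or.inl (by rw [mul_assoc, ← hs, ← e])⟩
    · exact ⟨s, Or.inr (by rw [mul_assoc, ← mul_neg, ← hs, ← e])⟩
  · right; right
    have hd : Disjoint (line k') (line k) := by
      refine (lines_eq_or_disjoint hS hk hk').resolve_left fun hl => ?_
      rcases diag_or_anti_of_line_eq hl with ⟨h0, -⟩ | ⟨h0, -⟩
      · exact h 0 1 h0
      · exact h 0 0 h0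
    have hn := mul_nonneg_of_disjoint hd
    have e1 : k'⁻¹ * k = (k⁻¹ * k')⁻¹ := by group
    have e2 : k⁻¹ * (k' * halfTurn) = (k⁻¹ * k') * halfTurn := by group
    have e3 : (k * halfTurn)⁻¹ * k' = halfTurn⁻¹ * (k⁻¹ * k') := by group
    rw [e1, e2, e3]
    generalize k⁻¹ * k' = m at h hn
    -- The number of negative entries is even. With the first entry made positive, four sign
    -- patterns remain, one for each way in which two disjoint oriented lines can lie.
    have hp : 0 < (m 0 0 * m 0 1) * (m 1 0 * m 1 1) := lt_of_le_of_ne (by linarith)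
      (mul_ne_zero (mul_ne_zero (h 0 0) (h 0 1)) (mul_ne_zero (h 1 0) (h 1 1))).symm
    wlog h00 : 0 < m 0 0 generalizing m
    · have h00' : m 0 0 < 0 := lt_of_le_of_ne (not_lt.1 h00) (h 0 0)
      have := this (-m) (fun i j => by rw [neg_entry]; exact neg_ne_zero.2 (h i j))
        (by simpa [neg_entry] using hn) (by simpa [neg_entry] using hp)
        (by rw [neg_entry]; linarith)
      rw [neg_inv', neg_mul, mul_neg] at this
      rcases this with h | h | h | h
      · exact Or.inl (by simpa using h.neg)
      · exact Or.inr (Or.inl (by simpa using h.neg))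
      · exact Or.inr (Or.inr (Or.inl (by simpa using h.neg)))
      · exact Or.inr (Or.inr (Or.inr (by simpa using h.neg)))
    rcases lt_or_gt_of_ne (h 0 1) with h01 | h01 <;> rcases lt_or_gt_of_ne (h 1 0) with h10 | h10
    · have h11 : 0 < m 1 1 := by
        by_contra hc
        nlinarith [mul_neg_of_pos_of_neg h00 h01, mul_nonneg_of_nonpos_of_nonpos h10.le
          (not_lt.1 hc)]
      right; left; left
      apply posMat_of <;> simp only [inv_00, inv_01, inv_10, inv_11] <;> linarith
    · have h11 : m 1 1 < 0 := by
        by_contra hc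
        nlinarith [mul_neg_of_pos_of_neg h00 h01, mul_nonneg h10.le (not_lt.1 hc)]
      right; right; left; right
      apply posMat_of <;> simp [neg_entry, mul_entry] <;> linarith
    · have h11 : m 1 1 < 0 := by
        by_contra hc
        nlinarith [mul_pos h00 h01, mul_nonpos_of_nonpos_of_nonneg h10.le (not_lt.1 hc)]
      right; right; right; right
      apply posMat_of <;>
        simp [neg_entry, mul_entry, inv_00, inv_01, inv_10, inv_11] <;> linarith
    · have h11 : 0 < m 1 1 := by
        by_contra hc
        nlinarith [mul_pos h00 h01, mul_nonpos_of_nonneg_of_nonpos h10.le (not_lt.1 hc)]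
      left; left
      exact posMat_of h00 h01 h10 h11

theorem rightSide_nonempty (k : SL(2, ℝ)) : (rightSide k).Nonempty := by
  refine ⟨k • ⟨1 + Complex.I, by simp⟩, ?_⟩
  change 0 < (k⁻¹ • k • _ : ℍ).re
  rw [inv_smul_smul, ← UpperHalfPlane.coe_re]
  simp

theorem leftSide_nonempty (k : SL(2, ℝ)) : (leftSide k).Nonempty := by
  rw [← rightSide_halfTurn]
  exact rightSide_nonempty _

theorem PosUpToSign.geodesic_right {k k' : SL(2, ℝ)} (hm : PosUpToSign (k⁻¹ * k')) (s : ℝ) :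
    geodesic k' s ∈ rightSide k := by
  rw [geodesic_mem_right, crossFun]
  have e := Real.exp_pos s
  have e' := Real.exp_pos (-s)
  rcases hm with h | h
  · exact add_pos (mul_pos (mul_pos (h _ _) (h _ _)) e) (mul_pos (mul_pos (h _ _) (h _ _)) e')
  · have := add_pos (mul_pos (mul_pos (h 0 0) (h 1 0)) e) (mul_pos (mul_pos (h 0 1) (h 1 1)) e')
    simpa only [neg_entry, neg_mul_neg] using this

theorem PosUpToSign.geodesic_left {k k' : SL(2, ℝ)} (hm : PosUpToSign (k⁻¹ * k')) (s : ℝ) :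
    geodesic k s ∈ leftSide k' := by
  have e1 : k'⁻¹ * k = (k⁻¹ * k')⁻¹ := by group
  rw [geodesic_mem_left, crossFun, e1, inv_00, inv_01, inv_10, inv_11]
  have e := Real.exp_pos s
  have e' := Real.exp_pos (-s)
  rcases hm with h | h
  · have := add_pos (mul_pos (mul_pos (h 1 1) (h 1 0)) e) (mul_pos (mul_pos (h 0 1) (h 0 0)) e')
    linarith
  · have := add_pos (mul_pos (mul_pos (h 1 1) (h 1 0)) e) (mul_pos (mul_pos (h 0 1) (h 0 0)) e')
    simp only [neg_entry, neg_mul_neg] at this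
    linarith

theorem geodesic_self_mem_line (k : SL(2, ℝ)) (s : ℝ) : geodesic k s ∈ line k :=
  Set.mem_range_self s

theorem PosUpToSign.ssubset {k k' : SL(2, ℝ)} (hm : PosUpToSign (k⁻¹ * k')) :
    rightSide k' ⊂ rightSide k ∧ leftSide k ⊂ leftSide k' := by
  refine ⟨⟨hm.nested.1, fun h => ?_⟩, ⟨hm.nested.2, fun h => ?_⟩⟩
  · exact not_mem_line_of_right (h (hm.geodesic_right 0)) (geodesic_self_mem_line _ _)
  · exact not_mem_line_of_left (h (hm.geodesic_left 0)) (geodesic_self_mem_line _ _)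

theorem translation_flow (k : SL(2, ℝ)) (s t : ℝ) :
    translation (k * flow s) t = translation k t := by
  have : flow s * flow t = flow t * flow s := by rw [← flow_add, ← flow_add, add_comm]
  rw [translation, translation, mul_assoc k, this]
  group

theorem translation_neg (k : SL(2, ℝ)) (t : ℝ) : translation (-k) t = translation k t := by
  simp [translation]

/-- The relative position of the sides of two lifts. -/
theorem lift_sides [ProperlyDiscontinuousSMul Γ ℍ] {k k' : SL(2, ℝ)} (hS : IsSimpleAxis Γ g)
    (hk : IsSignedLift Γ g k) (hk' : IsSignedLift Γ g k') :
    (rightSide k' = rightSide k ∧ leftSide k' = leftSide k ∧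
      ∀ t, translation k' t = translation k t) ∨
    (rightSide k' = leftSide k ∧ leftSide k' = rightSide k) ∨
    PosUpToSign (k⁻¹ * k') ∨ PosUpToSign (k'⁻¹ * k) ∨
    (leftSide k' ⊆ rightSide k ∧ leftSide k ⊆ rightSide k') ∨
    (rightSide k' ⊆ leftSide k ∧ rightSide k ⊆ leftSide k') := by
  rcases lift_cases hS hk hk' with ⟨s, h⟩ | ⟨s, h⟩ | h | h | h | h
  · left
    rcases h with rfl | rfl <;>
      simp [rightSide_neg, leftSide_neg, translation_neg, translation_flow, rightSide_flow,
        leftSide_flow]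
  · right; left
    rcases h with rfl | rfl <;>
      simp [rightSide_neg, leftSide_neg, rightSide_flow, leftSide_flow, rightSide_halfTurn,
        leftSide_halfTurn]
  · exact Or.inr (Or.inr (Or.inl h))
  · exact Or.inr (Or.inr (Or.inr (Or.inl h)))
  · have := h.nested
    rw [rightSide_halfTurn, leftSide_halfTurn] at this
    exact Or.inr (Or.inr (Or.inr (Or.inr (Or.inl this))))
  · have := h.nested
    rw [rightSide_halfTurn, leftSide_halfTurn] at this
    exact Or.inr (Or.inr (Or.inr (Or.inr (Or.inr this))))

theorem disjoint_sides (k : SL(2, ℝ)) {z : ℍ} (h : z ∈ leftSide k) (h' : z ∈ rightSide k) : False :=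
  not_mem_left_of_mem_right h' h

/-- The half plane determines a lift up to sign and sliding along the line, and neither affects the
translation. Lists of lifts may therefore be compared through their half planes. -/
theorem same_of_rightSide_eq [ProperlyDiscontinuousSMul Γ ℍ] {k k' : SL(2, ℝ)}
    (hS : IsSimpleAxis Γ g) (hk : IsSignedLift Γ g k) (hk' : IsSignedLift Γ g k')
    (e : rightSide k' = rightSide k) :
    leftSide k' = leftSide k ∧ ∀ t, translation k' t = translation k t := by
  obtain ⟨z, hz⟩ := rightSide_nonempty k
  obtain ⟨w, hw⟩ := leftSide_nonempty k
  rcases lift_sides hS hk hk' with h | h | h | h | h | h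
  · exact h.2
  · exact (disjoint_sides k (h.1 ▸ e ▸ hz) hz).elim
  · exact absurd e h.ssubset.1.ne
  · exact absurd e h.ssubset.1.ne'
  · exact (disjoint_sides k hw (e ▸ h.2 hw)).elim
  · exact (disjoint_sides k (h.1 (e ▸ hz)) hz).elim

theorem pos_of_ssubset [ProperlyDiscontinuousSMul Γ ℍ] {k k' : SL(2, ℝ)}
    (hS : IsSimpleAxis Γ g) (hk : IsSignedLift Γ g k) (hk' : IsSignedLift Γ g k')
    (e : rightSide k' ⊂ rightSide k) : PosUpToSign (k⁻¹ * k') := by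
  obtain ⟨z, hz⟩ := rightSide_nonempty k'
  obtain ⟨w, hw⟩ := leftSide_nonempty k
  rcases lift_sides hS hk hk' with h | h | h | h | h | h
  · exact absurd h.1 e.ne
  · exact (disjoint_sides k (h.1 ▸ hz) (e.1 hz)).elim
  · exact h
  · exact absurd (e.trans h.ssubset.1) (ssubset_irrefl _)
  · exact (disjoint_sides k hw (e.1 (h.2 hw))).elim
  · exact (disjoint_sides k (h.1 hz) (e.1 hz)).elim

/-- Two lifts are nested when three of the four intersections of their sides are nonempty. -/
theorem pos_of_points [ProperlyDiscontinuousSMul Γ ℍ] {k k' : SL(2, ℝ)} {x y z : ℍ}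
    (hS : IsSimpleAxis Γ g) (hk : IsSignedLift Γ g k) (hk' : IsSignedLift Γ g k')
    (hx : x ∈ leftSide k) (hx' : x ∈ leftSide k') (hy : y ∈ rightSide k) (hy' : y ∈ leftSide k')
    (hz : z ∈ rightSide k) (hz' : z ∈ rightSide k') : PosUpToSign (k⁻¹ * k') := by
  rcases lift_sides hS hk hk' with h | h | h | h | h | h
  · exact (disjoint_sides k (h.2.1 ▸ hy') hy).elim
  · exact (disjoint_sides k (h.1 ▸ hz') hz).elim
  · exact h
  · exact (disjoint_sides k' hy' (h.nested.1 hy)).elim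
  · exact (disjoint_sides k hx (h.1 hx')).elim
  · exact (disjoint_sides k (h.1 hz') hz).elim

end Lifts

/-! ### Lists of nested lifts -/

section Lists

variable {Γ : Subgroup SL(2, ℝ)} {g : SL(2, ℝ)}

/-- The lifts that separate `x` from `z`, oriented from `x` to `z`. -/
def Separates (Γ : Subgroup SL(2, ℝ)) (g : SL(2, ℝ)) (x z : ℍ) (k : SL(2, ℝ)) : Prop :=
  IsSignedLift Γ g k ∧ x ∈ leftSide k ∧ z ∈ rightSide k

/-- `L` lists, each of them once and in nested order, the half planes of the class `C`. -/
structure IsNestedList (C : SL(2, ℝ) → Prop) (L : List SL(2, ℝ)) : Prop where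
  mem : ∀ k ∈ L, C k
  complete : ∀ k, C k → ∃ k' ∈ L, rightSide k' = rightSide k
  sorted : L.Pairwise (fun k k' => rightSide k' ⊂ rightSide k)

theorem IsNestedList.congr {C C' : SL(2, ℝ) → Prop} {L : List SL(2, ℝ)} (h : IsNestedList C L)
    (e : ∀ k, C k ↔ C' k) : IsNestedList C' L :=
  ⟨fun k hk => (e k).1 (h.mem k hk), fun k hk => h.complete k ((e k).2 hk), h.sorted⟩

theorem IsNestedList.append {C C' : SL(2, ℝ) → Prop} {L L' : List SL(2, ℝ)}
    (h : IsNestedList C L) (h' : IsNestedList C' L')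
    (hs : ∀ k k', C k → C' k' → rightSide k' ⊂ rightSide k) :
    IsNestedList (fun k => C k ∨ C' k) (L ++ L') where
  mem k hk := (List.mem_append.1 hk).imp (h.mem k) (h'.mem k)
  complete k hk := by
    rcases hk with hk | hk
    · obtain ⟨k', h1, h2⟩ := h.complete k hk
      exact ⟨k', List.mem_append_left _ h1, h2⟩
    · obtain ⟨k', h1, h2⟩ := h'.complete k hk
      exact ⟨k', List.mem_append_right _ h1, h2⟩
  sorted := List.pairwise_append.2
    ⟨h.sorted, h'.sorted, fun k hk k' hk' => hs k k' (h.mem k hk) (h'.mem k' hk')⟩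

/-- Traversing the lifts backwards replaces right sides by left sides, and this reverses the
inclusions. -/
theorem IsNestedList.reverse [ProperlyDiscontinuousSMul Γ ℍ] (hS : IsSimpleAxis Γ g)
    {C : SL(2, ℝ) → Prop} {L : List SL(2, ℝ)} (h : IsNestedList C L)
    (hC : ∀ k, C k → IsSignedLift Γ g k) (hneg : ∀ k, C k → C (-k)) :
    IsNestedList (fun k => C (k * halfTurn)) (L.reverse.map (· * halfTurn)) where
  mem k hk := by
    obtain ⟨k', h1, rfl⟩ := List.mem_map.1 hk
    rw [mul_halfTurn_halfTurn]
    exact hneg _ (h.mem _ (List.mem_reverse.1 h1))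
  complete k hk := by
    obtain ⟨k', h1, h2⟩ := h.complete _ hk
    refine ⟨k' * halfTurn, List.mem_map.2 ⟨k', List.mem_reverse.2 h1, rfl⟩, ?_⟩
    rw [rightSide_halfTurn, (same_of_rightSide_eq hS (hC _ hk) (hC _ (h.mem _ h1)) h2).1,
      leftSide_halfTurn]
  sorted := by
    rw [List.pairwise_map, List.pairwise_reverse]
    refine h.sorted.imp_of_mem fun {k k'} hk hk' hlt => ?_
    rw [rightSide_halfTurn, rightSide_halfTurn]
    exact (pos_of_ssubset hS (hC _ (h.mem _ hk)) (hC _ (h.mem _ hk')) hlt).ssubset.2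

theorem IsNestedList.mul {C : SL(2, ℝ) → Prop} {L : List SL(2, ℝ)} (h : IsNestedList C L)
    (γ : SL(2, ℝ)) : IsNestedList (fun k => C (γ⁻¹ * k)) (L.map (γ * ·)) := by
  refine ⟨fun k hk => ?_, fun k hk => ?_, ?_⟩
  · obtain ⟨k', h1, rfl⟩ := List.mem_map.1 hk
    simpa using h.mem _ h1
  · obtain ⟨k', h1, h2⟩ := h.complete _ hk
    refine ⟨γ * k', List.mem_map.2 ⟨k', h1, rfl⟩, ?_⟩
    rw [rightSide_mul, h2, ← rightSide_mul, mul_inv_cancel_left]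
  · rw [List.pairwise_map]
    refine h.sorted.imp fun {k k'} hlt => ?_
    rw [rightSide_mul, rightSide_mul]
    exact (MulAction.injective γ).image_strictMono hlt

/-- The product of the translations along the members of a list. -/
noncomputable def listTranslation (t : ℝ) (L : List SL(2, ℝ)) : SL(2, ℝ) :=
  (L.map (fun k => translation k t)).prod

theorem listTranslation_append (t : ℝ) (L L' : List SL(2, ℝ)) :
    listTranslation t (L ++ L') = listTranslation t L * listTranslation t L' := by
  simp [listTranslation]

theorem listTranslation_reverse (t : ℝ) (L : List SL(2, ℝ)) :
    listTranslation t (L.reverse.map (· * halfTurn)) = (listTranslation t L)⁻¹ := by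
  rw [listTranslation, listTranslation, List.prod_inv_reverse, List.map_map, List.map_map,
    ← List.map_reverse]
  congr 2
  funext k
  exact translation_halfTurn k t

theorem listTranslation_mul (t : ℝ) (γ : SL(2, ℝ)) (L : List SL(2, ℝ)) :
    listTranslation t (L.map (γ * ·)) = γ * listTranslation t L * γ⁻¹ := by
  induction L with
  | nil => simp [listTranslation]
  | cons k L ih =>
    simp only [listTranslation, List.map_cons, List.prod_cons] at ih ⊢
    rw [ih]
    simp only [translation]
    group

/-- Strict inclusion leaves one ordering of the half planes, and the translations depend on the half
planes alone. So the arbitrary list chosen in `twistIsometry` is harmless. -/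
theorem IsNestedList.unique [ProperlyDiscontinuousSMul Γ ℍ] (hS : IsSimpleAxis Γ g)
    {C : SL(2, ℝ) → Prop} {L L' : List SL(2, ℝ)} (h : IsNestedList C L) (h' : IsNestedList C L')
    (hC : ∀ k, C k → IsSignedLift Γ g k) (t : ℝ) :
    listTranslation t L = listTranslation t L' := by
  have hsub : ∀ L L' : List SL(2, ℝ), IsNestedList C L → IsNestedList C L' →
      ∀ S, S ∈ L.map rightSide → S ∈ L'.map rightSide := by
    intro L L' h h' S hS
    obtain ⟨k, hk, rfl⟩ := List.mem_map.1 hS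
    obtain ⟨k', hk', e⟩ := h'.complete k (h.mem k hk)
    exact List.mem_map.2 ⟨k', hk', e⟩
  have hsort : ∀ L : List SL(2, ℝ), IsNestedList C L →
      (L.map rightSide).Pairwise (fun S S' => S' ⊂ S) := fun L h =>
    List.pairwise_map.2 h.sorted
  have hnodup : ∀ L : List SL(2, ℝ), IsNestedList C L → (L.map rightSide).Nodup := fun L h =>
    (hsort L h).imp fun hlt => hlt.ne'
  have e : L.map rightSide = L'.map rightSide := by
    refine List.Perm.eq_of_pairwise (le := fun S S' => S' ⊂ S) ?_ (hsort L h) (hsort L' h') ?_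
    · intro S S' _ _ h1 h2
      exact absurd (h1.trans h2) (ssubset_irrefl _)
    · exact (List.perm_ext_iff_of_nodup (hnodup L h) (hnodup L' h')).2 fun S =>
        ⟨hsub L L' h h' S, hsub L' L h' h S⟩
  have key : ∀ L L' : List SL(2, ℝ), (∀ k ∈ L, IsSignedLift Γ g k) →
      (∀ k ∈ L', IsSignedLift Γ g k) → L.map rightSide = L'.map rightSide →
      L.map (fun k => translation k t) = L'.map (fun k => translation k t) := by
    intro L
    induction L with
    | nil => intro L' _ _ e; cases L' with
      | nil => rfl
      | cons _ _ => simp at e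
    | cons k L ih => intro L' hL hL' e; cases L' with
      | nil => simp at e
      | cons k' L' =>
        simp only [List.map_cons, List.cons.injEq] at e ⊢
        exact ⟨((same_of_rightSide_eq hS (hL' _ List.mem_cons_self) (hL _ List.mem_cons_self)
          e.1).2 t), ih L' (fun k hk => hL k (List.mem_cons_of_mem _ hk))
          (fun k hk => hL' k (List.mem_cons_of_mem _ hk)) e.2⟩
  rw [listTranslation, listTranslation,
    key L L' (fun k hk => hC k (h.mem k hk)) (fun k hk => hC k (h'.mem k hk)) e]

theorem exists_sorted_list {α : Type*} (S : Finset (Set α))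
    (hS : ∀ A ∈ S, ∀ B ∈ S, A ⊆ B ∨ B ⊆ A) :
    ∃ L : List (Set α), (∀ A, A ∈ L ↔ A ∈ S) ∧ L.Pairwise (fun A B => B ⊂ A) := by
  classical
  induction S using Finset.strongInduction with
  | H S ih =>
    rcases S.eq_empty_or_nonempty with rfl | hne
    · exact ⟨[], by simp, List.Pairwise.nil⟩
    · obtain ⟨M, hM⟩ := S.exists_maximal hne
      obtain ⟨L, hL, hL'⟩ := ih (S.erase M) (Finset.erase_ssubset hM.1) fun A hA B hB =>
        hS A (Finset.mem_of_mem_erase hA) B (Finset.mem_of_mem_erase hB)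
      refine ⟨M :: L, fun A => ?_, List.pairwise_cons.2 ⟨fun A hA => ?_, hL'⟩⟩
      · rw [List.mem_cons, hL, Finset.mem_erase]
        constructor
        · rintro (rfl | h)
          · exact hM.1
          · exact h.2
        · intro h
          by_cases e : A = M
          · exact Or.inl e
          · exact Or.inr ⟨e, h⟩
      · rw [hL, Finset.mem_erase] at hA
        have hle : A ⊆ M := (hS A hA.2 M hM.1).elim id fun h => hM.2 hA.2 h
        exact lt_of_le_of_ne hle hA.1

/-- The point `z` lies to the right of both lifts and `x` to the left of both, which rules out every
position except equality and nesting. -/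
theorem separates_total [ProperlyDiscontinuousSMul Γ ℍ] (hS : IsSimpleAxis Γ g) {x z : ℍ}
    {k k' : SL(2, ℝ)} (h : Separates Γ g x z k) (h' : Separates Γ g x z k') :
    rightSide k ⊆ rightSide k' ∨ rightSide k' ⊆ rightSide k := by
  rcases lift_sides hS h.1 h'.1 with e | e | e | e | e | e
  · exact Or.inl e.1.ge
  · exact (disjoint_sides k (e.1 ▸ h'.2.2) h.2.2).elim
  · exact Or.inr e.nested.1
  · exact Or.inl e.nested.1
  · exact (disjoint_sides k h.2.1 (e.1 h'.2.1)).elim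
  · exact (disjoint_sides k (e.1 h'.2.2) h.2.2).elim

/-! ### Local finiteness -/

theorem continuous_flow : Continuous flow := by
  apply Continuous.subtype_mk
  refine continuous_matrix fun i j => ?_
  fin_cases i <;> fin_cases j <;> simp <;> fun_prop

theorem continuous_geodesic (h : SL(2, ℝ)) : Continuous (geodesic h) := by
  have hc := continuous_flow
  unfold geodesic
  fun_prop

theorem exists_mul_geodesic {a g : SL(2, ℝ)} (hg : IsOrientedAxis a g) :
    ∃ l : ℝ, 0 < l ∧ ∀ s, a • geodesic g s = geodesic g (s + l) := by
  obtain ⟨l, hl, h⟩ := hg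
  refine ⟨l, hl, fun s => ?_⟩
  have : translation g l • geodesic g s = geodesic g (s + l) := by
    rw [geodesic, geodesic, ← mul_smul, translation, add_comm, flow_add]
    congr 1
    group
  rcases h with rfl | rfl
  · exact this
  · rwa [neg_smul']

theorem zpow_smul_geodesic {a g : SL(2, ℝ)} {l : ℝ}
    (h : ∀ s, a • geodesic g s = geodesic g (s + l)) (n : ℤ) (s : ℝ) :
    a ^ n • geodesic g s = geodesic g (s + n * l) := by
  have hnat : ∀ (n : ℕ) s, a ^ n • geodesic g s = geodesic g (s + n * l) := by
    intro n
    induction n with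
    | zero => simp
    | succ n ih => intro s; rw [pow_succ', mul_smul, ih, h]; congr 1; push_cast; ring
  obtain ⟨n, rfl | rfl⟩ := n.eq_nat_or_neg
  · simpa using hnat n s
  · rw [zpow_neg, inv_smul_eq_iff, zpow_natCast, hnat]
    congr 1
    push_cast
    ring

/-- One period of the axis is a compact arc. A lift that meets `K` does so in a translate of this
arc, and only finitely many translates meet `K`. -/
theorem finite_lifts_meeting [ProperlyDiscontinuousSMul Γ ℍ] (hS : IsSimpleAxis Γ g) {K : Set ℍ}
    (hK : IsCompact K) :
    {S | ∃ k, IsSignedLift Γ g k ∧ rightSide k = S ∧ (line k ∩ K).Nonempty}.Finite := by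
  obtain ⟨a, ha, hax⟩ := hS.axis
  obtain ⟨l, hl, hgeo⟩ := exists_mul_geodesic hax
  have hK0 : IsCompact (geodesic g '' Set.Icc 0 l) := isCompact_Icc.image (continuous_geodesic g)
  have hfin := ProperlyDiscontinuousSMul.finite_disjoint_inter_image (Γ := Γ) hK0 hK
  refine ((hfin.image fun γ : Γ => rightSide ((γ : SL(2, ℝ)) * g)).union
    (hfin.image fun γ : Γ => leftSide ((γ : SL(2, ℝ)) * g))).subset ?_
  have hkey : ∀ c ∈ Γ, (line (c * g) ∩ K).Nonempty → ∃ γ : Γ,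
      γ ∈ {γ : Γ | ((γ • ·) '' (geodesic g '' Set.Icc 0 l) ∩ K).Nonempty} ∧
      rightSide ((γ : SL(2, ℝ)) * g) = rightSide (c * g) ∧
      leftSide ((γ : SL(2, ℝ)) * g) = leftSide (c * g) := by
    rintro c hc ⟨z, hz, hzK⟩
    rw [line_mul] at hz
    obtain ⟨_, ⟨s, rfl⟩, rfl⟩ := hz
    obtain ⟨n, hn, -⟩ := existsUnique_sub_zsmul_mem_Ico hl s 0
    have hn' : s - n * l ∈ Set.Icc 0 l := by
      simp only [zsmul_eq_mul, zero_add] at hn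
      exact ⟨hn.1, hn.2.le⟩
    -- Since `a * g` is `± g * flow l`, replacing `c` by `c * a ^ n` changes the frame but not the
    -- sides. The argument is run once for both sides.
    have hinv : ∀ S : SL(2, ℝ) → Set ℍ, (∀ k, S (-k) = S k) → (∀ k u, S (k * flow u) = S k) →
        (∀ m k, S (m * k) = (m • ·) '' S k) → S (c * a ^ n * g) = S (c * g) := by
      intro S h1 h2 h3
      have h4 : S (a * g) = S g := by
        obtain ⟨l', -, h | h⟩ := hax
        · rw [h, translation, inv_mul_cancel_right, h2]
        · rw [h, translation, neg_mul, inv_mul_cancel_right, h1, h2]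
      have h5 : ∀ m : ℕ, S (a ^ m * g) = S g := by
        intro m
        induction m with
        | zero => simp
        | succ m ih => rw [pow_succ, mul_assoc, h3, h4, ← h3, ih]
      have h6 : S (a ^ n * g) = S g := by
        obtain ⟨m, rfl | rfl⟩ := n.eq_nat_or_neg
        · simpa using h5 m
        · have := congrArg (fun T => ((a ^ m)⁻¹ • ·) '' T) (h5 m)
          simp only [← h3, inv_mul_cancel_left] at this
          rw [zpow_neg, zpow_natCast, this]
      rw [mul_assoc, h3, h6, ← h3]
    refine ⟨⟨c * a ^ n, Γ.mul_mem hc (Γ.zpow_mem ha n)⟩, ?_, ?_, ?_⟩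
    · refine ⟨c • geodesic g s, ⟨geodesic g (s - n * l), ⟨_, hn', rfl⟩, ?_⟩, hzK⟩
      change (c * a ^ n) • geodesic g (s - n * l) = _
      rw [mul_smul, zpow_smul_geodesic hgeo, sub_add_cancel]
    · exact hinv rightSide rightSide_neg rightSide_flow rightSide_mul
    · exact hinv leftSide leftSide_neg leftSide_flow leftSide_mul
  have hkey2 : ∀ k, IsLift Γ g k → (line k ∩ K).Nonempty → rightSide k ∈
      ((fun γ : Γ => rightSide ((γ : SL(2, ℝ)) * g)) '' {γ : Γ | ((γ • ·) ''
        (geodesic g '' Set.Icc 0 l) ∩ K).Nonempty}) ∪ ((fun γ : Γ => leftSide ((γ : SL(2, ℝ)) * g))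
        '' {γ : Γ | ((γ • ·) '' (geodesic g '' Set.Icc 0 l) ∩ K).Nonempty}) := by
    rintro k ⟨c, hc, rfl | rfl⟩ hne
    · obtain ⟨γ, h1, h2, -⟩ := hkey c hc hne
      exact Or.inl ⟨γ, h1, h2⟩
    · rw [line_halfTurn] at hne
      obtain ⟨γ, h1, -, h2⟩ := hkey c hc hne
      exact Or.inr ⟨γ, h1, by rw [rightSide_halfTurn]; exact h2⟩
  rintro S ⟨k, hk | hk, rfl, hne⟩
  · exact hkey2 k hk hne
  · rw [← line_neg] at hne
    rw [← rightSide_neg]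
    exact hkey2 _ hk hne

theorem exists_mem_line_of_path {k : SL(2, ℝ)} {p : ℝ → ℍ} {u v : ℝ} (huv : u ≤ v)
    (hp : ContinuousOn p (Set.Icc u v))
    (h : (p u ∈ leftSide k ∧ p v ∈ rightSide k) ∨ (p u ∈ rightSide k ∧ p v ∈ leftSide k)) :
    ∃ s ∈ Set.Icc u v, p s ∈ line k := by
  have hc : ContinuousOn (fun s => (k⁻¹ • p s).re) (Set.Icc u v) :=
    UpperHalfPlane.continuous_re.comp_continuousOn (hp.const_smul k⁻¹)
  rcases h with ⟨h1, h2⟩ | ⟨h1, h2⟩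
  · obtain ⟨s, hs, e⟩ := intermediate_value_Icc huv hc
      (⟨le_of_lt h1, le_of_lt h2⟩ : (0 : ℝ) ∈ Set.Icc _ _)
    exact ⟨s, hs, (mem_line_iff _ _).2 e⟩
  · obtain ⟨s, hs, e⟩ := intermediate_value_Icc' huv hc
      (⟨le_of_lt h2, le_of_lt h1⟩ : (0 : ℝ) ∈ Set.Icc _ _)
    exact ⟨s, hs, (mem_line_iff _ _).2 e⟩

/-- Any path from `x` to `z` is compact and meets each separating lift. -/
theorem finite_separating [ProperlyDiscontinuousSMul Γ ℍ] (hS : IsSimpleAxis Γ g) (x z : ℍ) :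
    {S | ∃ k, Separates Γ g x z k ∧ rightSide k = S}.Finite := by
  obtain ⟨p⟩ : Nonempty (Path x z) := PathConnectedSpace.joined x z
  have hK : IsCompact (Set.range p) := isCompact_range p.continuous
  refine (finite_lifts_meeting hS hK).subset ?_
  rintro S ⟨k, hk, rfl⟩
  refine ⟨k, hk.1, rfl, ?_⟩
  obtain ⟨s, -, hs⟩ := exists_mem_line_of_path (k := k) (p := p.extend) zero_le_one
    p.continuous_extend.continuousOn (Or.inl (by simpa using hk.2))
  exact ⟨_, hs, by rw [← p.extend_range]; exact Set.mem_range_self s⟩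

/-- An arbitrary subclass of separating lifts is allowed because the cocycle identity sorts them by
the side on which a third point lies. -/
theorem exists_nestedList [ProperlyDiscontinuousSMul Γ ℍ] (hS : IsSimpleAxis Γ g) {x z : ℍ}
    {C : SL(2, ℝ) → Prop} (hC : ∀ k, C k → Separates Γ g x z k) :
    ∃ L, IsNestedList C L := by
  classical
  have hfin : {S | ∃ k, C k ∧ rightSide k = S}.Finite :=
    (finite_separating hS x z).subset fun S ⟨k, hk, e⟩ => ⟨k, hC k hk, e⟩
  obtain ⟨M, hM, hM'⟩ := exists_sorted_list hfin.toFinset (by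
    intro A hA B hB
    obtain ⟨k, hk, rfl⟩ := hfin.mem_toFinset.1 hA
    obtain ⟨k', hk', rfl⟩ := hfin.mem_toFinset.1 hB
    exact separates_total hS (hC k hk) (hC k' hk'))
  have hM2 : ∀ A ∈ M, ∃ k, C k ∧ rightSide k = A := fun A hA => hfin.mem_toFinset.1 ((hM A).1 hA)
  choose! f hf using hM2
  refine ⟨M.map f, fun k hk => ?_, fun k hk => ?_, ?_⟩
  · obtain ⟨A, hA, rfl⟩ := List.mem_map.1 hk
    exact (hf A hA).1
  · have : rightSide k ∈ M := (hM _).2 (hfin.mem_toFinset.2 ⟨k, hk, rfl⟩)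
    exact ⟨_, List.mem_map.2 ⟨_, this, rfl⟩, (hf _ this).2⟩
  · rw [List.pairwise_map]
    refine hM'.imp_of_mem fun {A B} hA hB hlt => ?_
    rwa [(hf A hA).2, (hf B hB).2]

end Lists

/-! ### The cocycle of the twist -/

section Cocycle

variable {Γ : Subgroup SL(2, ℝ)} {g : SL(2, ℝ)}

/-- `x` lies on no lift. -/
def OffLifts (Γ : Subgroup SL(2, ℝ)) (g : SL(2, ℝ)) (x : ℍ) : Prop :=
  ∀ k, IsSignedLift Γ g k → x ∉ line k

theorem OffLifts.smul {x : ℍ} (h : OffLifts Γ g x) {γ : SL(2, ℝ)} (hγ : γ ∈ Γ) :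
    OffLifts Γ g (γ • x) := by
  intro k hk hx
  refine h (γ⁻¹ * k) (hk.mul (Γ.inv_mem hγ)) ?_
  rwa [← smul_mem_line γ, mul_inv_cancel_left]

theorem Separates.neg {x z : ℍ} {k : SL(2, ℝ)} (h : Separates Γ g x z k) :
    Separates Γ g x z (-k) :=
  ⟨h.1.neg, by rw [leftSide_neg]; exact h.2.1, by rw [rightSide_neg]; exact h.2.2⟩

theorem twistIsometry_eq [ProperlyDiscontinuousSMul Γ ℍ] (hS : IsSimpleAxis Γ g) {x z : ℍ}
    {L : List SL(2, ℝ)} (hL : IsNestedList (Separates Γ g x z) L) (t : ℝ) :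
    twistIsometry Γ g t x z = listTranslation t L := by
  -- This excludes the default value 1 in the definition of `twistIsometry`.
  have hex : ∃ L, IsCrossingList Γ g x z L := by
    obtain ⟨L', hL'⟩ := exists_nestedList hS (x := x) (z := z)
      (C := fun k => IsLift Γ g k ∧ x ∈ leftSide k ∧ z ∈ rightSide k)
      fun k hk => ⟨Or.inl hk.1, hk.2⟩
    exact ⟨L', hL'.mem, fun k h1 h2 h3 => hL'.complete k ⟨h1, h2, h3⟩, hL'.sorted⟩
  have hnest : IsNestedList (Separates Γ g x z) hex.choose := by
    obtain ⟨h1, h2, h3⟩ := hex.choose_spec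
    refine ⟨fun k hk => ⟨Or.inl (h1 k hk).1, (h1 k hk).2⟩, ?_, h3⟩
    rintro k ⟨hk | hk, hx, hz⟩
    · exact h2 k hk hx hz
    · rw [← rightSide_neg]
      rw [← rightSide_neg] at hz
      rw [← leftSide_neg] at hx
      exact h2 _ hk hx hz
  rw [twistIsometry, dif_pos hex]
  exact hnest.unique hS hL (fun k hk => hk.1) t

theorem twistIsometry_eq_one [ProperlyDiscontinuousSMul Γ ℍ] (hS : IsSimpleAxis Γ g) {x z : ℍ}
    (h : ∀ k, ¬ Separates Γ g x z k) (t : ℝ) : twistIsometry Γ g t x z = 1 := by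
  rw [twistIsometry_eq hS (L := []) ⟨by simp, fun k hk => (h k hk).elim, List.Pairwise.nil⟩]
  simp [listTranslation]

/-- Let `U` be the lifts separating `x` from both `z` and `w`, `V` those separating it from `z` only
and `W` those separating it from `w` only. The three crossing lists are `U V`, `U W` and `V`
reversed followed by `W`, so the contributions of `V` cancel. -/
theorem twistIsometry_trans [ProperlyDiscontinuousSMul Γ ℍ] (hS : IsSimpleAxis Γ g) {x z w : ℍ}
    (hx : OffLifts Γ g x) (hz : OffLifts Γ g z) (hw : OffLifts Γ g w) (t : ℝ) :
    twistIsometry Γ g t x z * twistIsometry Γ g t z w = twistIsometry Γ g t x w := by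
  obtain ⟨U, hU⟩ := exists_nestedList hS (C := fun k => Separates Γ g x z k ∧ w ∈ rightSide k)
    fun k hk => hk.1
  obtain ⟨V, hV⟩ := exists_nestedList hS (C := fun k => Separates Γ g x z k ∧ w ∈ leftSide k)
    fun k hk => hk.1
  obtain ⟨W, hW⟩ := exists_nestedList hS (C := fun k => Separates Γ g x w k ∧ z ∈ leftSide k)
    fun k hk => hk.1
  have hV' := hV.reverse hS (fun k hk => hk.1.1) fun k hk =>
    ⟨hk.1.neg, by rw [leftSide_neg]; exact hk.2⟩
  have h1 : IsNestedList (Separates Γ g x z) (U ++ V) := by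
    refine (hU.append hV fun k k' hk hk' => ?_).congr fun k => ⟨?_, fun hk => ?_⟩
    · exact (pos_of_points hS hk.1.1 hk'.1.1 hk.1.2.1 hk'.1.2.1 hk.2 hk'.2 hk.1.2.2
        hk'.1.2.2).ssubset.1
    · rintro (hk | hk)
      exacts [hk.1, hk.1]
    · by_cases h : w ∈ leftSide k
      · exact Or.inr ⟨hk, h⟩
      · exact Or.inl ⟨hk, mem_right_of_not_left (hw k hk.1) h⟩
  have h2 : IsNestedList (Separates Γ g x w) (U ++ W) := by
    refine (hU.append hW fun k k' hk hk' => ?_).congr fun k => ⟨?_, fun hk => ?_⟩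
    · exact (pos_of_points hS hk.1.1 hk'.1.1 hk.1.2.1 hk'.1.2.1 hk.1.2.2 hk'.2 hk.2
        hk'.1.2.2).ssubset.1
    · rintro (hk | hk)
      exacts [⟨hk.1.1, hk.1.2.1, hk.2⟩, hk.1]
    · by_cases h : z ∈ leftSide k
      · exact Or.inr ⟨hk, h⟩
      · exact Or.inl ⟨⟨hk.1, hk.2.1, mem_right_of_not_left (hz k hk.1) h⟩, hk.2.2⟩
  have h3 : IsNestedList (Separates Γ g z w) (V.reverse.map (· * halfTurn) ++ W) := by
    refine (hV'.append hW fun k k' hk hk' => ?_).congr fun k => ⟨?_, fun hk => ?_⟩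
    · obtain ⟨⟨hl, hkx, hkz⟩, hkw⟩ := hk
      rw [leftSide_halfTurn] at hkx hkw
      rw [rightSide_halfTurn] at hkz
      have hl' : IsSignedLift Γ g k := by
        have := hl.halfTurn.neg
        rwa [mul_halfTurn_halfTurn, neg_neg] at this
      exact (pos_of_points hS hl' hk'.1.1 hkz hk'.2 hkx hk'.1.2.1 hkw hk'.1.2.2).ssubset.1
    · rintro (hk | hk)
      · obtain ⟨⟨hl, hkx, hkz⟩, hkw⟩ := hk
        rw [leftSide_halfTurn] at hkx hkw
        rw [rightSide_halfTurn] at hkz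
        have hl' : IsSignedLift Γ g k := by
          have := hl.halfTurn.neg
          rwa [mul_halfTurn_halfTurn, neg_neg] at this
        exact ⟨hl', hkz, hkw⟩
      · exact ⟨hk.1.1, hk.2, hk.1.2.2⟩
    · by_cases h : x ∈ leftSide k
      · exact Or.inr ⟨⟨hk.1, h, hk.2.2⟩, hk.2.1⟩
      · refine Or.inl ⟨⟨hk.1.halfTurn, ?_, ?_⟩, ?_⟩
        · rw [leftSide_halfTurn]; exact mem_right_of_not_left (hx k hk.1) h
        · rw [rightSide_halfTurn]; exact hk.2.1
        · rw [leftSide_halfTurn]; exact hk.2.2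
  rw [twistIsometry_eq hS h1, twistIsometry_eq hS h2, twistIsometry_eq hS h3,
    listTranslation_append, listTranslation_append, listTranslation_append,
    listTranslation_reverse]
  group

theorem twistIsometry_smul [ProperlyDiscontinuousSMul Γ ℍ] (hS : IsSimpleAxis Γ g) (x z : ℍ)
    {γ : SL(2, ℝ)} (hγ : γ ∈ Γ) (t : ℝ) :
    twistIsometry Γ g t (γ • x) (γ • z) = γ * twistIsometry Γ g t x z * γ⁻¹ := by
  obtain ⟨L, hL⟩ := exists_nestedList hS (C := Separates Γ g x z) fun k hk => hk
  rw [twistIsometry_eq hS hL, ← listTranslation_mul]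
  refine twistIsometry_eq hS ((hL.mul γ).congr fun k => ?_) t
  rw [Separates, Separates, mem_leftSide_mul, mem_rightSide_mul, inv_inv]
  refine and_congr_left' ⟨fun h => ?_, fun h => h.mul (Γ.inv_mem hγ)⟩
  simpa using h.mul hγ

theorem twistIsometry_self [ProperlyDiscontinuousSMul Γ ℍ] (hS : IsSimpleAxis Γ g) (x : ℍ)
    (t : ℝ) : twistIsometry Γ g t x x = 1 :=
  twistIsometry_eq_one hS (fun k hk => disjoint_sides k hk.2.1 hk.2.2) t

/-- This is the cocycle identity for `x`, `b • x`, `b • c • x`, combined with equivariance under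
`b`. -/
theorem twist_mul [ProperlyDiscontinuousSMul Γ ℍ] (hS : IsSimpleAxis Γ g) {x : ℍ}
    (hx : OffLifts Γ g x) {b c : SL(2, ℝ)} (hb : b ∈ Γ) (hc : c ∈ Γ) (t : ℝ) :
    twist Γ g x t (b * c) = twist Γ g x t b * twist Γ g x t c := by
  rw [twist, twist, twist, mul_smul,
    ← twistIsometry_trans hS hx (hx.smul hb) ((hx.smul hc).smul hb), twistIsometry_smul hS _ _ hb]
  group

theorem twist_inv [ProperlyDiscontinuousSMul Γ ℍ] (hS : IsSimpleAxis Γ g) {x : ℍ}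
    (hx : OffLifts Γ g x) {b : SL(2, ℝ)} (hb : b ∈ Γ) (t : ℝ) :
    twist Γ g x t b⁻¹ = (twist Γ g x t b)⁻¹ := by
  rw [eq_inv_iff_mul_eq_one, ← twist_mul hS hx (Γ.inv_mem hb) hb, inv_mul_cancel, twist, one_smul,
    twistIsometry_self hS, mul_one]

/-- A change of base point is a conjugation, so traces and angles may be computed from a base point
on the axis under study. -/
theorem twist_basepoint [ProperlyDiscontinuousSMul Γ ℍ] (hS : IsSimpleAxis Γ g) {x p : ℍ}
    (hx : OffLifts Γ g x) (hp : OffLifts Γ g p) {b : SL(2, ℝ)} (hb : b ∈ Γ) (t : ℝ) :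
    twist Γ g x t b =
      twistIsometry Γ g t x p * twist Γ g p t b * (twistIsometry Γ g t x p)⁻¹ := by
  rw [twist, twist, ← twistIsometry_trans hS hx hp (hx.smul hb),
    ← twistIsometry_trans hS hp (hp.smul hb) (hx.smul hb), twistIsometry_smul hS _ _ hb]
  have e : twistIsometry Γ g t p x = (twistIsometry Γ g t x p)⁻¹ := by
    rw [eq_inv_iff_mul_eq_one, twistIsometry_trans hS hp hx hp, twistIsometry_self hS]
  rw [e]
  group

theorem twist_zero (x : ℍ) (b : SL(2, ℝ)) : twist Γ g x 0 b = b := by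
  have : twistIsometry Γ g 0 x (b • x) = 1 := by
    rw [twistIsometry]
    split_ifs
    · simp [translation, flow_zero]
    · rfl
  rw [twist, this, one_mul]

theorem continuous_twist (x : ℍ) (b : SL(2, ℝ)) : Continuous fun t => twist Γ g x t b := by
  have hl : ∀ L : List SL(2, ℝ), Continuous fun t => (L.map fun k => translation k t).prod := by
    intro L
    induction L with
    | nil => simpa using continuous_const
    | cons k L ih =>
      simp only [List.map_cons, List.prod_cons, translation]
      exact ((continuous_const.mul continuous_flow).mul continuous_const).mul ih
  unfold twist twistIsometry
  split_ifs with h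
  · exact (hl _).mul continuous_const
  · simpa using continuous_const

end Cocycle

/-! ### The twisted holonomy of an element whose axis crosses lifts -/

section Words

open Matrix Filter Topology

/-- The product telescopes into flows alternating with the transition matrices between consecutive
lifts, and these are positive up to sign. -/
theorem posUpToSign_word (t : ℝ) (q k : SL(2, ℝ)) (L : List SL(2, ℝ))
    (hL : (k :: L).Pairwise fun k k' => PosUpToSign (k⁻¹ * k'))
    (hq : ∀ k' ∈ k :: L, PosUpToSign (k'⁻¹ * q)) :
    PosUpToSign (k⁻¹ * (listTranslation t (k :: L) * q)) := by
  induction L generalizing k with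
  | nil =>
    have e : k⁻¹ * (listTranslation t [k] * q) = flow t * (k⁻¹ * q) := by
      simp only [listTranslation, List.map_cons, List.map_nil, List.prod_singleton, translation]
      group
    rw [e]
    exact (hq k List.mem_cons_self).flow_mul t
  | cons k' L ih =>
    have e : k⁻¹ * (listTranslation t (k :: k' :: L) * q) =
        flow t * ((k⁻¹ * k') * (k'⁻¹ * (listTranslation t (k' :: L) * q))) := by
      simp only [listTranslation, List.map_cons, List.prod_cons, translation]
      group
    rw [List.pairwise_cons] at hL
    rw [e]
    exact ((hL.1 k' List.mem_cons_self).mul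
      (ih k' hL.2 fun k'' hk => hq k'' (List.mem_cons_of_mem _ hk))).flow_mul t

/-- The projection onto the `i`-th column of `k` along the other one. -/
noncomputable def columnProj (i : Fin 2) (k : SL(2, ℝ)) : Matrix (Fin 2) (Fin 2) ℝ :=
  (k : Matrix (Fin 2) (Fin 2) ℝ) * Matrix.single i i 1 *
    ((k⁻¹ : SL(2, ℝ)) : Matrix (Fin 2) (Fin 2) ℝ)

/-- The product of the column projections of the members of a list. -/
noncomputable def listProj (i : Fin 2) (L : List SL(2, ℝ)) : Matrix (Fin 2) (Fin 2) ℝ :=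
  (L.map (columnProj i)).prod

theorem coe_inv_mul_coe (k : SL(2, ℝ)) :
    ((k⁻¹ : SL(2, ℝ)) : Matrix (Fin 2) (Fin 2) ℝ) * (k : Matrix (Fin 2) (Fin 2) ℝ) = 1 := by
  rw [← Matrix.SpecialLinearGroup.coe_mul, inv_mul_cancel, Matrix.SpecialLinearGroup.coe_one]

theorem coe_mul_coe_inv (k : SL(2, ℝ)) :
    (k : Matrix (Fin 2) (Fin 2) ℝ) * ((k⁻¹ : SL(2, ℝ)) : Matrix (Fin 2) (Fin 2) ℝ) = 1 := by
  rw [← Matrix.SpecialLinearGroup.coe_mul, mul_inv_cancel, Matrix.SpecialLinearGroup.coe_one]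

theorem listProj_cons (i : Fin 2) (k : SL(2, ℝ)) (L : List SL(2, ℝ))
    (Y : Matrix (Fin 2) (Fin 2) ℝ) :
    ((k⁻¹ : SL(2, ℝ)) : Matrix (Fin 2) (Fin 2) ℝ) * (listProj i (k :: L) * Y) =
      Matrix.single i i 1 * (((k⁻¹ : SL(2, ℝ)) : Matrix (Fin 2) (Fin 2) ℝ) * (listProj i L * Y)) := by
  simp only [listProj, List.map_cons, List.prod_cons, columnProj, ← Matrix.mul_assoc]
  rw [coe_inv_mul_coe, Matrix.one_mul]

/-- In the limit each flow becomes the projection onto coordinate `i`. The entry is then a product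
of `(i, i)` entries of transition matrices and one `(i, j)` entry of the last one, all nonzero. -/
theorem listProj_ne_zero (i j : Fin 2) (q k : SL(2, ℝ)) (L : List SL(2, ℝ))
    (hL : (k :: L).Pairwise fun k k' => PosUpToSign (k⁻¹ * k'))
    (hq : ∀ k' ∈ k :: L, PosUpToSign (k'⁻¹ * q)) :
    (((k⁻¹ : SL(2, ℝ)) : Matrix (Fin 2) (Fin 2) ℝ) *
      (listProj i (k :: L) * (q : Matrix (Fin 2) (Fin 2) ℝ))) i j ≠ 0 := by
  induction L generalizing k with
  | nil =>
    rw [listProj_cons, Matrix.single_mul_apply_same, one_mul]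
    simp only [listProj, List.map_nil, List.prod_nil, one_mul]
    rw [← Matrix.SpecialLinearGroup.coe_mul]
    exact (hq k List.mem_cons_self).ne_zero i j
  | cons k' L ih =>
    rw [List.pairwise_cons] at hL
    have h1 := ih k' hL.2 fun k'' hk => hq k'' (List.mem_cons_of_mem _ hk)
    rw [listProj_cons, Matrix.single_mul_apply_same, one_mul]
    set Y := listProj i (k' :: L) * (q : Matrix (Fin 2) (Fin 2) ℝ) with hY
    have e : ((k⁻¹ : SL(2, ℝ)) : Matrix (Fin 2) (Fin 2) ℝ) * Y =
        ((k⁻¹ * k' : SL(2, ℝ)) : Matrix (Fin 2) (Fin 2) ℝ) *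
          (((k'⁻¹ : SL(2, ℝ)) : Matrix (Fin 2) (Fin 2) ℝ) * Y) := by
      rw [Matrix.SpecialLinearGroup.coe_mul, Matrix.mul_assoc,
        ← Matrix.mul_assoc (k' : Matrix (Fin 2) (Fin 2) ℝ), coe_mul_coe_inv, Matrix.one_mul]
    have e2 : ∀ r, r ≠ i → (((k'⁻¹ : SL(2, ℝ)) : Matrix (Fin 2) (Fin 2) ℝ) * Y) r j = 0 := by
      intro r hr
      rw [hY, listProj_cons, Matrix.single_mul_apply_of_ne]
      exact hr
    rw [e, Matrix.mul_apply, Finset.sum_eq_single i]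
    · exact mul_ne_zero ((hL.1 k' List.mem_cons_self).ne_zero i i) h1
    · intro r _ hr
      rw [e2 r hr, mul_zero]
    · intro h
      exact absurd (Finset.mem_univ i) h

/-- Each translation along a lift is rescaled separately, hence the exponent `L.length`. The filter
and `i` are left open so that both ends of the twist orbit are covered. -/
theorem tendsto_listTranslation {F : Filter ℝ} {c : ℝ → ℝ} {i : Fin 2}
    (hc : Tendsto (fun t => c t • (flow t : Matrix (Fin 2) (Fin 2) ℝ)) F
      (𝓝 (Matrix.single i i 1))) (L : List SL(2, ℝ)) :
    Tendsto (fun t => c t ^ L.length • (listTranslation t L : Matrix (Fin 2) (Fin 2) ℝ)) F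
      (𝓝 (listProj i L)) := by
  induction L with
  | nil => simpa [listTranslation, listProj] using tendsto_const_nhds
  | cons k L ih =>
    have h1 : Tendsto (fun t => ((k : Matrix (Fin 2) (Fin 2) ℝ) *
        (c t • (flow t : Matrix (Fin 2) (Fin 2) ℝ)) *
        ((k⁻¹ : SL(2, ℝ)) : Matrix (Fin 2) (Fin 2) ℝ)) *
        (c t ^ L.length • (listTranslation t L : Matrix (Fin 2) (Fin 2) ℝ))) F
        (𝓝 (columnProj i k * listProj i L)) :=
      ((hc.const_mul _).mul_const _).mul ih
    have e : listProj i (k :: L) = columnProj i k * listProj i L := by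
      simp [listProj]
    rw [e]
    refine h1.congr fun t => ?_
    simp only [listTranslation, List.map_cons, List.prod_cons, translation, List.length_cons,
      Matrix.SpecialLinearGroup.coe_mul, Matrix.mul_smul, Matrix.smul_mul, smul_smul]
    rw [pow_succ]

theorem tendsto_flow_atTop :
    Tendsto (fun t => Real.exp (-(t / 2)) • (flow t : Matrix (Fin 2) (Fin 2) ℝ)) atTop
      (𝓝 (Matrix.single 0 0 1)) := by
  have h1 : Tendsto (fun t : ℝ => Real.exp (-t)) atTop (𝓝 0) :=
    Real.tendsto_exp_atBot.comp tendsto_neg_atTop_atBot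
  have e1 : ∀ t : ℝ, Real.exp (-(t / 2)) * Real.exp (t / 2) = 1 := fun t => by
    rw [← Real.exp_add]; simp
  have e2 : ∀ t : ℝ, Real.exp (-(t / 2)) * Real.exp (-(t / 2)) = Real.exp (-t) := fun t => by
    rw [← Real.exp_add]; ring_nf
  refine tendsto_pi_nhds.2 fun i => tendsto_pi_nhds.2 fun j => ?_
  fin_cases i <;> fin_cases j <;> simp [Matrix.single, e1, e2, h1]

theorem tendsto_flow_atBot :
    Tendsto (fun t => Real.exp (t / 2) • (flow t : Matrix (Fin 2) (Fin 2) ℝ)) atBot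
      (𝓝 (Matrix.single 1 1 1)) := by
  have e1 : ∀ t : ℝ, Real.exp (t / 2) * Real.exp (-(t / 2)) = 1 := fun t => by
    rw [← Real.exp_add]; simp
  have e2 : ∀ t : ℝ, Real.exp (t / 2) * Real.exp (t / 2) = Real.exp t := fun t => by
    rw [← Real.exp_add]; ring_nf
  refine tendsto_pi_nhds.2 fun i => tendsto_pi_nhds.2 fun j => ?_
  fin_cases i <;> fin_cases j <;> simp [Matrix.single, e1, e2, Real.tendsto_exp_atBot]

end Words

/-! ### Limits of the ends of a twisted axis -/

section Axis

open Matrix Filter Topology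

variable {Γ : Subgroup SL(2, ℝ)} {g : SL(2, ℝ)}

/-- The `i`-th column of `k`. -/
def column (k : SL(2, ℝ)) (i : Fin 2) : Fin 2 → ℝ :=
  (k : Matrix (Fin 2) (Fin 2) ℝ) *ᵥ Pi.single i 1

/-- `u` and `w` are eigenvectors of `M`, the eigenvalue of `u` being the larger one in absolute
value. -/
def HasAttractingPair (M : Matrix (Fin 2) (Fin 2) ℝ) (u w : Fin 2 → ℝ) : Prop :=
  ∃ μ ν : ℝ, ν ^ 2 < μ ^ 2 ∧ M *ᵥ u = μ • u ∧ M *ᵥ w = ν • w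

/-- The lift `b * k'` is crossed in the next period. The points at times `s`, `s + l`, `s + 2l`
supply the three side conditions of `pos_of_points`, since a geodesic does not cross back. -/
theorem pos_of_axis [ProperlyDiscontinuousSMul Γ ℍ] (hS : IsSimpleAxis Γ g) {b h : SL(2, ℝ)}
    (hb : b ∈ Γ) {s l : ℝ} (hl : 0 < l) (hgeo : ∀ s, b • geodesic h s = geodesic h (s + l))
    {k k' : SL(2, ℝ)} (hk : Separates Γ g (geodesic h s) (b • geodesic h s) k)
    (hk' : Separates Γ g (geodesic h s) (b • geodesic h s) k') :
    PosUpToSign (k⁻¹ * (b * k')) := by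
  have h1 : geodesic h (s + l) ∈ leftSide (b * k') := by
    rw [← hgeo, smul_mem_leftSide]; exact hk'.2.1
  have h2 : geodesic h (s + l + l) ∈ rightSide (b * k') := by
    rw [← hgeo, smul_mem_rightSide, ← hgeo]; exact hk'.2.2
  have h3 := hk.2.2
  rw [hgeo] at h3
  exact pos_of_points hS hk.1 (hk'.1.mul hb) hk.2.1
    (mem_left_of_crossed (by linarith) h1 h2 (by linarith : s ≤ s + l)) h3 h1
    (mem_right_of_crossed (by linarith) hk.2.1 h3 (by linarith : s + l ≤ s + l + l)) h2

theorem trace_conj (k m : SL(2, ℝ)) :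
    (k * m * k⁻¹) 0 0 + (k * m * k⁻¹) 1 1 = m 0 0 + m 1 1 := by
  have hd := det_eq k
  simp only [mul_entry, inv_00, inv_01, inv_10, inv_11]
  linear_combination (m 0 0 + m 1 1) * hd

theorem trace_eq_of_conj {k m n : SL(2, ℝ)} (h : m = k * n * k⁻¹) :
    m 0 0 + m 1 1 = n 0 0 + n 1 1 := by
  rw [h, trace_conj]

/-- Either no lift is crossed in a period of the axis of `b`, or the twisted holonomy of `b` is
hyperbolic and its ends converge to the ends of the first lift and of the last lift crossed. -/
theorem twist_axis [ProperlyDiscontinuousSMul Γ ℍ] (hS : IsSimpleAxis Γ g) {b h : SL(2, ℝ)}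
    (hb : b ∈ Γ) (hh : IsOrientedAxis b h) (s : ℝ) :
    (∀ t, twist Γ g (geodesic h s) t b = b) ∨
    ((∀ t, 2 < |twist Γ g (geodesic h s) t b 0 0 + twist Γ g (geodesic h s) t b 1 1|) ∧
      ∃ k κ, IsSignedLift Γ g k ∧ IsSignedLift Γ g κ ∧ CrossesToRight h k ∧ CrossesToRight h κ ∧
      ∃ n : ℕ, ∀ (F : Filter ℝ) (c : ℝ → ℝ) (i : Fin 2),
        Tendsto (fun t => c t • (flow t : Matrix (Fin 2) (Fin 2) ℝ)) F (𝓝 (Matrix.single i i 1)) →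
        ∃ M, Tendsto (fun t => c t ^ n • (twist Γ g (geodesic h s) t b :
            Matrix (Fin 2) (Fin 2) ℝ)) F (𝓝 M) ∧
          ∀ j, j ≠ i → HasAttractingPair M (column k i) (column κ j)) := by
  obtain ⟨l, hl, hgeo⟩ := exists_mul_geodesic hh
  set p := geodesic h s with hp
  obtain ⟨L, hL⟩ := exists_nestedList hS (C := Separates Γ g p (b • p)) fun k hk => hk
  have htw : ∀ t, twist Γ g p t b = listTranslation t L * b := fun t => by
    rw [twist, twistIsometry_eq hS hL]
  rcases L.eq_nil_or_concat with rfl | ⟨L', kn, hLn⟩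
  · left
    intro t
    rw [htw]
    simp [listTranslation]
  right
  obtain ⟨k, L'', hLk⟩ : ∃ k L'', L = k :: L'' := by
    cases L with
    | nil => simp at hLn
    | cons k L'' => exact ⟨k, L'', rfl⟩
  have hkn : Separates Γ g p (b • p) kn := hL.mem _ (by rw [hLn]; simp)
  have hk : Separates Γ g p (b • p) k := hL.mem _ (by rw [hLk]; simp)
  have hpair : (k :: L'').Pairwise fun k k' => PosUpToSign (k⁻¹ * k') := by
    rw [← hLk]
    exact hL.sorted.imp_of_mem fun {k k'} h1 h2 hlt =>
      pos_of_ssubset hS (hL.mem _ h1).1 (hL.mem _ h2).1 hlt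
  have hq : ∀ k' ∈ k :: L'', PosUpToSign (k'⁻¹ * (b * k)) := by
    rw [← hLk]
    exact fun k' hk' => pos_of_axis hS hb hl hgeo (hL.mem _ hk') hk
  -- The limit matrix is `listProj i L * b`. Its first projection has image spanned by a column of
  -- `k`. Its last one kills the other column of `kn`, which gives a kernel vector of the whole in
  -- `b⁻¹ * kn`, the last lift of the preceding period.
  refine ⟨fun t => ?_, k, b⁻¹ * kn, hk.1, hkn.1.mul (Γ.inv_mem hb), ?_, ?_, L.length, ?_⟩
  · have := (posUpToSign_word t (b * k) k L'' hpair hq).trace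
    rwa [htw, hLk, trace_eq_of_conj (k := k) (n := k⁻¹ * (listTranslation t (k :: L'') * (b * k)))]
    group
  · exact ⟨s, s + l, by linarith, hk.2.1, by rw [← hgeo]; exact hk.2.2⟩
  · refine ⟨s - l, s, by linarith, ?_, ?_⟩
    · rw [mem_leftSide_mul, inv_inv, hgeo, sub_add_cancel]; exact hkn.2.1
    · rw [mem_rightSide_mul, inv_inv]; exact hkn.2.2
  · intro F c i hF
    refine ⟨listProj i L * (b : Matrix (Fin 2) (Fin 2) ℝ), ?_, fun j hj => ?_⟩
    · refine ((tendsto_listTranslation hF L).mul_const (b : Matrix (Fin 2) (Fin 2) ℝ)).congr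
        fun t => ?_
      rw [htw, Matrix.SpecialLinearGroup.coe_mul, Matrix.smul_mul]
    · set X := ((k⁻¹ : SL(2, ℝ)) : Matrix (Fin 2) (Fin 2) ℝ) *
        (listProj i (k :: L'') * ((b * k : SL(2, ℝ)) : Matrix (Fin 2) (Fin 2) ℝ)) with hX
      have hXi : X i i ≠ 0 := listProj_ne_zero i i (b * k) k L'' hpair hq
      -- The leading projection annihilates every row of `X` except row `i`.
      have hX2 : X *ᵥ Pi.single i 1 = X i i • Pi.single i 1 := by
        have hX' := hX
        rw [listProj_cons] at hX'
        rw [hX']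
        ext r
        rw [Matrix.mulVec_single_one]
        by_cases hr : r = i
        · subst hr
          simp
        · rw [Matrix.col_apply, Matrix.single_mul_apply_of_ne _ _ _ _ _ hr]
          simp [hr]
      refine ⟨X i i, 0, by rw [zero_pow two_ne_zero]; positivity, ?_, ?_⟩
      · have e : listProj i L * (b : Matrix (Fin 2) (Fin 2) ℝ) * (k : Matrix (Fin 2) (Fin 2) ℝ) =
            (k : Matrix (Fin 2) (Fin 2) ℝ) * X := by
          rw [hX, ← Matrix.mul_assoc, coe_mul_coe_inv, Matrix.one_mul, hLk,
            Matrix.SpecialLinearGroup.coe_mul, Matrix.mul_assoc]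
        rw [column, Matrix.mulVec_mulVec, e, ← Matrix.mulVec_mulVec, hX2, Matrix.mulVec_smul]
      · have e : listProj i L * (b : Matrix (Fin 2) (Fin 2) ℝ) *
            ((b⁻¹ * kn : SL(2, ℝ)) : Matrix (Fin 2) (Fin 2) ℝ) =
            listProj i L' * (kn : Matrix (Fin 2) (Fin 2) ℝ) * Matrix.single i i 1 := by
          rw [Matrix.mul_assoc, ← Matrix.SpecialLinearGroup.coe_mul, mul_inv_cancel_left, hLn]
          simp only [listProj, List.concat_eq_append, List.map_append, List.prod_append,
            List.map_cons, List.map_nil, List.prod_singleton, columnProj, Matrix.mul_assoc]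
          rw [coe_inv_mul_coe, Matrix.mul_one]
        rw [column, Matrix.mulVec_mulVec, e, ← Matrix.mulVec_mulVec, zero_smul]
        have : (Matrix.single i i (1 : ℝ)) *ᵥ Pi.single j 1 = 0 := by
          ext r
          rw [Matrix.mulVec_single_one, Matrix.col_apply, Matrix.single_apply_of_col_ne _ _ hj.symm]
          rfl
        rw [this, Matrix.mulVec_zero]

end Axis

/-! ### Traces of the twisted holonomy -/

theorem exists_fixedPoint {m : SL(2, ℝ)} (h : |m 0 0 + m 1 1| < 2) : ∃ z : ℍ, m • z = z := by
  have hd := det_eq m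
  obtain ⟨h1, h2⟩ := abs_lt.1 h
  have h10 : m 1 0 ≠ 0 := by
    intro h0
    rw [h0, mul_zero, sub_zero] at hd
    nlinarith [sq_nonneg (m 0 0 - m 1 1), sq_nonneg (m 0 0 + m 1 1)]
  set D := 4 - (m 0 0 + m 1 1) ^ 2 with hD
  have hDpos : 0 < D := by nlinarith
  -- `x + ir` is the root in the upper half plane of the fixed point equation `cz² + (d - a)z - b =
  -- 0`.
  set x := (m 0 0 - m 1 1) / (2 * m 1 0) with hx
  set r := √D / (2 * |m 1 0|) with hr
  have hrpos : 0 < r := div_pos (Real.sqrt_pos.2 hDpos) (by positivity)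
  have hx' : 2 * m 1 0 * x = m 0 0 - m 1 1 := by rw [hx]; field_simp
  have hr' : 4 * m 1 0 ^ 2 * r ^ 2 = D := by
    rw [hr, div_pow, Real.sq_sqrt hDpos.le, mul_pow, sq_abs]
    field_simp
    norm_num
  have key : m 0 0 * x + m 0 1 = m 1 0 * (x ^ 2 - r ^ 2) + m 1 1 * x := by
    have : 4 * m 1 0 * (m 1 0 * (x ^ 2 - r ^ 2) + m 1 1 * x - (m 0 0 * x + m 0 1)) = 0 := by
      linear_combination (2 * m 1 0 * x - m 0 0 + m 1 1) * hx' - hr' - hD + 4 * hd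
    have := (mul_eq_zero.1 this).resolve_left (by positivity)
    linarith
  refine ⟨⟨⟨x, r⟩, hrpos⟩, ?_⟩
  apply UpperHalfPlane.ext
  rw [UpperHalfPlane.coe_specialLinearGroup_apply]
  simp only [Algebra.algebraMap_self, RingHom.id_apply]
  rw [div_eq_iff]
  · apply Complex.ext
    · simp
      linarith
    · simp
      linear_combination (-r) * hx'
  · intro h0
    have := congrArg Complex.im h0
    simp [h10, hrpos.ne'] at this

theorem wedge_ne_zero_of_eigen {a b c d μ ν : ℝ} {u w : Fin 2 → ℝ} (hne : μ ≠ ν) (hu : u ≠ 0)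
    (hw : w ≠ 0) (hu0 : a * u 0 + b * u 1 = μ * u 0) (hu1 : c * u 0 + d * u 1 = μ * u 1)
    (hw0 : a * w 0 + b * w 1 = ν * w 0) (hw1 : c * w 0 + d * w 1 = ν * w 1) :
    u 0 * w 1 - u 1 * w 0 ≠ 0 := by
  intro h0
  have hne' := sub_ne_zero.2 hne
  have b0 : u 0 * w 0 = 0 := (mul_eq_zero.1 (show (μ - ν) * (u 0 * w 0) = 0 by
    linear_combination u 0 * hw0 - w 0 * hu0 - b * h0)).resolve_left hne'
  have b1 : u 1 * w 1 = 0 := (mul_eq_zero.1 (show (μ - ν) * (u 1 * w 1) = 0 by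
    linear_combination u 1 * hw1 - w 1 * hu1 + c * h0)).resolve_left hne'
  have b2 : u 0 * w 1 = 0 := (mul_eq_zero.1 (show (μ - ν) * (u 0 * w 1) = 0 by
    linear_combination w 1 * (-hu0) + u 1 * hw0 + (a - ν) * h0)).resolve_left hne'
  have b3 : u 1 * w 0 = 0 := by linarith
  have hcase : ∀ v : Fin 2 → ℝ, v ≠ 0 → v 0 ≠ 0 ∨ v 1 ≠ 0 := by
    intro v hv
    by_contra hcon
    push Not at hcon
    exact hv (by ext i; fin_cases i; exacts [hcon.1, hcon.2])
  rcases hcase u hu with h1 | h1 <;> rcases hcase w hw with h2 | h2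
  · exact mul_ne_zero h1 h2 b0
  · exact mul_ne_zero h1 h2 b2
  · exact mul_ne_zero h1 h2 b3
  · exact mul_ne_zero h1 h2 b1

theorem exists_isOrientedAxis {m : SL(2, ℝ)} (h : 2 < |m 0 0 + m 1 1|) :
    ∃ k, IsOrientedAxis m k := by
  wlog hpos : 0 < m 0 0 + m 1 1 generalizing m
  · have := @this (-m) (by rwa [neg_entry, neg_entry, ← neg_add, abs_neg]) (by
      rw [neg_entry, neg_entry]
      rcases lt_trichotomy (m 0 0 + m 1 1) 0 with h1 | h1 | h1
      · linarith
      · rw [h1, abs_zero] at h; linarith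
      · exact absurd h1 hpos)
    obtain ⟨k, l, hl, hk⟩ := this
    exact ⟨k, l, hl, hk.symm.imp (fun e => neg_injective e) fun e => by rw [← e, neg_neg]⟩
  rw [abs_of_pos hpos] at h
  have hd := det_eq m
  set T := m 0 0 + m 1 1 with hT
  set r := √(T ^ 2 - 4) with hr
  have hr2 : r ^ 2 = T ^ 2 - 4 := Real.sq_sqrt (by nlinarith)
  have hr0 : 0 < r := Real.sqrt_pos.2 (by nlinarith)
  set lam := (T + r) / 2 with hlam
  have hlam1 : 1 < lam := by rw [hlam]; linarith
  have hlam0 : 0 < lam := by linarith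
  set nu := (T - r) / 2 with hnu
  have hprod : lam * nu = 1 := by rw [hlam, hnu]; linear_combination (-1 / 4) * hr2
  have hnueq : nu = lam⁻¹ := eq_inv_of_mul_eq_one_right hprod
  have heig : ∀ x : ℝ, x ^ 2 - T * x + 1 = 0 → ∃ v : Fin 2 → ℝ, v ≠ 0 ∧
      (m 0 0 - x) * v 0 + m 0 1 * v 1 = 0 ∧ m 1 0 * v 0 + (m 1 1 - x) * v 1 = 0 := by
    intro x hx
    obtain ⟨v, hv, e⟩ := Matrix.exists_mulVec_eq_zero_iff.2
      (show (!![m 0 0 - x, m 0 1; m 1 0, m 1 1 - x]).det = 0 by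
        rw [Matrix.det_fin_two_of]; rw [hT] at hx; linear_combination hx + hd)
    have e0 := congrFun e 0
    have e1 := congrFun e 1
    simp [Matrix.mulVec, dotProduct, Fin.sum_univ_two] at e0 e1
    exact ⟨v, hv, e0, e1⟩
  obtain ⟨u, hu, hu0, hu1⟩ := heig lam (by rw [hlam]; linear_combination (1 / 4) * hr2)
  obtain ⟨w, hw, hw0, hw1⟩ := heig nu (by rw [hnu]; linear_combination (1 / 4) * hr2)
  have hne : lam - nu ≠ 0 := by rw [hlam, hnu]; intro h0; linarith
  set ω := u 0 * w 1 - u 1 * w 0 with hω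
  have hω0 : ω ≠ 0 := wedge_ne_zero_of_eigen (sub_ne_zero.1 hne) hu hw (a := m 0 0) (b := m 0 1)
    (c := m 1 0) (d := m 1 1) (by linarith) (by linarith) (by linarith) (by linarith)
  -- The columns are the eigenvectors for `lam > 1` and for `lam⁻¹`; dividing the second by `ω`
  -- makes the determinant 1.
  let k : SL(2, ℝ) := ⟨!![u 0, w 0 / ω; u 1, w 1 / ω], by
    rw [Matrix.det_fin_two_of]
    field_simp
    linarith⟩
  have k00 : k 0 0 = u 0 := rfl
  have k01 : k 0 1 = w 0 / ω := rfl
  have k10 : k 1 0 = u 1 := rfl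
  have k11 : k 1 1 = w 1 / ω := rfl
  refine ⟨k, 2 * Real.log lam, by have := Real.log_pos hlam1; linarith, Or.inl ?_⟩
  have e0 : Real.exp (2 * Real.log lam / 2) = lam := by
    rw [mul_div_cancel_left₀ _ two_ne_zero, Real.exp_log hlam0]
  rw [translation, eq_mul_inv_iff_mul_eq]
  apply ext_entries <;> simp only [mul_entry, flow_00, flow_01, flow_10, flow_11, Real.exp_neg, e0,
    ← hnueq, k00, k01, k10, k11]
  · linear_combination hu0
  · field_simp; linear_combination hw0
  · linear_combination hu1
  · field_simp; linear_combination hw1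

theorem exists_parabolic_conj {c : SL(2, ℝ)} (hc : c ≠ -1) (htr : c 0 0 + c 1 1 = -2) :
    ∃ k : SL(2, ℝ), (k⁻¹ * c * k) 0 0 = -1 ∧ (k⁻¹ * c * k) 0 1 ≠ 0 ∧ (k⁻¹ * c * k) 1 0 = 0 ∧
      (k⁻¹ * c * k) 1 1 = -1 := by
  have hd := det_eq c
  obtain ⟨v, hv, e⟩ := Matrix.exists_mulVec_eq_zero_iff.2
    (show (!![c 0 0 + 1, c 0 1; c 1 0, c 1 1 + 1]).det = 0 by
      rw [Matrix.det_fin_two_of]; linear_combination hd + htr)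
  have e0 := congrFun e 0
  have e1 := congrFun e 1
  simp [Matrix.mulVec, dotProduct, Fin.sum_univ_two] at e0 e1
  have hN : v 0 ^ 2 + v 1 ^ 2 ≠ 0 := by
    intro hcon
    have h0 : v 0 = 0 := by nlinarith [sq_nonneg (v 0), sq_nonneg (v 1)]
    have h1 : v 1 = 0 := by nlinarith [sq_nonneg (v 0), sq_nonneg (v 1)]
    exact hv (by ext i; fin_cases i <;> assumption)
  obtain ⟨N, hNdef⟩ : ∃ N, N = v 0 ^ 2 + v 1 ^ 2 := ⟨_, rfl⟩
  rw [← hNdef] at hN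
  -- The eigenvector `v` is completed by its quarter turn, divided by its squared length `N`.
  obtain ⟨k, k00, k01, k10, k11⟩ : ∃ k : SL(2, ℝ), k 0 0 = v 0 ∧ k 0 1 = -v 1 / N ∧
      k 1 0 = v 1 ∧ k 1 1 = v 0 / N := by
    refine ⟨⟨!![v 0, -v 1 / N; v 1, v 0 / N], ?_⟩, rfl, rfl, rfl, rfl⟩
    rw [Matrix.det_fin_two_of]
    field_simp
    linarith
  have q10 : (k⁻¹ * c * k) 1 0 = 0 := by
    simp only [mul_entry, inv_10, inv_11, k00, k10]
    linear_combination v 0 * e1 - v 1 * e0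
  have q00 : (k⁻¹ * c * k) 0 0 = -1 := by
    simp only [mul_entry, inv_00, inv_01, k00, k01, k10, k11]
    field_simp
    linear_combination v 0 * e0 + v 1 * e1 + hNdef
  have q11 : (k⁻¹ * c * k) 1 1 = -1 := by
    have := det_eq (k⁻¹ * c * k)
    rw [q10, q00] at this
    linarith
  refine ⟨k, q00, fun q01 => hc ?_, q10, q11⟩
  have e2 : k⁻¹ * c * k = -1 := by
    apply ext_entries
    · rw [q00, neg_entry, one_00]
    · rw [q01, neg_entry, one_01, neg_zero]
    · rw [q10, neg_entry, one_10, neg_zero]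
    · rw [q11, neg_entry, one_11]
  calc c = k * (k⁻¹ * c * k) * k⁻¹ := by group
    _ = -1 := by rw [e2]; simp

section Trace

variable {Γ : Subgroup SL(2, ℝ)} {g : SL(2, ℝ)}

theorem line_eq_of_rightSide_eq [ProperlyDiscontinuousSMul Γ ℍ] {k k' : SL(2, ℝ)}
    (hS : IsSimpleAxis Γ g) (hk : IsSignedLift Γ g k) (hk' : IsSignedLift Γ g k')
    (e : rightSide k' = rightSide k) : line k' = line k := by
  have e' := (same_of_rightSide_eq hS hk hk' e).1
  ext z
  constructor
  · intro h
    rcases side_cases k z with h1 | h1 | h1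
    · rw [← e'] at h1; exact absurd h (not_mem_line_of_left h1)
    · exact h1
    · rw [← e] at h1; exact absurd h (not_mem_line_of_right h1)
  · intro h
    rcases side_cases k' z with h1 | h1 | h1
    · rw [e'] at h1; exact absurd h (not_mem_line_of_left h1)
    · exact h1
    · rw [e] at h1; exact absurd h (not_mem_line_of_right h1)

/-- A geodesic which is not a lift meets the lifts in a discrete set of times. -/
theorem exists_offLifts_near [ProperlyDiscontinuousSMul Γ ℍ] (hS : IsSimpleAxis Γ g)
    {h : SL(2, ℝ)} (hh : ∀ k, IsSignedLift Γ g k → line k ≠ line h) (s₀ : ℝ) :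
    ∃ δ > 0, ∀ s, s ≠ s₀ → |s - s₀| < δ → OffLifts Γ g (geodesic h s) := by
  set K := geodesic h '' Set.Icc (s₀ - 1) (s₀ + 1)
  have hK : IsCompact K := isCompact_Icc.image (continuous_geodesic h)
  set B := {s | s ∈ Set.Icc (s₀ - 1) (s₀ + 1) ∧ ∃ k, IsSignedLift Γ g k ∧ geodesic h s ∈ line k}
    with hB
  have hB' : ∀ s, ∃ k, s ∈ B → IsSignedLift Γ g k ∧ geodesic h s ∈ line k := fun s => by
    by_cases hs : s ∈ B
    · exact ⟨hs.2.choose, fun _ => hs.2.choose_spec⟩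
    · exact ⟨1, fun h => absurd h hs⟩
  choose f hf using hB'
  have hfin : B.Finite := by
    refine Set.Finite.of_finite_image (f := fun s => rightSide (f s))
      ((finite_lifts_meeting hS hK).subset ?_) ?_
    · rintro _ ⟨s, hs, rfl⟩
      exact ⟨f s, (hf s hs).1, rfl, geodesic h s, (hf s hs).2, s, hs.1, rfl⟩
    · intro s hs s' hs' e
      by_contra hne
      refine hh (f s) (hf s hs).1 (line_eq_of_crossFun hne (hf s hs).2 ?_).symm
      rw [line_eq_of_rightSide_eq hS (hf s' hs').1 (hf s hs).1 e]
      exact (hf s' hs').2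
  have hopen := (hfin.subset (Set.sdiff_subset (s := B) (t := {s₀}))).isClosed.isOpen_compl
  obtain ⟨ε, hε, hball⟩ := Metric.isOpen_iff.1 hopen s₀ (by simp)
  refine ⟨min ε 1, lt_min hε one_pos, fun s hs hlt k hk hmem => ?_⟩
  have h1 : s ∈ Metric.ball s₀ ε := by
    rw [Metric.mem_ball, Real.dist_eq]; exact hlt.trans_le (min_le_left _ _)
  have h2 := abs_lt.1 (hlt.trans_le (min_le_right _ _))
  exact hball h1 ⟨⟨⟨by linarith, by linarith⟩, k, hk, hmem⟩, hs⟩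

/-- No lift separates `p` from `c • p`, so the twist based at `p` fixes `c`; a change of base point
preserves the trace. -/
theorem twist_eq_conj_of_same_side [ProperlyDiscontinuousSMul Γ ℍ] (hS : IsSimpleAxis Γ g)
    {x p : ℍ} (hx : OffLifts Γ g x) {c : SL(2, ℝ)} (hc : c ∈ Γ)
    (h : ∀ k, IsSignedLift Γ g k → 0 < (k⁻¹ • p).re * (k⁻¹ • c • p).re) (t : ℝ) :
    twist Γ g x t c 0 0 + twist Γ g x t c 1 1 = c 0 0 + c 1 1 := by
  have hp : OffLifts Γ g p := fun k hk hmem => by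
    rw [mem_line_iff] at hmem
    have := h k hk
    rw [hmem, zero_mul] at this
    exact lt_irrefl _ this
  have h1 : twist Γ g p t c = c := by
    rw [twist, twistIsometry_eq_one hS, one_mul]
    rintro k ⟨hk, h1, h2⟩
    exact lt_asymm (h k hk) (mul_neg_of_neg_of_pos h1 h2)
  rw [trace_eq_of_conj (twist_basepoint hS hx hp hc t), h1]

theorem re_mul_re_pos {m m' : SL(2, ℝ)} {z z' : ℍ} (h : 0 < reNum m z * reNum m' z') :
    0 < (m • z).re * (m' • z').re := by
  obtain ⟨D, hD, e⟩ := exists_denom m z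
  obtain ⟨D', hD', e'⟩ := exists_denom m' z'
  rw [e, e', div_mul_div_comm]
  exact div_pos h (mul_pos hD hD')

theorem mul_pos_of_mul_pos_same {a x y : ℝ} (hx : 0 < a * x) (hy : 0 < a * y) : 0 < x * y := by
  have h := mul_pos hx hy
  have e : a * x * (a * y) = a ^ 2 * (x * y) := by ring
  rw [e] at h
  exact pos_of_mul_pos_right h (sq_nonneg a)

/-- The twist does not change the trace of the elements whose axis is a lift. -/
theorem twist_trace_of_axis_lift [ProperlyDiscontinuousSMul Γ ℍ] (hS : IsSimpleAxis Γ g)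
    {x : ℍ} (hx : OffLifts Γ g x) {c h k₀ : SL(2, ℝ)} (hc : c ∈ Γ) (hh : IsOrientedAxis c h)
    (hk₀ : IsSignedLift Γ g k₀) (hline : line k₀ = line h) (t : ℝ) :
    twist Γ g x t c 0 0 + twist Γ g x t c 1 1 = c 0 0 + c 1 1 := by
  obtain ⟨l, hl, hcl⟩ := id hh
  set δ := Real.exp (l / 2) - Real.exp (-(l / 2)) with hδ
  have hexp : Real.exp (l / 2) * Real.exp (-(l / 2)) = 1 := by rw [← Real.exp_add]; simp
  have hδ0 : 0 < δ := sub_pos.2 (Real.exp_lt_exp.2 (by linarith))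
  have hXX : (0 : ℝ) < 1 / δ := by positivity
  -- Here `δ = 2 sinh (l / 2)`, and `h • (X + i)` lies at distance `arsinh (1 / δ)` from the axis,
  -- inside the collar of a simple closed geodesic of length `l`. The point is off the axis but
  -- cannot reach another lift.
  set X := 1 / δ with hX
  have hXδ : X * δ = 1 := by rw [hX]; field_simp
  let P : ℍ := ⟨⟨X, 1⟩, one_pos⟩
  have hcP : c • h • P = (h * flow l) • P := by
    rw [← mul_smul]
    rcases hcl with rfl | rfl
    · rw [translation, inv_mul_cancel_right]
    · rw [neg_mul, neg_smul', translation, inv_mul_cancel_right]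
  refine twist_eq_conj_of_same_side hS (p := h • P) hx hc (fun k hk => ?_) t
  rw [hcP, ← mul_smul, ← mul_smul, ← mul_assoc]
  apply re_mul_re_pos
  obtain ⟨a, ha, hak⟩ := hk.axis hS
  have hcases := axes_cases Γ ha hc hak hh
  have hdisj := lines_eq_or_disjoint hS hk hk₀
  rw [hline] at hdisj
  have hdisj2 := lines_eq_or_disjoint hS hk (hk.mul hc)
  set m := k⁻¹ * h with hm
  have hre : P.re = X := rfl
  have hnsq : Complex.normSq (P : ℂ) = X ^ 2 + 1 := by
    rw [Complex.normSq_apply]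
    change X * X + 1 * 1 = _
    ring
  have hE : 0 < Real.exp (l / 2) := Real.exp_pos _
  have f1 : reNum m P = m 0 0 * m 1 0 * (X ^ 2 + 1) +
      (m 0 0 * m 1 1 + m 0 1 * m 1 0) * X + m 0 1 * m 1 1 := by
    rw [reNum, hre, hnsq]
  have f2 : reNum (m * flow l) P = m 0 0 * m 1 0 * (Real.exp (l / 2) ^ 2 * (X ^ 2 + 1)) +
      (m 0 0 * m 1 1 + m 0 1 * m 1 0) * X + m 0 1 * m 1 1 * Real.exp (-(l / 2)) ^ 2 := by
    rw [reNum, hre, hnsq]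
    simp only [mul_entry, flow_00, flow_01, flow_10, flow_11]
    linear_combination (m 0 0 * m 1 1 + m 0 1 * m 1 0) * X * hexp
  rcases hcases with ⟨h0, h1⟩ | ⟨h0, h1⟩ | hne
  · have hd := det_eq m
    rw [f1, f2, h0, h1]
    rw [h0, zero_mul, sub_zero] at hd
    simp only [hd, mul_zero, zero_mul, zero_add, add_zero, one_mul]
    positivity
  · have hd := det_eq m
    rw [f1, f2, h0, h1]
    rw [h0, zero_mul, zero_sub] at hd
    have hd' : m 0 1 * m 1 0 = -1 := by linarith
    simp only [hd', mul_zero, zero_mul, zero_add, add_zero]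
    nlinarith
  · have hd := det_eq m
    have hdis : Disjoint (line h) (line k) := by
      refine hdisj.resolve_left fun e => ?_
      rcases diag_or_anti_of_line_eq e with ⟨e1, -⟩ | ⟨e1, -⟩
      · exact hne 0 1 e1
      · exact hne 0 0 e1
    have hw0 := mul_nonneg_of_disjoint hdis
    rw [← hm] at hw0
    set w := m 0 0 * m 1 0 * (m 0 1 * m 1 1) with hw
    have hwpos : 0 < w := lt_of_le_of_ne hw0
      (mul_ne_zero (mul_ne_zero (hne _ _) (hne _ _)) (mul_ne_zero (hne _ _) (hne _ _))).symm
    -- disjointness of `k` from its image under `c`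
    have hM : ∃ N : SL(2, ℝ), N = m * flow l * m⁻¹ ∧ (k⁻¹ * (c * k) = N ∨ k⁻¹ * (c * k) = -N) := by
      refine ⟨_, rfl, ?_⟩
      rcases hcl with rfl | rfl
      · left; rw [hm, translation]; group
      · right; rw [hm, translation, neg_mul, mul_neg]; group
    obtain ⟨N, hN, hcN⟩ := hM
    have n00 : N 0 0 = Real.exp (l / 2) * (m 0 0 * m 1 1) -
        Real.exp (-(l / 2)) * (m 0 1 * m 1 0) := by
      rw [hN]
      simp only [mul_entry, inv_00, inv_10, flow_00, flow_01, flow_10, flow_11]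
      ring
    have n11 : N 1 1 = Real.exp (-(l / 2)) * (m 0 0 * m 1 1) -
        Real.exp (l / 2) * (m 0 1 * m 1 0) := by
      rw [hN]
      simp only [mul_entry, inv_01, inv_11, flow_00, flow_01, flow_10, flow_11]
      ring
    have n01 : N 0 1 = -(δ * (m 0 0 * m 0 1)) := by
      rw [hN]
      simp only [mul_entry, inv_01, inv_11, flow_00, flow_01, flow_10, flow_11]
      rw [hδ]; ring
    have n10 : N 1 0 = δ * (m 1 0 * m 1 1) := by
      rw [hN]
      simp only [mul_entry, inv_00, inv_10, flow_00, flow_01, flow_10, flow_11]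
      rw [hδ]; ring
    have n01' : N 0 1 ≠ 0 := by
      rw [n01]
      exact neg_ne_zero.2 (mul_ne_zero hδ0.ne' (mul_ne_zero (hne _ _) (hne _ _)))
    have ntr : N 0 0 + N 1 1 ≠ 0 := by
      have : N 0 0 + N 1 1 = Real.exp (l / 2) + Real.exp (-(l / 2)) := by
        rw [n00, n11]; linear_combination (Real.exp (l / 2) + Real.exp (-(l / 2))) * hd
      rw [this]
      positivity
    have hq : 0 ≤ N 0 0 * N 1 0 * (N 0 1 * N 1 1) := by
      rcases hdisj2 with e | e
      · exfalso
        have := diag_or_anti_of_line_eq e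
        rcases hcN with hc' | hc' <;> rw [hc'] at this
        · rcases this with ⟨e1, -⟩ | ⟨e1, e2⟩
          · exact n01' e1
          · rw [e1, e2] at ntr; simp at ntr
        · simp only [neg_entry, neg_eq_zero] at this
          rcases this with ⟨e1, -⟩ | ⟨e1, e2⟩
          · exact n01' e1
          · rw [e1, e2] at ntr; simp at ntr
      · have := mul_nonneg_of_disjoint e
        rcases hcN with hc' | hc' <;> rw [hc'] at this
        · exact this
        · simpa only [neg_entry, neg_mul_neg] using this
    -- Its sign turns disjointness of `k` from its image under `c` into `δ² * w ≥ 1`, a collar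
    -- inequality.
    have hq2 : N 0 0 * N 1 0 * (N 0 1 * N 1 1) = δ ^ 2 * w * (δ ^ 2 * w - 1) := by
      have e1 : N 0 0 * N 1 1 = 1 + N 0 1 * N 1 0 := by
        have := det_eq N
        linarith
      have e2 : N 0 1 * N 1 0 = -(δ ^ 2 * w) := by rw [n01, n10, hw]; ring
      calc _ = N 0 0 * N 1 1 * (N 0 1 * N 1 0) := by ring
        _ = _ := by rw [e1, e2]; ring
    have hδw : 1 ≤ δ ^ 2 * w := by
      rw [hq2] at hq
      have := nonneg_of_mul_nonneg_right hq (by positivity)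
      linarith
    have hXw : X ^ 2 ≤ w := by
      have e1 : X ^ 2 * (δ ^ 2 * w) = w := by
        calc _ = (X * δ) ^ 2 * w := by ring
          _ = w := by rw [hXδ]; ring
      nlinarith [sq_nonneg X]
    have hX4 : X ^ 2 < 4 * w := by linarith
    have hS2 : (m 0 0 * m 1 1 + m 0 1 * m 1 0) ^ 2 = 1 + 4 * w := by
      rw [hw]; linear_combination (m 0 0 * m 1 1 - m 0 1 * m 1 0 + 1) * hd
    set A := m 0 0 * m 1 0 with hA
    set B := m 0 1 * m 1 1 with hB
    set S := m 0 0 * m 1 1 + m 0 1 * m 1 0 with hSdef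
    -- Completing the square leaves the positive remainder `(4w - X²) / 4`. Taking `r = 1` and `r =
    -- exp (l / 2)` shows that the point and its image are both on the side of `k` given by the sign
    -- of `A`.
    have gen : ∀ r r' : ℝ, 0 < r → r * r' = 1 →
        0 < A * (A * (r ^ 2 * (X ^ 2 + 1)) + S * X + B * r' ^ 2) := by
      intro r r' hr hrr
      have hN : 0 < r ^ 2 * (X ^ 2 + 1) := by positivity
      have hr' : r ^ 2 * r' ^ 2 = 1 := by rw [← mul_pow, hrr, one_pow]
      have e1 : (r ^ 2 * (X ^ 2 + 1)) * (A * (A * (r ^ 2 * (X ^ 2 + 1)) + S * X + B * r' ^ 2)) =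
          (A * (r ^ 2 * (X ^ 2 + 1)) + S * X / 2) ^ 2 + (4 * w - X ^ 2) / 4 := by
        linear_combination (X ^ 2 + 1) * A * B * hr' - X ^ 2 / 4 * hS2 - (X ^ 2 + 1) * hw
      have e2 : 0 < (A * (r ^ 2 * (X ^ 2 + 1)) + S * X / 2) ^ 2 + (4 * w - X ^ 2) / 4 := by
        have := sq_nonneg (A * (r ^ 2 * (X ^ 2 + 1)) + S * X / 2)
        linarith
      rw [← e1] at e2
      exact pos_of_mul_pos_right e2 hN.le
    have g1 := gen 1 1 one_pos (one_mul 1)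
    have g2 := gen _ _ hE hexp
    rw [f1, f2]
    refine mul_pos_of_mul_pos_same (a := A) ?_ g2
    simpa using g1

/-- The twist does not change the trace of parabolic elements. -/
theorem twist_trace_of_parabolic [ProperlyDiscontinuousSMul Γ ℍ] (hS : IsSimpleAxis Γ g)
    {x : ℍ} (hx : OffLifts Γ g x) {c h : SL(2, ℝ)} (hc : c ∈ Γ) {y : ℝ} (hy : y ≠ 0)
    (h00 : (h⁻¹ * c * h) 0 0 = -1) (h01 : (h⁻¹ * c * h) 0 1 = y) (h10 : (h⁻¹ * c * h) 1 0 = 0)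
    (h11 : (h⁻¹ * c * h) 1 1 = -1) (t : ℝ) :
    twist Γ g x t c 0 0 + twist Γ g x t c 1 1 = c 0 0 + c 1 1 := by
  set n := h⁻¹ * c * h with hn
  have hypos : 0 < |y| := abs_pos.2 hy
  -- In this frame `c` is a horizontal translation by `-y`. A half circle disjoint from its
  -- translate has diameter at most `|y|`, so no lift reaches the height `|y|`.
  let P : ℍ := ⟨⟨0, |y|⟩, hypos⟩
  refine twist_eq_conj_of_same_side hS (p := h • P) hx hc (fun k hk => ?_) t
  obtain ⟨a, ha, hak⟩ := hk.axis hS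
  have hu := upper_of_axis Γ ha hc hak
  have hv := lower_of_axis Γ ha hc hak
  have hdisj := lines_eq_or_disjoint hS hk (hk.mul hc)
  set m := k⁻¹ * h with hm
  have ecP : k⁻¹ • c • h • P = (m * n) • P := by
    rw [hm, hn, ← mul_smul, ← mul_smul]; congr 1; group
  rw [ecP, ← mul_smul]
  apply re_mul_re_pos
  have hd := det_eq m
  have eN : k⁻¹ * (c * k) = m * n * m⁻¹ := by rw [hm, hn]; group
  have eN' : k⁻¹ * c * k = m * n * m⁻¹ := by rw [← eN]; group
  set w := m 0 0 * m 1 0 with hw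
  have n00 : (m * n * m⁻¹) 0 0 = -1 - y * w := by
    simp only [mul_entry, inv_00, inv_10, h00, h01, h10, h11]
    rw [hw]; linear_combination -hd
  have n11 : (m * n * m⁻¹) 1 1 = -1 + y * w := by
    simp only [mul_entry, inv_01, inv_11, h00, h01, h10, h11]
    rw [hw]; linear_combination -hd
  have n01 : (m * n * m⁻¹) 0 1 = y * m 0 0 ^ 2 := by
    simp only [mul_entry, inv_01, inv_11, h00, h01, h10, h11]
    ring
  have n10 : (m * n * m⁻¹) 1 0 = -(y * m 1 0 ^ 2) := by
    simp only [mul_entry, inv_00, inv_10, h00, h01, h10, h11]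
    ring
  rw [eN', n01, n10] at hu hv
  have h0ne : m 0 0 ≠ 0 := by
    intro e
    have h1 : m 1 0 ≠ 0 := fun e' => by rw [e, e'] at hd; simp at hd
    have := hv (by rw [e]; ring)
    rw [neg_eq_zero] at this
    exact mul_ne_zero hy (pow_ne_zero 2 h1) this
  have h1ne : m 1 0 ≠ 0 := by
    intro e
    exact mul_ne_zero hy (pow_ne_zero 2 h0ne) (hu (by rw [e]; ring))
  have hwne : w ≠ 0 := mul_ne_zero h0ne h1ne
  -- The half circle representing `k` has diameter `1 / |w|`.
  have hyw : 1 ≤ y ^ 2 * w ^ 2 := by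
    rcases hdisj with e | e
    · exfalso
      have := diag_or_anti_of_line_eq e
      rw [eN, n00, n01, n10, n11] at this
      rcases this with ⟨e1, -⟩ | ⟨e1, e2⟩
      · exact mul_ne_zero hy (pow_ne_zero 2 h0ne) e1
      · linarith
    · have := mul_nonneg_of_disjoint e
      rw [eN, n00, n01, n10, n11] at this
      have e1 : (-1 - y * w) * -(y * m 1 0 ^ 2) * (y * m 0 0 ^ 2 * (-1 + y * w)) =
          (y ^ 2 * w ^ 2) * (y ^ 2 * w ^ 2 - 1) := by rw [hw]; ring
      rw [e1] at this
      have := nonneg_of_mul_nonneg_right this (by positivity)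
      linarith
  have hre : P.re = 0 := rfl
  have hnsq : Complex.normSq (P : ℂ) = y ^ 2 := by
    rw [Complex.normSq_apply]
    change 0 * 0 + |y| * |y| = _
    rw [abs_mul_abs_self]; ring
  have hS2 : (m 0 0 * m 1 1 + m 0 1 * m 1 0) ^ 2 = 1 + 4 * (w * (m 0 1 * m 1 1)) := by
    rw [hw]; linear_combination (m 0 0 * m 1 1 - m 0 1 * m 1 0 + 1) * hd
  have f1 : w * reNum m P = w ^ 2 * y ^ 2 - 1 / 4 +
      ((m 0 0 * m 1 1 + m 0 1 * m 1 0) / 2) ^ 2 := by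
    rw [reNum, hre, hnsq]
    linear_combination -hS2 / 4 - y ^ 2 * w * hw
  have f2 : w * reNum (m * n) P = w ^ 2 * y ^ 2 - 1 / 4 +
      ((m 0 0 * m 1 1 + m 0 1 * m 1 0) / 2 - w * y) ^ 2 := by
    rw [reNum, hre, hnsq]
    simp only [mul_entry, h00, h01, h10, h11]
    linear_combination (-hS2) / 4 - 2 * y ^ 2 * w * hw
  apply mul_pos_of_mul_pos_same (a := w)
  · rw [f1]
    have := sq_nonneg ((m 0 0 * m 1 1 + m 0 1 * m 1 0) / 2)
    linarith
  · rw [f2]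
    have := sq_nonneg ((m 0 0 * m 1 1 + m 0 1 * m 1 0) / 2 - w * y)
    linarith

/-- An element of trace smaller than `2` never gets trace `2`. -/
theorem twist_trace_ne_two [ProperlyDiscontinuousSMul Γ ℍ] (hS : IsSimpleAxis Γ g)
    (hfree : ∀ γ ∈ Γ, ∀ z : ℍ, γ • z = z → γ = 1 ∨ γ = -1)
    {x : ℍ} (hx : OffLifts Γ g x) {c : SL(2, ℝ)} (hc : c ∈ Γ) (htr : c 0 0 + c 1 1 < 2) (t : ℝ) :
    twist Γ g x t c 0 0 + twist Γ g x t c 1 1 ≠ 2 := by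
  suffices h : twist Γ g x t c 0 0 + twist Γ g x t c 1 1 = c 0 0 + c 1 1 ∨
      2 < |twist Γ g x t c 0 0 + twist Γ g x t c 1 1| by
    rcases h with h | h
    · rw [h]; exact htr.ne
    · intro e; rw [e] at h; norm_num at h
  -- Elliptic elements contradict freeness. In the middle case the hypothesis leaves only trace -2,
  -- including `c = -1`. A hyperbolic element is treated according to whether its axis is a lift.
  rcases lt_trichotomy |c 0 0 + c 1 1| 2 with h | h | h
  · obtain ⟨z, hz⟩ := exists_fixedPoint h
    rcases hfree c hc z hz with rfl | rfl
    · norm_num at h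
    · simp only [neg_entry, one_00, one_11] at h
      norm_num at h
  · left
    have htr2 : c 0 0 + c 1 1 = -2 := by
      rcases (abs_eq two_pos.le).1 h with e | e
      · linarith
      · exact e
    by_cases hc1 : c = -1
    · rw [twist, hc1, neg_smul', one_smul, twistIsometry_self hS, one_mul]
    obtain ⟨k, q00, q01, q10, q11⟩ := exists_parabolic_conj hc1 htr2
    exact twist_trace_of_parabolic hS hx hc (h := k) q01 q00 rfl q10 q11 t
  · obtain ⟨k, hk⟩ := exists_isOrientedAxis h
    by_cases hlift : ∃ k₀, IsSignedLift Γ g k₀ ∧ line k₀ = line k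
    · obtain ⟨k₀, hk₀, e⟩ := hlift
      exact Or.inl (twist_trace_of_axis_lift hS hx hc hk hk₀ e t)
    · push Not at hlift
      obtain ⟨δ, hδ, hoff⟩ := exists_offLifts_near hS hlift 0
      have hp := hoff (δ / 2) (by positivity) (by rw [sub_zero, abs_of_pos] <;> linarith)
      rw [trace_eq_of_conj (twist_basepoint hS hx hp hc t)]
      rcases twist_axis hS hc hk (δ / 2) with h1 | ⟨h1, -⟩
      · rw [h1]; exact Or.inl rfl
      · exact Or.inr (h1 t)

end Trace

/-! ### The angle between two axes -/

section Angle

open Filter Topology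

/-- The area form of the plane. -/
def wedge (u w : Fin 2 → ℝ) : ℝ := u 0 * w 1 - u 1 * w 0

/-- The cosine of the angle between the oriented axes of two hyperbolic matrices, as a function of
their traces and determinants. It does not change when the matrices are rescaled. -/
noncomputable def cosAngle (M M' : Matrix (Fin 2) (Fin 2) ℝ) : ℝ :=
  (2 * (M * M').trace / (M.trace * M'.trace) - 1) /
    (√(1 - 4 * M.det / M.trace ^ 2) * √(1 - 4 * M'.det / M'.trace ^ 2))

theorem cosAngle_smul {r r' : ℝ} (hr : r ≠ 0) (hr' : r' ≠ 0) (M M' : Matrix (Fin 2) (Fin 2) ℝ) :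
    cosAngle (r • M) (r' • M') = cosAngle M M' := by
  have e : ∀ (s : ℝ) (N : Matrix (Fin 2) (Fin 2) ℝ), s ≠ 0 →
      4 * (s • N).det / (s • N).trace ^ 2 = 4 * N.det / N.trace ^ 2 := by
    intro s N hs
    rw [Matrix.det_smul, Matrix.trace_smul, Fintype.card_fin, smul_eq_mul, mul_pow,
      mul_left_comm, mul_div_mul_left _ _ (pow_ne_zero 2 hs)]
  have e2 : 2 * (r • M * r' • M').trace / ((r • M).trace * (r' • M').trace) =
      2 * (M * M').trace / (M.trace * M'.trace) := by
    rw [Matrix.smul_mul, Matrix.mul_smul, Matrix.trace_smul, Matrix.trace_smul, Matrix.trace_smul,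
      Matrix.trace_smul, smul_eq_mul, smul_eq_mul, smul_eq_mul, smul_eq_mul]
    rw [show 2 * (r * (r' * (M * M').trace)) = (r * r') * (2 * (M * M').trace) by ring,
      show r * M.trace * (r' * M'.trace) = (r * r') * (M.trace * M'.trace) by ring,
      mul_div_mul_left _ _ (mul_ne_zero hr hr')]
  rw [cosAngle, cosAngle, e r M hr, e r' M' hr', e2]

theorem cosAngle_conj (k m n : SL(2, ℝ)) :
    cosAngle ((k * m * k⁻¹ : SL(2, ℝ)) : Matrix (Fin 2) (Fin 2) ℝ) (k * n * k⁻¹ : SL(2, ℝ)) =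
      cosAngle m n := by
  have htr : ∀ q : SL(2, ℝ), ((k * q * k⁻¹ : SL(2, ℝ)) : Matrix (Fin 2) (Fin 2) ℝ).trace =
      (q : Matrix (Fin 2) (Fin 2) ℝ).trace := fun q => by
    rw [Matrix.trace_fin_two, Matrix.trace_fin_two]
    exact trace_conj k q
  have e : (k * m * k⁻¹) * (k * n * k⁻¹) = k * (m * n) * k⁻¹ := by group
  rw [cosAngle, cosAngle, ← Matrix.SpecialLinearGroup.coe_mul, e, htr, htr, htr,
    Matrix.SpecialLinearGroup.coe_mul, Matrix.SpecialLinearGroup.det_coe,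
    Matrix.SpecialLinearGroup.det_coe, Matrix.SpecialLinearGroup.det_coe,
    Matrix.SpecialLinearGroup.det_coe]

theorem HasAttractingPair.eqs {M : Matrix (Fin 2) (Fin 2) ℝ} {u w : Fin 2 → ℝ}
    (h : HasAttractingPair M u w) : ∃ μ ν : ℝ, ν ^ 2 < μ ^ 2 ∧
      M 0 0 * u 0 + M 0 1 * u 1 = μ * u 0 ∧ M 1 0 * u 0 + M 1 1 * u 1 = μ * u 1 ∧
      M 0 0 * w 0 + M 0 1 * w 1 = ν * w 0 ∧ M 1 0 * w 0 + M 1 1 * w 1 = ν * w 1 := by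
  obtain ⟨μ, ν, h1, h2, h3⟩ := h
  have a0 := congrFun h2 0
  have a1 := congrFun h2 1
  have b0 := congrFun h3 0
  have b1 := congrFun h3 1
  simp only [Matrix.mulVec, dotProduct, Fin.sum_univ_two, Pi.smul_apply, smul_eq_mul] at a0 a1 b0 b1
  exact ⟨μ, ν, h1, a0, a1, b0, b1⟩

/-- Trace, determinant and entries of a matrix in terms of its eigenvectors. -/
theorem HasAttractingPair.spectral {M : Matrix (Fin 2) (Fin 2) ℝ} {u w : Fin 2 → ℝ}
    (h : HasAttractingPair M u w) (hD : wedge u w ≠ 0) : ∃ μ ν : ℝ, ν ^ 2 < μ ^ 2 ∧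
      M.trace = μ + ν ∧ M.det = μ * ν ∧
      M 0 0 * wedge u w = μ * (u 0 * w 1) - ν * (w 0 * u 1) ∧
      M 0 1 * wedge u w = (ν - μ) * (u 0 * w 0) ∧
      M 1 0 * wedge u w = (μ - ν) * (u 1 * w 1) ∧
      M 1 1 * wedge u w = ν * (w 1 * u 0) - μ * (u 1 * w 0) := by
  obtain ⟨μ, ν, hlt, a0, a1, b0, b1⟩ := h.eqs
  have e00 : M 0 0 * wedge u w = μ * (u 0 * w 1) - ν * (w 0 * u 1) := by
    rw [wedge]; linear_combination w 1 * a0 - u 1 * b0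
  have e01 : M 0 1 * wedge u w = (ν - μ) * (u 0 * w 0) := by
    rw [wedge]; linear_combination u 0 * b0 - w 0 * a0
  have e10 : M 1 0 * wedge u w = (μ - ν) * (u 1 * w 1) := by
    rw [wedge]; linear_combination w 1 * a1 - u 1 * b1
  have e11 : M 1 1 * wedge u w = ν * (w 1 * u 0) - μ * (u 1 * w 0) := by
    rw [wedge]; linear_combination u 0 * b1 - w 0 * a1
  refine ⟨μ, ν, hlt, ?_, ?_, e00, e01, e10, e11⟩
  · apply mul_right_cancel₀ hD
    rw [Matrix.trace_fin_two, add_mul, e00, e11, wedge]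
    ring
  · apply mul_right_cancel₀ (pow_ne_zero 2 hD)
    have : M.det * wedge u w ^ 2 = M 0 0 * wedge u w * (M 1 1 * wedge u w) -
        M 0 1 * wedge u w * (M 1 0 * wedge u w) := by
      rw [Matrix.det_fin_two]; ring
    rw [this, e00, e01, e10, e11, wedge]
    ring

theorem HasAttractingPair.wedge_ne_zero {M : Matrix (Fin 2) (Fin 2) ℝ} {u w : Fin 2 → ℝ}
    (h : HasAttractingPair M u w) (hu : u ≠ 0) (hw : w ≠ 0) : wedge u w ≠ 0 := by
  obtain ⟨μ, ν, hlt, a0, a1, b0, b1⟩ := h.eqs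
  have hne : μ ≠ ν := by rintro rfl; exact lt_irrefl _ hlt
  exact wedge_ne_zero_of_eigen hne hu hw a0 a1 b0 b1

/-- The square root equals `|(μ - ν) / (μ + ν)|`, and the quotient is positive because `μ`
dominates. This includes `ν = 0`, needed for rank one limits. -/
theorem sqrt_disc {μ ν : ℝ} (h : ν ^ 2 < μ ^ 2) :
    μ + ν ≠ 0 ∧ 0 < (μ - ν) / (μ + ν) ∧
      √(1 - 4 * (μ * ν) / (μ + ν) ^ 2) = (μ - ν) / (μ + ν) := by
  have h1 : 0 < (μ - ν) * (μ + ν) := by nlinarith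
  have h2 : μ + ν ≠ 0 := by intro e; rw [e, mul_zero] at h1; exact lt_irrefl _ h1
  have h3 : 0 < (μ - ν) / (μ + ν) := by
    have : (μ - ν) / (μ + ν) = (μ - ν) * (μ + ν) / (μ + ν) ^ 2 := by field_simp
    rw [this]
    positivity
  refine ⟨h2, h3, ?_⟩
  have e : 1 - 4 * (μ * ν) / (μ + ν) ^ 2 = ((μ - ν) / (μ + ν)) ^ 2 := by
    field_simp
    ring
  rw [e, Real.sqrt_sq h3.le]

/-- Substituting the spectral decompositions cancels all eigenvalues and leaves a cross ratio of
eigendirections. The value is -1 exactly when an attracting direction equals a repelling direction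
of the other matrix. -/
theorem cosAngle_eq {M M' : Matrix (Fin 2) (Fin 2) ℝ} {u w u' w' : Fin 2 → ℝ}
    (h : HasAttractingPair M u w) (h' : HasAttractingPair M' u' w') (hD : wedge u w ≠ 0)
    (hD' : wedge u' w' ≠ 0) :
    cosAngle M M' = 2 * (wedge u w' * wedge u' w / (wedge u w * wedge u' w')) - 1 := by
  obtain ⟨μ, ν, hlt, ht, hd, e00, e01, e10, e11⟩ := h.spectral hD
  obtain ⟨μ', ν', hlt', ht', hd', e00', e01', e10', e11'⟩ := h'.spectral hD'
  obtain ⟨h1, h2, h3⟩ := sqrt_disc hlt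
  obtain ⟨h1', h2', h3'⟩ := sqrt_disc hlt'
  have hs : μ - ν ≠ 0 := fun e => by rw [e, zero_div] at h2; exact lt_irrefl _ h2
  have hs' : μ' - ν' ≠ 0 := fun e => by rw [e, zero_div] at h2'; exact lt_irrefl _ h2'
  have htr : (M * M').trace * (wedge u w * wedge u' w') =
      (2 * ν * ν' + ν * (μ' - ν') + ν' * (μ - ν)) * (wedge u w * wedge u' w') +
        (μ - ν) * (μ' - ν') * (wedge u w' * wedge u' w) := by
    have : (M * M').trace * (wedge u w * wedge u' w') =
        (M 0 0 * wedge u w) * (M' 0 0 * wedge u' w') + (M 0 1 * wedge u w) * (M' 1 0 * wedge u' w') +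
        ((M 1 0 * wedge u w) * (M' 0 1 * wedge u' w') +
          (M 1 1 * wedge u w) * (M' 1 1 * wedge u' w')) := by
      rw [Matrix.trace_fin_two, Matrix.mul_apply, Matrix.mul_apply, Fin.sum_univ_two,
        Fin.sum_univ_two]
      ring
    rw [this, e00, e01, e10, e11, e00', e01', e10', e11']
    simp only [wedge]
    ring
  have hR : (M * M').trace = 2 * ν * ν' + ν * (μ' - ν') + ν' * (μ - ν) +
      (μ - ν) * (μ' - ν') * (wedge u w' * wedge u' w / (wedge u w * wedge u' w')) := by
    apply mul_right_cancel₀ (mul_ne_zero hD hD')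
    rw [htr]
    field_simp
  rw [cosAngle, ht, ht', hd, hd', h3, h3', hR]
  generalize wedge u w' * wedge u' w / (wedge u w * wedge u' w') = R
  field_simp
  ring

theorem tendsto_cosAngle {α : Type*} {F : Filter α} {B C : α → Matrix (Fin 2) (Fin 2) ℝ}
    {M M' : Matrix (Fin 2) (Fin 2) ℝ} {u w u' w' : Fin 2 → ℝ}
    (h : HasAttractingPair M u w) (h' : HasAttractingPair M' u' w') (hD : wedge u w ≠ 0)
    (hD' : wedge u' w' ≠ 0) (hB : Tendsto B F (𝓝 M)) (hC : Tendsto C F (𝓝 M')) :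
    Tendsto (fun t => cosAngle (B t) (C t)) F (𝓝 (cosAngle M M')) := by
  obtain ⟨μ, ν, hlt, ht, hd, -⟩ := h.spectral hD
  obtain ⟨μ', ν', hlt', ht', hd', -⟩ := h'.spectral hD'
  obtain ⟨h1, h2, h3⟩ := sqrt_disc hlt
  obtain ⟨h1', h2', h3'⟩ := sqrt_disc hlt'
  have htr : ∀ {N : Matrix (Fin 2) (Fin 2) ℝ} {A : α → Matrix (Fin 2) (Fin 2) ℝ},
      Tendsto A F (𝓝 N) → Tendsto (fun t => (A t).trace) F (𝓝 N.trace) := fun hA =>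
    (Continuous.tendsto (by fun_prop : Continuous fun N : Matrix (Fin 2) (Fin 2) ℝ => N.trace)
      _).comp hA
  have hdet : ∀ {N : Matrix (Fin 2) (Fin 2) ℝ} {A : α → Matrix (Fin 2) (Fin 2) ℝ},
      Tendsto A F (𝓝 N) → Tendsto (fun t => (A t).det) F (𝓝 N.det) := fun hA =>
    (Continuous.tendsto (by fun_prop : Continuous fun N : Matrix (Fin 2) (Fin 2) ℝ => N.det)
      _).comp hA
  have n1 : M.trace ≠ 0 := by rwa [ht]
  have n1' : M'.trace ≠ 0 := by rwa [ht']
  unfold cosAngle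
  refine Tendsto.div ((((htr (hB.mul hC)).const_mul 2).div ((htr hB).mul (htr hC))
    (mul_ne_zero n1 n1')).sub_const 1) ((Tendsto.sqrt ((((hdet hB).const_mul 4).div
      ((htr hB).pow 2) (pow_ne_zero 2 n1)).const_sub 1)).mul (Tendsto.sqrt
      ((((hdet hC).const_mul 4).div ((htr hC).pow 2) (pow_ne_zero 2 n1')).const_sub 1))) ?_
  rw [ht, ht', hd, hd', h3, h3']
  exact mul_ne_zero h2.ne' h2'.ne'

/-- Column 0 represents the forward end of a geodesic and column 1 the backward end, so coincidences
of ends are zero entries of `k⁻¹ * k'`. -/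
theorem wedge_column (k k' : SL(2, ℝ)) (i j : Fin 2) :
    wedge (column k i) (column k' j) = if i = 0 then (k⁻¹ * k') 1 j else -(k⁻¹ * k') 0 j := by
  simp only [wedge, column, Matrix.mulVec_single_one, Matrix.col_apply, mul_entry, inv_00, inv_01,
    inv_10, inv_11]
  fin_cases i
  · simp; ring
  · simp; ring

theorem column_ne_zero (k : SL(2, ℝ)) (i : Fin 2) : column k i ≠ 0 := by
  intro e
  have hd := det_eq k
  have e0 := congrFun e 0
  have e1 := congrFun e 1
  simp only [column, Matrix.mulVec_single_one, Matrix.col_apply, Pi.zero_apply] at e0 e1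
  fin_cases i
  · simp only [Fin.zero_eta] at e0 e1; rw [e0, e1] at hd; simp at hd
  · simp only [Fin.mk_one] at e0 e1; rw [e0, e1] at hd; simp at hd

theorem IsOrientedAxis.hasAttractingPair {b h : SL(2, ℝ)} (hh : IsOrientedAxis b h) :
    HasAttractingPair b (column h 0) (column h 1) := by
  obtain ⟨l, hl, hb⟩ := hh
  have e1 : Real.exp (-(l / 2)) < Real.exp (l / 2) := Real.exp_lt_exp.2 (by linarith)
  have hlt : Real.exp (-(l / 2)) ^ 2 < Real.exp (l / 2) ^ 2 :=
    pow_lt_pow_left₀ e1 (Real.exp_pos _).le two_ne_zero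
  have key : ∀ i, ((translation h l : SL(2, ℝ)) : Matrix (Fin 2) (Fin 2) ℝ).mulVec (column h i) =
      flow l i i • column h i := by
    intro i
    rw [column, Matrix.mulVec_mulVec, ← Matrix.SpecialLinearGroup.coe_mul, translation,
      inv_mul_cancel_right, Matrix.SpecialLinearGroup.coe_mul, ← Matrix.mulVec_mulVec,
      ← Matrix.mulVec_smul]
    congr 1
    ext r
    rw [Matrix.mulVec_single_one, Matrix.col_apply]
    fin_cases i <;> fin_cases r <;> simp
  rcases hb with rfl | rfl
  · exact ⟨_, _, hlt, key 0, key 1⟩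
  · refine ⟨-Real.exp (l / 2), -Real.exp (-(l / 2)), by simpa using hlt, ?_, ?_⟩
    · rw [Matrix.SpecialLinearGroup.coe_neg, Matrix.neg_mulVec, key]
      exact (_root_.neg_smul _ _).symm
    · rw [Matrix.SpecialLinearGroup.coe_neg, Matrix.neg_mulVec, key]
      exact (_root_.neg_smul _ _).symm

theorem IsOrientedAxis.trace {b h : SL(2, ℝ)} (hh : IsOrientedAxis b h) :
    2 < |b 0 0 + b 1 1| := by
  obtain ⟨l, hl, hb⟩ := hh
  have key : 2 < flow l 0 0 + flow l 1 1 := by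
    have e : Real.exp (l / 2) * Real.exp (-(l / 2)) = 1 := by rw [← Real.exp_add]; simp
    have e1 : Real.exp (-(l / 2)) < Real.exp (l / 2) := Real.exp_lt_exp.2 (by linarith)
    have e2 : 0 < (Real.exp (l / 2) - Real.exp (-(l / 2))) ^ 2 := by
      have := sub_pos.2 e1
      positivity
    rw [flow_00, flow_11]
    nlinarith [Real.exp_pos (l / 2), Real.exp_pos (-(l / 2))]
  rcases hb with rfl | rfl
  · rw [translation, trace_conj]
    exact lt_of_lt_of_le key (le_abs_self _)
  · rw [neg_entry, neg_entry, ← neg_add, abs_neg, translation, trace_conj]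
    exact lt_of_lt_of_le key (le_abs_self _)

/-! ### Velocities -/

theorem velocity_eq (k : SL(2, ℝ)) :
    (k 1 0 * Complex.I + k 1 1 : ℂ) ≠ 0 ∧
      velocity k = Complex.I / (k 1 0 * Complex.I + k 1 1 : ℂ) ^ 2 := by
  have hd := det_eq k
  have hne : (k 1 0 * Complex.I + k 1 1 : ℂ) ≠ 0 := by
    intro h0
    have him := congrArg Complex.im h0
    have hre := congrArg Complex.re h0
    simp at him hre
    rw [him, hre] at hd
    simp at hd
  refine ⟨hne, ?_⟩
  have hfun : (fun s : ℝ => (geodesic k s : ℂ)) = fun s : ℝ =>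
      (k 0 0 * (Real.exp s * Complex.I) + k 0 1 : ℂ) / (k 1 0 * (Real.exp s * Complex.I) + k 1 1) := by
    funext s
    rw [geodesic, mul_smul, UpperHalfPlane.coe_specialLinearGroup_apply, coe_flow_smul_I]
    rfl
  have hexp : HasDerivAt (fun s : ℝ => (Real.exp s * Complex.I : ℂ)) Complex.I 0 := by
    have := ((Real.hasDerivAt_exp 0).ofReal_comp).mul_const Complex.I
    simpa using this
  have h1 := ((hexp.const_mul (k 0 0 : ℂ)).add_const (k 0 1 : ℂ)).div
    ((hexp.const_mul (k 1 0 : ℂ)).add_const (k 1 1 : ℂ)) (by simpa using hne)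
  rw [velocity, hfun]
  refine h1.deriv.trans ?_
  simp only [Real.exp_zero, Complex.ofReal_one, one_mul]
  congr 1
  have hd' : (k 0 0 * k 1 1 - k 0 1 * k 1 0 : ℂ) = 1 := by exact_mod_cast hd
  linear_combination Complex.I * hd'

/-- A rotation matrix of angle φ about `i` rotates tangent vectors by twice that angle: velocities
are multiplied by `(p - qi)²`, and `cos 2φ = p² - q²`. -/
theorem angle_velocity {k h : SL(2, ℝ)} {p q : ℝ} (h00 : (k⁻¹ * h) 0 0 = p)
    (h01 : (k⁻¹ * h) 0 1 = -q) (h10 : (k⁻¹ * h) 1 0 = q) (h11 : (k⁻¹ * h) 1 1 = p) :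
    InnerProductGeometry.angle (velocity k) (velocity h) = Real.arccos (p ^ 2 - q ^ 2) := by
  have hd := det_eq (k⁻¹ * h)
  rw [h00, h01, h10, h11] at hd
  have hd' : p ^ 2 + q ^ 2 = 1 := by linarith
  have e : h = k * (k⁻¹ * h) := by group
  have e10 : h 1 0 = k 1 0 * p + k 1 1 * q := by
    rw [e, mul_entry, h00, h10]
  have e11 : h 1 1 = -(k 1 0 * q) + k 1 1 * p := by
    rw [e, mul_entry, h01, h11]; ring
  obtain ⟨hk0, hk⟩ := velocity_eq k
  obtain ⟨hh0, hh⟩ := velocity_eq h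
  have efac : (h 1 0 * Complex.I + h 1 1 : ℂ) =
      (k 1 0 * Complex.I + k 1 1) * (p + q * Complex.I) := by
    rw [e10, e11]
    push_cast
    linear_combination (-(k 1 0 * q : ℂ)) * Complex.I_sq
  have epq : (p + q * Complex.I : ℂ) * (p - q * Complex.I) = 1 := by
    have : (p ^ 2 + q ^ 2 : ℂ) = 1 := by exact_mod_cast hd'
    linear_combination this - (q ^ 2 : ℂ) * Complex.I_sq
  have epq0 : (p + q * Complex.I : ℂ) ≠ 0 := left_ne_zero_of_mul_eq_one epq
  have ev : velocity h = velocity k * (p - q * Complex.I) ^ 2 := by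
    rw [hk, hh, efac, div_mul_eq_mul_div, div_eq_div_iff (pow_ne_zero 2 (mul_ne_zero hk0 epq0))
      (pow_ne_zero 2 hk0), mul_pow]
    linear_combination (-(Complex.I * (k 1 0 * Complex.I + k 1 1) ^ 2) *
      ((p + q * Complex.I) * (p - q * Complex.I) + 1 : ℂ)) * epq
  have hv0 : velocity k ≠ 0 := by
    rw [hk]
    exact div_ne_zero Complex.I_ne_zero (pow_ne_zero 2 hk0)
  have hnorm : ‖(p - q * Complex.I : ℂ) ^ 2‖ = 1 := by
    rw [norm_pow, ← Complex.normSq_eq_norm_sq, Complex.normSq_apply]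
    simp
    linarith
  have hinner : inner ℝ (velocity k) (velocity k * (p - q * Complex.I) ^ 2) =
      ‖velocity k‖ ^ 2 * (p ^ 2 - q ^ 2) := by
    rw [Complex.inner, ← Complex.normSq_eq_norm_sq, mul_right_comm, Complex.mul_conj',
      ← Complex.ofReal_pow, Complex.re_ofReal_mul, Complex.normSq_eq_norm_sq]
    congr 1
    simp [sq]
  rw [ev, InnerProductGeometry.angle, hinner, norm_mul, hnorm, mul_one, ← sq,
    mul_div_cancel_left₀ _ (pow_ne_zero 2 (norm_ne_zero_iff.2 hv0))]

theorem isOrientedAxis_flow {b k : SL(2, ℝ)} (h : IsOrientedAxis b k) (s : ℝ) :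
    IsOrientedAxis b (k * flow s) := by
  obtain ⟨l, hl, h⟩ := h
  exact ⟨l, hl, by rwa [translation_flow]⟩

theorem smul_I_of_rotation {m : SL(2, ℝ)} (h0 : m 0 0 = m 1 1) (h1 : m 0 1 = -m 1 0) :
    m • I = I := by
  have hd := det_eq m
  apply UpperHalfPlane.ext
  rw [UpperHalfPlane.coe_specialLinearGroup_apply]
  simp only [Algebra.algebraMap_self, RingHom.id_apply, UpperHalfPlane.coe_I]
  rw [div_eq_iff (velocity_eq m).1, h0, h1]
  push_cast
  linear_combination (-(m 1 0 : ℂ)) * Complex.I_sq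

theorem isCrossingAngle_of_entries {b c k h : SL(2, ℝ)} (hk : IsOrientedAxis b k)
    (hh : IsOrientedAxis c h) (h1 : 0 < (k⁻¹ * h) 0 0 * (k⁻¹ * h) 1 1)
    (h2 : (k⁻¹ * h) 0 1 * (k⁻¹ * h) 1 0 < 0) :
    IsCrossingAngle b c
      (Real.arccos ((k⁻¹ * h) 0 0 * (k⁻¹ * h) 1 1 + (k⁻¹ * h) 0 1 * (k⁻¹ * h) 1 0)) := by
  set m := k⁻¹ * h with hm
  have hd := det_eq m
  have a0 : m 0 0 ≠ 0 := left_ne_zero_of_mul h1.ne'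
  have d0 : m 1 1 ≠ 0 := right_ne_zero_of_mul h1.ne'
  have b0 : m 0 1 ≠ 0 := left_ne_zero_of_mul h2.ne
  have c0 : m 1 0 ≠ 0 := right_ne_zero_of_mul h2.ne
  have hda : 0 < m 1 1 / m 0 0 := by
    have : m 1 1 / m 0 0 = (m 0 0 * m 1 1) / m 0 0 ^ 2 := by field_simp
    rw [this]; positivity
  have hbc : 0 < -m 0 1 / m 1 0 := by
    have : -m 0 1 / m 1 0 = -(m 0 1 * m 1 0) / m 1 0 ^ 2 := by field_simp
    rw [this]
    exact div_pos (by linarith) (by positivity)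
  -- Both frames are slid along their axes to the crossing point. The parameters `x` and `y` are
  -- chosen to equalize the diagonal entries and to make the off-diagonal ones opposite, so that the
  -- transition matrix becomes a rotation.
  set x := Real.log (m 1 1 / m 0 0) / 2 with hx
  set y := Real.log (-m 0 1 / m 1 0) / 2 with hy
  have ex : Real.exp x * Real.exp x = m 1 1 / m 0 0 := by
    rw [← Real.exp_add, hx, add_halves, Real.exp_log hda]
  have ey : Real.exp y * Real.exp y = -m 0 1 / m 1 0 := by
    rw [← Real.exp_add, hy, add_halves, Real.exp_log hbc]
  have ex' : Real.exp x * Real.exp (-x) = 1 := by rw [← Real.exp_add]; simp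
  have ey' : Real.exp y * Real.exp (-y) = 1 := by rw [← Real.exp_add]; simp
  set n := (k * flow (y - x))⁻¹ * (h * flow (y + x)) with hn
  have en : n = (flow (y - x))⁻¹ * m * flow (y + x) := by rw [hn, hm]; group
  have s1 : Real.exp (-((y - x) / 2)) * Real.exp ((y + x) / 2) = Real.exp x := by
    rw [← Real.exp_add]; ring_nf
  have s2 : Real.exp (-((y - x) / 2)) * Real.exp (-((y + x) / 2)) = Real.exp (-y) := by
    rw [← Real.exp_add]; ring_nf
  have s3 : Real.exp ((y - x) / 2) * Real.exp ((y + x) / 2) = Real.exp y := by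
    rw [← Real.exp_add]; ring_nf
  have s4 : Real.exp ((y - x) / 2) * Real.exp (-((y + x) / 2)) = Real.exp (-x) := by
    rw [← Real.exp_add]; ring_nf
  have n00 : n 0 0 = m 0 0 * Real.exp x := by
    rw [en]
    simp only [mul_entry, inv_00, inv_01, flow_00, flow_01, flow_10, flow_11]
    linear_combination m 0 0 * s1
  have n01 : n 0 1 = m 0 1 * Real.exp (-y) := by
    rw [en]
    simp only [mul_entry, inv_00, inv_01, flow_01, flow_11]
    linear_combination m 0 1 * s2
  have n10 : n 1 0 = m 1 0 * Real.exp y := by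
    rw [en]
    simp only [mul_entry, inv_10, inv_11, flow_00, flow_10]
    linear_combination m 1 0 * s3
  have n11 : n 1 1 = m 1 1 * Real.exp (-x) := by
    rw [en]
    simp only [mul_entry, inv_10, inv_11, flow_00, flow_01, flow_10, flow_11]
    linear_combination m 1 1 * s4
  have r1 : n 1 1 = n 0 0 := by
    rw [n00, n11]
    have : m 1 1 = m 0 0 * (Real.exp x * Real.exp x) := by rw [ex]; field_simp
    rw [this]
    linear_combination m 0 0 * Real.exp x * ex'
  have r2 : n 0 1 = -n 1 0 := by
    rw [n01, n10]
    have : m 0 1 = -(m 1 0 * (Real.exp y * Real.exp y)) := by rw [ey]; field_simp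
    rw [this]
    linear_combination -(m 1 0 * Real.exp y) * ey'
  refine ⟨k * flow (y - x), h * flow (y + x), isOrientedAxis_flow hk _, isOrientedAxis_flow hh _,
    ?_, ?_, ?_⟩
  · have : h * flow (y + x) = (k * flow (y - x)) * n := by rw [hn]; group
    rw [this, mul_smul (k * flow (y - x)) n, smul_I_of_rotation r1.symm r2]
  · intro e
    rcases diag_or_anti_of_line_eq e.symm with ⟨e1, -⟩ | ⟨e1, -⟩
    · rw [← hn, n01] at e1
      exact mul_ne_zero b0 (Real.exp_pos _).ne' e1
    · rw [← hn, n00] at e1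
      exact mul_ne_zero a0 (Real.exp_pos _).ne' e1
  · rw [angle_velocity (p := n 0 0) (q := n 1 0) rfl r2 rfl r1]
    congr 1
    have q1 : n 0 0 ^ 2 = m 0 0 * m 1 1 := by
      calc n 0 0 ^ 2 = n 0 0 * n 1 1 := by rw [r1, sq]
        _ = m 0 0 * m 1 1 * (Real.exp x * Real.exp (-x)) := by rw [n00, n11]; ring
        _ = _ := by rw [ex', mul_one]
    have q2 : n 1 0 ^ 2 = -(m 0 1 * m 1 0) := by
      calc n 1 0 ^ 2 = -(n 0 1 * n 1 0) := by rw [r2]; ring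
        _ = -(m 0 1 * m 1 0 * (Real.exp y * Real.exp (-y))) := by rw [n01, n10]; ring
        _ = _ := by rw [ey', mul_one]
    rw [q1, q2]
    ring

/-! ### Commutators -/

theorem trace_commutator_flow (l : ℝ) (c : SL(2, ℝ)) :
    (flow l * c * (flow l)⁻¹ * c⁻¹) 0 0 + (flow l * c * (flow l)⁻¹ * c⁻¹) 1 1 =
      2 - (Real.exp (l / 2) - Real.exp (-(l / 2))) ^ 2 * (c 0 1 * c 1 0) := by
  have e : Real.exp (l / 2) * Real.exp (-(l / 2)) = 1 := by rw [← Real.exp_add]; simp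
  have hd := det_eq c
  simp only [mul_entry, inv_00, inv_01, inv_10, inv_11, flow_00, flow_01, flow_10, flow_11]
  linear_combination (2 * c 0 0 * c 1 1 - 2 * c 0 1 * c 1 0) * e + 2 * hd

/-- Two axes cross if and only if the commutator has trace less than `2`. -/
theorem trace_commutator_lt_iff {b c k h : SL(2, ℝ)} (hk : IsOrientedAxis b k)
    (hh : IsOrientedAxis c h) :
    (b * c * b⁻¹ * c⁻¹) 0 0 + (b * c * b⁻¹ * c⁻¹) 1 1 < 2 ↔
      ((k⁻¹ * h) 0 0 * (k⁻¹ * h) 1 1) * ((k⁻¹ * h) 0 1 * (k⁻¹ * h) 1 0) < 0 := by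
  obtain ⟨l, hl, hb⟩ := hk
  obtain ⟨l', hl', hc⟩ := hh
  have e1 : b * c * b⁻¹ * c⁻¹ = translation k l * translation h l' * (translation k l)⁻¹ *
      (translation h l')⁻¹ := by
    rcases hb with rfl | rfl <;> rcases hc with rfl | rfl <;>
      simp only [neg_inv', neg_mul, mul_neg, neg_neg]
  set m := k⁻¹ * h with hm
  set n := m * flow l' * m⁻¹ with hn
  have e2 : b * c * b⁻¹ * c⁻¹ = k * (flow l * n * (flow l)⁻¹ * n⁻¹) * k⁻¹ := by
    rw [e1, hn, hm, translation, translation]; group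
  have n01 : n 0 1 = -((Real.exp (l' / 2) - Real.exp (-(l' / 2))) * (m 0 0 * m 0 1)) := by
    rw [hn]
    simp only [mul_entry, inv_01, inv_11, flow_00, flow_01, flow_10, flow_11]
    ring
  have n10 : n 1 0 = (Real.exp (l' / 2) - Real.exp (-(l' / 2))) * (m 1 0 * m 1 1) := by
    rw [hn]
    simp only [mul_entry, inv_00, inv_10, flow_00, flow_01, flow_10, flow_11]
    ring
  rw [trace_eq_of_conj e2, trace_commutator_flow, n01, n10]
  have d1 : 0 < Real.exp (l / 2) - Real.exp (-(l / 2)) :=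
    sub_pos.2 (Real.exp_lt_exp.2 (by linarith))
  have d2 : 0 < Real.exp (l' / 2) - Real.exp (-(l' / 2)) :=
    sub_pos.2 (Real.exp_lt_exp.2 (by linarith))
  set δ := Real.exp (l / 2) - Real.exp (-(l / 2))
  set δ' := Real.exp (l' / 2) - Real.exp (-(l' / 2))
  have e3 : 2 - δ ^ 2 * (-(δ' * (m 0 0 * m 0 1)) * (δ' * (m 1 0 * m 1 1))) =
      2 + (δ ^ 2 * δ' ^ 2) * (m 0 0 * m 1 1 * (m 0 1 * m 1 0)) := by ring
  have d3 : 0 < δ ^ 2 * δ' ^ 2 := by positivity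
  rw [e3]
  constructor
  · intro h
    by_contra hc
    have := mul_nonneg d3.le (not_lt.1 hc)
    linarith
  · intro h
    have := mul_neg_of_pos_of_neg d3 h
    linarith

/-- The commutator of `b` with `c⁻¹` is conjugate to the inverse of that with `c`, so the crossing
criterion ignores orientations. -/
theorem trace_commutator_inv (b c : SL(2, ℝ)) :
    (b * c⁻¹ * b⁻¹ * c⁻¹⁻¹) 0 0 + (b * c⁻¹ * b⁻¹ * c⁻¹⁻¹) 1 1 =
      (b * c * b⁻¹ * c⁻¹) 0 0 + (b * c * b⁻¹ * c⁻¹) 1 1 := by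
  have e : b * c⁻¹ * b⁻¹ * c⁻¹⁻¹ = c⁻¹ * (b * c * b⁻¹ * c⁻¹)⁻¹ * c⁻¹⁻¹ := by group
  rw [trace_eq_of_conj e, inv_00, inv_11, add_comm]

/-- If two matrices are hyperbolic and their commutator has trace less than `2`, their axes cross
and the angle is given by `cosAngle`. -/
theorem isCrossingAngle_of_trace {b c : SL(2, ℝ)} (hb : 2 < |b 0 0 + b 1 1|)
    (hc : 2 < |c 0 0 + c 1 1|)
    (hbc : (b * c * b⁻¹ * c⁻¹) 0 0 + (b * c * b⁻¹ * c⁻¹) 1 1 < 2) :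
    IsCrossingAngle b c (Real.arccos (cosAngle b c)) ∧ -1 < cosAngle b c := by
  obtain ⟨k, hk⟩ := exists_isOrientedAxis hb
  obtain ⟨h, hh⟩ := exists_isOrientedAxis hc
  rw [trace_commutator_lt_iff hk hh] at hbc
  have hd := det_eq (k⁻¹ * h)
  have w : ∀ q : SL(2, ℝ), wedge (column q 0) (column q 1) = 1 := fun q => by
    rw [wedge_column, if_pos rfl, inv_mul_cancel, one_11]
  have w1 : wedge (column k 0) (column h 1) = (k⁻¹ * h) 1 1 := by rw [wedge_column, if_pos rfl]
  have w2 : wedge (column h 0) (column k 1) = (k⁻¹ * h) 0 0 := by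
    have e : h⁻¹ * k = (k⁻¹ * h)⁻¹ := by group
    rw [wedge_column, if_pos rfl, e, inv_11]
  have hcos := cosAngle_eq hk.hasAttractingPair hh.hasAttractingPair (by rw [w]; exact one_ne_zero)
    (by rw [w]; exact one_ne_zero)
  rw [w, w, w1, w2, mul_one, div_one] at hcos
  -- The two products have opposite signs and differ by the determinant 1, so the diagonal one is
  -- positive.
  have h1 : 0 < (k⁻¹ * h) 0 0 * (k⁻¹ * h) 1 1 := by nlinarith
  have h2 : (k⁻¹ * h) 0 1 * (k⁻¹ * h) 1 0 < 0 := by nlinarith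
  refine ⟨?_, by rw [hcos]; linarith⟩
  have e : cosAngle b c = (k⁻¹ * h) 0 0 * (k⁻¹ * h) 1 1 + (k⁻¹ * h) 0 1 * (k⁻¹ * h) 1 0 := by
    rw [hcos]; linear_combination hd
  rw [e]
  exact isCrossingAngle_of_entries hk hh h1 h2

end Angle

/-! ### The angle along the twist orbit -/

section Orbit

open Filter Topology

variable {Γ : Subgroup SL(2, ℝ)} {g : SL(2, ℝ)}

/-- Along `F`, the attracting and repelling directions of `B` converge to those of `u` and `w`. -/
def ConvergesTo (B : ℝ → SL(2, ℝ)) (F : Filter ℝ) (u w : Fin 2 → ℝ) : Prop :=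
  ∃ c : ℝ → ℝ, (∀ t, c t ≠ 0) ∧ ∃ M : Matrix (Fin 2) (Fin 2) ℝ,
    Tendsto (fun t => c t • (B t : Matrix (Fin 2) (Fin 2) ℝ)) F (𝓝 M) ∧
      HasAttractingPair M u w ∧ wedge u w ≠ 0

theorem ConvergesTo.tendsto_cosAngle {B C : ℝ → SL(2, ℝ)} {F : Filter ℝ} {u w u' w' : Fin 2 → ℝ}
    (hB : ConvergesTo B F u w) (hC : ConvergesTo C F u' w') (h1 : wedge u w' ≠ 0)
    (h2 : wedge u' w ≠ 0) :
    ∃ a, a ≠ -1 ∧ Tendsto (fun t => cosAngle (B t) (C t)) F (𝓝 a) := by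
  obtain ⟨c, hc, M, hM, hMp, hD⟩ := hB
  obtain ⟨c', hc', M', hM', hMp', hD'⟩ := hC
  refine ⟨cosAngle M M', ?_, ?_⟩
  · rw [cosAngle_eq hMp hMp' hD hD']
    intro e
    have h3 : wedge u w' * wedge u' w / (wedge u w * wedge u' w') ≠ 0 :=
      div_ne_zero (mul_ne_zero h1 h2) (mul_ne_zero hD hD')
    apply h3
    linarith
  · refine (FenchelNielsen.tendsto_cosAngle hMp hMp' hD hD' hM hM').congr fun t => ?_
    exact cosAngle_smul (hc t) (hc' t) _ _

/-- The rescaled limit may be singular, so the inverse is taken as the adjugate, which is continuous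
and exchanges the two eigenvalues. -/
theorem ConvergesTo.inv {B : ℝ → SL(2, ℝ)} {F : Filter ℝ} {u w : Fin 2 → ℝ}
    (hB : ConvergesTo B F u w) : ConvergesTo (fun t => (B t)⁻¹) F w u := by
  obtain ⟨c, hc, M, hM, hMp, hD⟩ := hB
  obtain ⟨μ, ν, hlt, -, -, e00, e01, e10, e11⟩ := hMp.spectral hD
  refine ⟨c, hc, M.adjugate, ?_, ?_, ?_⟩
  · have h1 : Tendsto (fun t => (c t • (B t : Matrix (Fin 2) (Fin 2) ℝ)).adjugate) F
        (𝓝 M.adjugate) := (Continuous.tendsto (by fun_prop :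
          Continuous fun N : Matrix (Fin 2) (Fin 2) ℝ => N.adjugate) _).comp hM
    refine h1.congr fun t => ?_
    rw [Matrix.adjugate_smul, Matrix.SpecialLinearGroup.coe_inv]
    simp
  · refine ⟨μ, ν, hlt, ?_, ?_⟩ <;> ext r <;> fin_cases r <;>
      simp [Matrix.adjugate_fin_two, Matrix.mulVec, dotProduct, Fin.sum_univ_two] <;>
      apply mul_right_cancel₀ hD
    · rw [wedge] at *; linear_combination w 0 * e11 - w 1 * e01
    · rw [wedge] at *; linear_combination w 1 * e00 - w 0 * e10
    · rw [wedge] at *; linear_combination u 0 * e11 - u 1 * e01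
    · rw [wedge] at *; linear_combination u 1 * e00 - u 0 * e10
  · rw [wedge] at hD ⊢
    intro e
    apply hD
    linarith

theorem exists_lower_bound {f : ℝ → ℝ} (hf : Continuous f) (hpos : ∀ t, -1 < f t) {a b : ℝ}
    (ha : a ≠ -1) (hb : b ≠ -1) (hfa : Tendsto f atTop (𝓝 a)) (hfb : Tendsto f atBot (𝓝 b)) :
    ∃ r, -1 < r ∧ ∀ t, r ≤ f t := by
  have ha' : -1 < a := lt_of_le_of_ne (ge_of_tendsto' hfa fun t => (hpos t).le) ha.symm
  have hb' : -1 < b := lt_of_le_of_ne (ge_of_tendsto' hfb fun t => (hpos t).le) hb.symm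
  obtain ⟨ra, hra, hra'⟩ := exists_between ha'
  obtain ⟨rb, hrb, hrb'⟩ := exists_between hb'
  obtain ⟨T, hT⟩ := eventually_atTop.1 (hfa.eventually_const_le hra')
  obtain ⟨S, hS⟩ := eventually_atBot.1 (hfb.eventually_const_le hrb')
  obtain ⟨m, -, hm⟩ := (isCompact_Icc (a := min S T) (b := max S T)).exists_isMinOn
    ⟨S, min_le_left _ _, le_max_left _ _⟩ hf.continuousOn
  refine ⟨min (f m) (min ra rb), lt_min (hpos m) (lt_min hra hrb), fun t => ?_⟩
  by_cases h1 : T ≤ t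
  · exact ((min_le_right _ _).trans (min_le_left _ _)).trans (hT t h1)
  by_cases h2 : t ≤ S
  · exact ((min_le_right _ _).trans (min_le_right _ _)).trans (hS t h2)
  · exact (min_le_left _ _).trans (hm ⟨(min_le_left _ _).trans (not_le.1 h2).le,
      (not_le.1 h1).le.trans (le_max_right _ _)⟩)

/-- Two hyperbolic families whose axes cross, and whose limits at `±∞` are such that no attracting
direction coincides with a repelling one, cross at an angle bounded away from `π`. -/
theorem exists_angle_bound {B C B₀ C₀ : ℝ → SL(2, ℝ)} (hB : Continuous B) (hC : Continuous C)
    (hBtr : ∀ t, 2 < |B t 0 0 + B t 1 1|) (hCtr : ∀ t, 2 < |C t 0 0 + C t 1 1|)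
    (hcomm : ∀ t, (B t * C t * (B t)⁻¹ * (C t)⁻¹) 0 0 + (B t * C t * (B t)⁻¹ * (C t)⁻¹) 1 1 < 2)
    (hcos : ∀ t, cosAngle (B t) (C t) = cosAngle (B₀ t) (C₀ t))
    {u w u' w' : Fin 2 → Fin 2 → ℝ}
    (hB0 : ConvergesTo B₀ atTop (u 0) (w 0)) (hB1 : ConvergesTo B₀ atBot (u 1) (w 1))
    (hC0 : ConvergesTo C₀ atTop (u' 0) (w' 0)) (hC1 : ConvergesTo C₀ atBot (u' 1) (w' 1))
    (h1 : ∀ i, wedge (u i) (w' i) ≠ 0) (h2 : ∀ i, wedge (u' i) (w i) ≠ 0) :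
    ∃ ε : ℝ, 0 < ε ∧ ∀ t, ∃ θ, IsCrossingAngle (B t) (C t) θ ∧ θ ≤ Real.pi - ε := by
  have hcross := fun t => isCrossingAngle_of_trace (hBtr t) (hCtr t) (hcomm t)
  have hcont : Continuous fun t => cosAngle (B t) (C t) := by
    refine continuous_iff_continuousAt.2 fun t => ?_
    obtain ⟨k, hk⟩ := exists_isOrientedAxis (hBtr t)
    obtain ⟨h, hh⟩ := exists_isOrientedAxis (hCtr t)
    have hw : ∀ q : SL(2, ℝ), wedge (column q 0) (column q 1) ≠ 0 := fun q => by
      rw [wedge_column, if_pos rfl, inv_mul_cancel, one_11]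
      exact one_ne_zero
    exact tendsto_cosAngle hk.hasAttractingPair hh.hasAttractingPair (hw k) (hw h)
      (continuous_subtype_val.comp hB).continuousAt (continuous_subtype_val.comp hC).continuousAt
  -- Limits are known for `B₀` and `C₀`; `B` and `C` enter the limit only through the equality of
  -- cosines.
  obtain ⟨a, ha, hfa⟩ := hB0.tendsto_cosAngle hC0 (h1 0) (h2 0)
  obtain ⟨b, hb, hfb⟩ := hB1.tendsto_cosAngle hC1 (h1 1) (h2 1)
  obtain ⟨r, hr, hrf⟩ := exists_lower_bound hcont (fun t => (hcross t).2) ha hb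
    (hfa.congr fun t => (hcos t).symm) (hfb.congr fun t => (hcos t).symm)
  refine ⟨Real.pi - Real.arccos r, ?_, fun t => ⟨_, (hcross t).1, ?_⟩⟩
  · have h3 : Real.arccos r ≠ Real.pi := fun e => by
      rw [Real.arccos_eq_pi] at e
      linarith
    have := lt_of_le_of_ne (Real.arccos_le_pi r) h3
    linarith
  · rw [sub_sub_cancel]
    exact Real.antitone_arccos (hrf t)

/-- The possible limits, as the twist time tends to `∞` and to `-∞`, of the attracting and repelling
directions along the oriented geodesic of `h`: they are constant, or the ends of the first and the
last lift that are crossed in a period. -/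
def IsLimitPair (Γ : Subgroup SL(2, ℝ)) (g h : SL(2, ℝ)) (u w : Fin 2 → Fin 2 → ℝ) : Prop :=
  (∀ i, u i = column h 0 ∧ w i = column h 1) ∨
    ∃ k κ, IsSignedLift Γ g k ∧ IsSignedLift Γ g κ ∧ CrossesToRight h k ∧
      CrossesToRight h κ ∧ ∀ i, u i = column k i ∧ w i = column κ (1 - i)

/-- The limits of the attracting and repelling directions of the twisted holonomy of `b`. -/
theorem exists_limit_directions [ProperlyDiscontinuousSMul Γ ℍ] (hS : IsSimpleAxis Γ g)
    {b h : SL(2, ℝ)} (hb : b ∈ Γ) (hh : IsOrientedAxis b h) (s : ℝ) :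
    (∀ t, 2 < |twist Γ g (geodesic h s) t b 0 0 + twist Γ g (geodesic h s) t b 1 1|) ∧
    ∃ u w : Fin 2 → Fin 2 → ℝ,
      ConvergesTo (fun t => twist Γ g (geodesic h s) t b) atTop (u 0) (w 0) ∧
      ConvergesTo (fun t => twist Γ g (geodesic h s) t b) atBot (u 1) (w 1) ∧
      IsLimitPair Γ g h u w := by
  rcases twist_axis hS hb hh s with hconst | ⟨htr, k, κ, hk, hκ, hck, hcκ, n, hlim⟩
  · refine ⟨fun t => by rw [hconst]; exact hh.trace, fun _ => column h 0, fun _ => column h 1, ?_, ?_,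
      Or.inl fun i => ⟨rfl, rfl⟩⟩
    all_goals
      refine ⟨fun _ => 1, fun _ => one_ne_zero, b, ?_, hh.hasAttractingPair,
        hh.hasAttractingPair.wedge_ne_zero (column_ne_zero _ _) (column_ne_zero _ _)⟩
      simp only [hconst, one_smul]
      exact tendsto_const_nhds
  · refine ⟨htr, fun i => column k i, fun i => column κ (1 - i), ?_, ?_,
      Or.inr ⟨k, κ, hk, hκ, hck, hcκ, fun i => ⟨rfl, rfl⟩⟩⟩
    · obtain ⟨M, hM, hpair⟩ := hlim atTop _ 0 tendsto_flow_atTop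
      have hp := hpair (1 - 0) (by decide)
      exact ⟨_, fun t => pow_ne_zero n (Real.exp_pos _).ne', M, hM, hp,
        hp.wedge_ne_zero (column_ne_zero _ _) (column_ne_zero _ _)⟩
    · obtain ⟨M, hM, hpair⟩ := hlim atBot _ 1 tendsto_flow_atBot
      have hp := hpair (1 - 1) (by decide)
      exact ⟨_, fun t => pow_ne_zero n (Real.exp_pos _).ne', M, hM, hp,
        hp.wedge_ne_zero (column_ne_zero _ _) (column_ne_zero _ _)⟩

/-! ### Choice of the base points -/

theorem sides_of_line_eq {k k' : SL(2, ℝ)} (e : line k' = line k) :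
    (rightSide k' = rightSide k ∧ leftSide k' = leftSide k) ∨
      (rightSide k' = leftSide k ∧ leftSide k' = rightSide k) := by
  have ek : k' = k * (k⁻¹ * k') := by group
  rcases diag_or_anti_of_line_eq e with ⟨h0, h1⟩ | ⟨h0, h1⟩
  · left
    obtain ⟨s, hs | hs⟩ := eq_flow_of_diag h0 h1 <;> rw [ek, hs]
    · exact ⟨rightSide_flow _ _, leftSide_flow _ _⟩
    · rw [mul_neg, rightSide_neg, leftSide_neg]
      exact ⟨rightSide_flow _ _, leftSide_flow _ _⟩
  · right
    obtain ⟨s, hs | hs⟩ := eq_flow_halfTurn_of_anti h0 h1 <;> rw [ek, hs]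
    · rw [← mul_assoc, rightSide_halfTurn, leftSide_halfTurn]
      exact ⟨leftSide_flow _ _, rightSide_flow _ _⟩
    · rw [mul_neg, rightSide_neg, leftSide_neg, ← mul_assoc, rightSide_halfTurn, leftSide_halfTurn]
      exact ⟨leftSide_flow _ _, rightSide_flow _ _⟩

/-- A geodesic that meets another one moves to its left in one of the two directions. -/
theorem exists_left_near {k h : SL(2, ℝ)} (h0 : geodesic h 0 ∈ line k) {δ : ℝ}
    (h1 : geodesic h δ ∉ line k) (h2 : geodesic h (-δ) ∉ line k) :
    ∃ s, |s| = |δ| ∧ geodesic h s ∈ leftSide k := by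
  by_contra hcon
  push Not at hcon
  have a1 := mem_right_of_not_left h1 (hcon δ rfl)
  have a2 := mem_right_of_not_left h2 (hcon (-δ) (abs_neg δ))
  rw [geodesic_mem_right, crossFun] at a1 a2
  rw [geodesic_mem_line, crossFun] at h0
  rw [neg_neg] at a2
  simp only [neg_zero, Real.exp_zero, mul_one] at h0
  set A' := (k⁻¹ * h) 0 0 * (k⁻¹ * h) 1 0
  set B' := (k⁻¹ * h) 0 1 * (k⁻¹ * h) 1 1
  have e : A' * Real.exp δ + B' * Real.exp (-δ) + (A' * Real.exp (-δ) + B' * Real.exp δ) = 0 := by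
    linear_combination (Real.exp δ + Real.exp (-δ)) * h0
  linarith

/-- A piece of a geodesic that meets no lift after its starting point stays on one side. -/
theorem not_crossed {k h : SL(2, ℝ)} (hk : IsSignedLift Γ g k) {s δ : ℝ} (hs : |s| < δ)
    (hoff : ∀ s, s ≠ 0 → |s - 0| < δ → OffLifts Γ g (geodesic h s))
    (hc : (geodesic h 0 ∈ leftSide k ∧ geodesic h s ∈ rightSide k) ∨
      (geodesic h 0 ∈ rightSide k ∧ geodesic h s ∈ leftSide k)) : False := by
  obtain ⟨τ, hτ, hmem⟩ := exists_mem_line_of_path (k := k) (p := fun τ => geodesic h (τ * s))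
    zero_le_one ((continuous_geodesic h).comp (by fun_prop)).continuousOn (by simpa using hc)
  by_cases h0 : τ * s = 0
  · rw [h0] at hmem
    rcases hc with hc | hc
    · exact not_mem_line_of_left hc.1 hmem
    · exact not_mem_line_of_right hc.1 hmem
  · refine hoff (τ * s) h0 ?_ k hk hmem
    rw [sub_zero, abs_mul, abs_of_nonneg hτ.1]
    exact lt_of_le_of_lt (mul_le_of_le_one_left (abs_nonneg s) hτ.2) hs

/-- Near a common point of two geodesics there are points of them in a common complementary
piece of the lifts. -/
theorem exists_base_points [ProperlyDiscontinuousSMul Γ ℍ] (hS : IsSimpleAxis Γ g)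
    {h₁ h₂ : SL(2, ℝ)} (hy : geodesic h₁ 0 = geodesic h₂ 0)
    (hα₁ : ∀ k, IsSignedLift Γ g k → line k ≠ line h₁)
    (hα₂ : ∀ k, IsSignedLift Γ g k → line k ≠ line h₂) :
    ∃ s₁ s₂, OffLifts Γ g (geodesic h₁ s₁) ∧ OffLifts Γ g (geodesic h₂ s₂) ∧
      ∀ k, ¬ Separates Γ g (geodesic h₁ s₁) (geodesic h₂ s₂) k := by
  by_cases hoff : OffLifts Γ g (geodesic h₁ 0)
  · refine ⟨0, 0, hoff, hy ▸ hoff, fun k hk => ?_⟩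
    rw [← hy] at hk
    exact disjoint_sides k hk.2.1 hk.2.2
  obtain ⟨k₀, hk₀, hmem⟩ : ∃ k₀, IsSignedLift Γ g k₀ ∧ geodesic h₁ 0 ∈ line k₀ := by
    rw [OffLifts] at hoff
    push Not at hoff
    exact hoff
  obtain ⟨δ₁, hδ₁, hoff₁⟩ := exists_offLifts_near hS hα₁ 0
  obtain ⟨δ₂, hδ₂, hoff₂⟩ := exists_offLifts_near hS hα₂ 0
  have hmin : 0 < min δ₁ δ₂ := lt_min hδ₁ hδ₂
  set δ := min δ₁ δ₂ / 2 with hδ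
  have hδ0 : 0 < δ := by positivity
  have hd1 : |δ| < δ₁ := by
    rw [abs_of_pos hδ0]
    linarith [min_le_left δ₁ δ₂]
  have hd2 : |δ| < δ₂ := by
    rw [abs_of_pos hδ0]
    linarith [min_le_right δ₁ δ₂]
  obtain ⟨s₁, hs₁, hl₁⟩ := exists_left_near hmem
    (hoff₁ δ hδ0.ne' (by rwa [sub_zero]) k₀ hk₀)
    (hoff₁ (-δ) (neg_ne_zero.2 hδ0.ne') (by rwa [sub_zero, abs_neg]) k₀ hk₀)
  obtain ⟨s₂, hs₂, hl₂⟩ := exists_left_near (hy ▸ hmem)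
    (hoff₂ δ hδ0.ne' (by rwa [sub_zero]) k₀ hk₀)
    (hoff₂ (-δ) (neg_ne_zero.2 hδ0.ne') (by rwa [sub_zero, abs_neg]) k₀ hk₀)
  have hne : ∀ {s : ℝ}, |s| = |δ| → s ≠ 0 := fun h e => by
    rw [e, abs_zero] at h
    exact hδ0.ne' (abs_eq_zero.1 h.symm)
  refine ⟨s₁, s₂, hoff₁ s₁ (hne hs₁) (by rwa [sub_zero, hs₁]),
    hoff₂ s₂ (hne hs₂) (by rwa [sub_zero, hs₂]), fun k hk => ?_⟩
  -- If the crossing point is off `k`, one of the two short arcs would cross `k`. If it is on `k`,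
  -- then `k` has the line of `k₀`, and both points were chosen to the left of `k₀`.
  rcases side_cases k (geodesic h₁ 0) with h | h | h
  · rw [hy] at h
    exact not_crossed hk.1 (hs₂ ▸ hd2) hoff₂ (Or.inl ⟨h, hk.2.2⟩)
  · have e : line k = line k₀ := (lines_eq_or_disjoint hS hk₀ hk.1).resolve_right fun hd =>
      Set.disjoint_left.1 hd h hmem
    rcases sides_of_line_eq e with ⟨e1, e2⟩ | ⟨e1, e2⟩
    · exact disjoint_sides k₀ hl₂ (e1 ▸ hk.2.2)
    · exact disjoint_sides k₀ hl₁ (e2 ▸ hk.2.1)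
  · exact not_crossed hk.1 (hs₁ ▸ hd1) hoff₁ (Or.inr ⟨h, hk.2.1⟩)

/-! ### Coincidences of limit directions -/

/-- Once on the right a geodesic stays there, so it cannot cross one line in both directions. -/
theorem CrossesToRight.not_opposite {h k κ : SL(2, ℝ)} (hk : CrossesToRight h k)
    (hκ : CrossesToRight h κ) (e1 : rightSide κ = leftSide k) (e2 : leftSide κ = rightSide k) :
    False := by
  obtain ⟨s, s', hs, hl, hr⟩ := hk
  obtain ⟨v, v', hv, hl', hr'⟩ := hκ
  rw [e1] at hr'
  rw [e2] at hl'
  rcases lt_or_ge s v with h1 | h1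
  · exact disjoint_sides k hr' (mem_right_of_crossed h1 hl hl' hv.le)
  · exact disjoint_sides k (mem_left_of_crossed hs hl hr h1) hl'

theorem wedge_column_ne_zero {k k' : SL(2, ℝ)} (h : ∀ i j, (k⁻¹ * k') i j ≠ 0) (i j : Fin 2) :
    wedge (column k i) (column k' j) ≠ 0 := by
  rw [wedge_column]
  split_ifs
  · exact h _ _
  · exact neg_ne_zero.2 (h _ _)

/-- Lifts with a common end share a line. Ends of the same kind then coincide only for equal
orientations, ends of different kinds only for opposite ones. -/
theorem wedge_ne_zero_of_lifts [ProperlyDiscontinuousSMul Γ ℍ] (hS : IsSimpleAxis Γ g)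
    {k k' : SL(2, ℝ)} (hk : IsSignedLift Γ g k) (hk' : IsSignedLift Γ g k') (i : Fin 2) :
    (rightSide k' ≠ rightSide k → wedge (column k i) (column k' i) ≠ 0) ∧
      (rightSide k' ≠ leftSide k → wedge (column k i) (column k' (1 - i)) ≠ 0 ∧
        wedge (column k' i) (column k (1 - i)) ≠ 0) := by
  obtain ⟨a, ha, hak⟩ := hk.axis hS
  obtain ⟨a', ha', hak'⟩ := hk'.axis hS
  have hd := det_eq (k⁻¹ * k')
  have einv : k'⁻¹ * k = (k⁻¹ * k')⁻¹ := by group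
  rcases axes_cases Γ ha ha' hak hak' with ⟨h0, h1⟩ | ⟨h0, h1⟩ | h
  · refine ⟨fun hne => ?_, fun _ => ?_⟩
    · obtain ⟨s, hs⟩ := eq_flow_of_diag h0 h1
      refine absurd ?_ hne
      have e : k' = k * (k⁻¹ * k') := by group
      rcases hs with hs | hs <;> rw [e, hs]
      · exact rightSide_flow _ _
      · rw [mul_neg, rightSide_neg, rightSide_flow]
    · rw [h0, zero_mul, sub_zero] at hd
      have d0 := left_ne_zero_of_mul_eq_one hd
      have d1 := right_ne_zero_of_mul_eq_one hd
      rw [wedge_column, wedge_column, einv]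
      fin_cases i
      · rw [← inv_11] at d0
        exact ⟨by simpa using d1, by simpa using d0⟩
      · rw [← inv_00] at d1
        exact ⟨by simpa using d0, by simpa using d1⟩
  · refine ⟨fun _ => ?_, fun hne => ?_⟩
    · rw [h0, zero_mul, zero_sub] at hd
      have d0 : (k⁻¹ * k') 0 1 ≠ 0 := fun e => by rw [e] at hd; simp at hd
      have d1 : (k⁻¹ * k') 1 0 ≠ 0 := fun e => by rw [e] at hd; simp at hd
      rw [wedge_column]
      fin_cases i
      · simpa using d1
      · simpa using d0
    · refine absurd ?_ hne
      obtain ⟨s, hs⟩ := eq_flow_halfTurn_of_anti h0 h1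
      have e : k' = k * (k⁻¹ * k') := by group
      rcases hs with hs | hs <;> rw [e, hs]
      · rw [← mul_assoc, rightSide_halfTurn, leftSide_flow]
      · rw [mul_neg, rightSide_neg, ← mul_assoc, rightSide_halfTurn, leftSide_flow]
  · have h' : ∀ i j, (k'⁻¹ * k) i j ≠ 0 := by
      rw [einv]
      simp only [Fin.forall_fin_two, inv_00, inv_01, inv_10, inv_11]
      exact ⟨⟨h _ _, neg_ne_zero.2 (h _ _)⟩, neg_ne_zero.2 (h _ _), h _ _⟩
    exact ⟨fun _ => wedge_column_ne_zero h _ _, fun _ =>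
      ⟨wedge_column_ne_zero h _ _, wedge_column_ne_zero h' _ _⟩⟩

end Orbit

/-! ### Coincidences of limit directions and the bound on the angle -/

section Main

variable {Γ : Subgroup SL(2, ℝ)} {g : SL(2, ℝ)}

theorem CrossesToRight.congr {h k k' : SL(2, ℝ)} (hc : CrossesToRight h k)
    (e1 : leftSide k' = leftSide k) (e2 : rightSide k' = rightSide k) : CrossesToRight h k' := by
  rwa [CrossesToRight, e1, e2]

theorem exists_lift_of_opposite
    {h₁ h₂ k κ : SL(2, ℝ)} (hk : IsSignedLift Γ g k) (h1 : CrossesToRight h₁ k)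
    (h2 : CrossesToRight h₂ κ) (e1 : rightSide κ = leftSide k) (e2 : leftSide κ = rightSide k) :
    ∃ k, IsLift Γ g k ∧ CrossesToRight h₁ k ∧ CrossesToRight h₂ (k * halfTurn) := by
  rcases hk with hk | hk
  · refine ⟨k, hk, h1, h2.congr ?_ ?_⟩
    · rw [leftSide_halfTurn, e2]
    · rw [rightSide_halfTurn, e1]
  · refine ⟨-k, hk, h1.congr (leftSide_neg k) (rightSide_neg k), h2.congr ?_ ?_⟩
    · rw [leftSide_halfTurn, rightSide_neg, e2]
    · rw [rightSide_halfTurn, leftSide_neg, e1]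

theorem leftSide_eq_of_opposite [ProperlyDiscontinuousSMul Γ ℍ] (hS : IsSimpleAxis Γ g)
    {k κ : SL(2, ℝ)} (hk : IsSignedLift Γ g k) (hκ : IsSignedLift Γ g κ)
    (e : rightSide κ = leftSide k) : leftSide κ = rightSide k := by
  rw [← rightSide_halfTurn] at e
  rw [(same_of_rightSide_eq hS hk.halfTurn hκ e).1, leftSide_halfTurn]

/-- The transition matrix fixes `i`, hence is a rotation with `a = d` and `b = -c`. The product in
the criterion is `-(ac)²`, nonzero because distinct axes of Γ share no end. -/
theorem trace_commutator_lt_of_crossing [ProperlyDiscontinuousSMul Γ ℍ]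
    {b₁ b₂ h₁ h₂ : SL(2, ℝ)} (hb₁ : b₁ ∈ Γ) (hb₂ : b₂ ∈ Γ) (hh₁ : IsOrientedAxis b₁ h₁)
    (hh₂ : IsOrientedAxis b₂ h₂) (hy : h₁ • I = h₂ • I) (hne : line h₁ ≠ line h₂) :
    (b₁ * b₂ * b₁⁻¹ * b₂⁻¹) 0 0 + (b₁ * b₂ * b₁⁻¹ * b₂⁻¹) 1 1 < 2 := by
  rw [trace_commutator_lt_iff hh₁ hh₂]
  have h := axes_ne_zero Γ hb₁ hb₂ hh₁ hh₂ hne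
  have hI : (h₁⁻¹ * h₂) • I = I := by rw [mul_smul, ← hy, inv_smul_smul]
  generalize h₁⁻¹ * h₂ = m at h hI
  have e : ((m • I : ℍ) : ℂ) = Complex.I := by rw [hI, coe_I]
  rw [UpperHalfPlane.coe_specialLinearGroup_apply, coe_I] at e
  have hd : ((algebraMap ℝ ℝ (m 1 0) : ℝ) : ℂ) * Complex.I + ((algebraMap ℝ ℝ (m 1 1) : ℝ) : ℂ) ≠ 0 :=
    fun h0 => by
      rw [h0, div_zero] at e
      exact Complex.I_ne_zero e.symm
  rw [div_eq_iff hd] at e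
  have h1 := congrArg Complex.im e
  have h2 := congrArg Complex.re e
  simp at h1 h2
  rw [h1, h2]
  have p1 := pow_pos (abs_pos.2 (h 1 0)) 2
  have p2 := pow_pos (abs_pos.2 (h 1 1)) 2
  rw [sq_abs] at p1 p2
  linear_combination mul_pos p1 p2

/-- The limit directions of the two twisted holonomies, and how they bound the angle. -/
theorem exists_limitPairs [ProperlyDiscontinuousSMul Γ ℍ] (hS : IsSimpleAxis Γ g)
    (hfree : ∀ γ ∈ Γ, ∀ z : ℍ, γ • z = z → γ = 1 ∨ γ = -1)
    {b₁ b₂ h₁ h₂ : SL(2, ℝ)} (hb₁ : b₁ ∈ Γ) (hb₂ : b₂ ∈ Γ) (hh₁ : IsOrientedAxis b₁ h₁)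
    (hh₂ : IsOrientedAxis b₂ h₂) (hy : h₁ • I = h₂ • I) (hne : line h₁ ≠ line h₂)
    (hα₁ : ∀ k, IsSignedLift Γ g k → line k ≠ line h₁)
    (hα₂ : ∀ k, IsSignedLift Γ g k → line k ≠ line h₂) {x : ℍ} (hx : OffLifts Γ g x) :
    ∃ u₁ w₁ u₂ w₂, IsLimitPair Γ g h₁ u₁ w₁ ∧ IsLimitPair Γ g h₂ u₂ w₂ ∧
      ((∀ i, wedge (u₁ i) (w₂ i) ≠ 0) → (∀ i, wedge (u₂ i) (w₁ i) ≠ 0) →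
        AngleBoundedAwayFromPi Γ g x b₁ b₂) ∧
      ((∀ i, wedge (u₁ i) (u₂ i) ≠ 0) → (∀ i, wedge (w₂ i) (w₁ i) ≠ 0) →
        AngleBoundedAwayFromPi Γ g x b₁ b₂⁻¹) := by
  have hy' : geodesic h₁ 0 = geodesic h₂ 0 := by
    rw [geodesic, geodesic, flow_zero, mul_one, mul_one, hy]
  obtain ⟨s₁, s₂, hp₁, hp₂, hsep⟩ := exists_base_points hS hy' hα₁ hα₂
  obtain ⟨htr₁, u₁, w₁, hu₁, hw₁, hl₁⟩ := exists_limit_directions hS hb₁ hh₁ s₁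
  obtain ⟨htr₂, u₂, w₂, hu₂, hw₂, hl₂⟩ := exists_limit_directions hS hb₂ hh₂ s₂
  -- No lift separates the two base points, so both holonomies are conjugated by the same matrix and
  -- the angle is unchanged.
  have e1 := fun t => twist_basepoint hS hx hp₁ hb₁ t
  have e2 : ∀ t, twist Γ g x t b₂ = twistIsometry Γ g t x (geodesic h₁ s₁) *
      twist Γ g (geodesic h₂ s₂) t b₂ * (twistIsometry Γ g t x (geodesic h₁ s₁))⁻¹ := fun t => by
    rw [twist_basepoint hS hx hp₁ hb₂ t, twist_basepoint hS hp₁ hp₂ hb₂ t,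
      twistIsometry_eq_one hS hsep, one_mul, inv_one, mul_one]
  have htr₁' : ∀ t, 2 < |twist Γ g x t b₁ 0 0 + twist Γ g x t b₁ 1 1| := fun t => by
    rw [trace_eq_of_conj (e1 t)]; exact htr₁ t
  have htr₂' : ∀ t, 2 < |twist Γ g x t b₂ 0 0 + twist Γ g x t b₂ 1 1| := fun t => by
    rw [trace_eq_of_conj (e2 t)]; exact htr₂ t
  have hc0 := trace_commutator_lt_of_crossing hb₁ hb₂ hh₁ hh₂ hy hne
  have hcΓ : b₁ * b₂ * b₁⁻¹ * b₂⁻¹ ∈ Γ :=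
    Γ.mul_mem (Γ.mul_mem (Γ.mul_mem hb₁ hb₂) (Γ.inv_mem hb₁)) (Γ.inv_mem hb₂)
  have hcomm : ∀ t, (twist Γ g x t b₁ * twist Γ g x t b₂ * (twist Γ g x t b₁)⁻¹ *
      (twist Γ g x t b₂)⁻¹) 0 0 + (twist Γ g x t b₁ * twist Γ g x t b₂ * (twist Γ g x t b₁)⁻¹ *
      (twist Γ g x t b₂)⁻¹) 1 1 < 2 := fun t => by
    rw [← twist_inv hS hx hb₁, ← twist_inv hS hx hb₂, ← twist_mul hS hx hb₁ hb₂,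
      ← twist_mul hS hx (Γ.mul_mem hb₁ hb₂) (Γ.inv_mem hb₁),
      ← twist_mul hS hx (Γ.mul_mem (Γ.mul_mem hb₁ hb₂) (Γ.inv_mem hb₁)) (Γ.inv_mem hb₂)]
    set c := b₁ * b₂ * b₁⁻¹ * b₂⁻¹
    set f : ℝ → ℝ := fun t => twist Γ g x t c 0 0 + twist Γ g x t c 1 1 with hf
    have hcont : Continuous f := by
      have := continuous_subtype_val.comp (continuous_twist (Γ := Γ) (g := g) x c)
      exact (this.matrix_elem 0 0).add (this.matrix_elem 1 1)
    have hf0 : f 0 < 2 := by simpa only [hf, twist_zero] using hc0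
    by_contra hge
    -- By the intermediate value theorem the trace would equal 2 at some time.
    obtain ⟨r, hr⟩ := mem_range_of_exists_le_of_exists_ge hcont ⟨0, hf0.le⟩ ⟨t, not_lt.1 hge⟩
    exact twist_trace_ne_two hS hfree hx hcΓ hc0 r hr
  refine ⟨u₁, w₁, u₂, w₂, hl₁, hl₂, fun h h' => ?_, fun h h' => ?_⟩
  · exact exists_angle_bound (continuous_twist x b₁) (continuous_twist x b₂) htr₁' htr₂' hcomm
      (fun t => by rw [e1, e2, cosAngle_conj]) hu₁ hw₁ hu₂ hw₂ h h'
  · refine exists_angle_bound (C₀ := fun t => (twist Γ g (geodesic h₂ s₂) t b₂)⁻¹)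
      (continuous_twist x b₁) (continuous_twist x b₂⁻¹) htr₁' (fun t => ?_) (fun t => ?_)
      (fun t => ?_) hu₁ hw₁ hu₂.inv hw₂.inv h h'
    · rw [twist_inv hS hx hb₂, inv_00, inv_11, add_comm]
      exact htr₂' t
    · rw [twist_inv hS hx hb₂, trace_commutator_inv]
      exact hcomm t
    · have e : (twist Γ g x t b₂)⁻¹ = twistIsometry Γ g t x (geodesic h₁ s₁) *
          (twist Γ g (geodesic h₂ s₂) t b₂)⁻¹ *
          (twistIsometry Γ g t x (geodesic h₁ s₁))⁻¹ := by
        rw [e2]; group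
      rw [twist_inv hS hx hb₂, e, e1, cosAngle_conj]

/-- This serves the case where one of the two holonomies is constant: the limit directions of the
other are ends of axes of Γ on different lines, so discreteness excludes every coincidence. -/
theorem IsLimitPair.exists_axes {h b : SL(2, ℝ)} {u w : Fin 2 → Fin 2 → ℝ} (hS : IsSimpleAxis Γ g)
    (hb : b ∈ Γ) (hh : IsOrientedAxis b h) (hu : IsLimitPair Γ g h u w) {h' : SL(2, ℝ)}
    (hα : ∀ k, IsSignedLift Γ g k → line k ≠ line h') (hne : line h ≠ line h') (i : Fin 2) :
    (∃ a ∈ Γ, ∃ k, IsOrientedAxis a k ∧ line k ≠ line h' ∧ ∃ j, u i = column k j) ∧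
      ∃ a ∈ Γ, ∃ k, IsOrientedAxis a k ∧ line k ≠ line h' ∧ ∃ j, w i = column k j := by
  rcases hu with hu | ⟨k, κ, hk, hκ, -, -, hu⟩
  · exact ⟨⟨b, hb, h, hh, hne, _, (hu i).1⟩, b, hb, h, hh, hne, _, (hu i).2⟩
  · obtain ⟨a, ha, hak⟩ := hk.axis hS
    obtain ⟨c, hc, hcκ⟩ := hκ.axis hS
    exact ⟨⟨a, ha, k, hak, hα k hk, _, (hu i).1⟩, c, hc, κ, hcκ, hα κ hκ, _, (hu i).2⟩

end Main
end FenchelNielsen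

/-! ### The main theorem -/

open FenchelNielsen in
theorem mainTheorem4
    (Γ : Subgroup SL(2, ℝ)) [ProperlyDiscontinuousSMul Γ UpperHalfPlane]
    (hfree : ∀ γ ∈ Γ, ∀ z : UpperHalfPlane, γ • z = z → γ = 1 ∨ γ = -1)
    (a b₁ b₂ : SL(2, ℝ)) (ha : a ∈ Γ) (hb₁ : b₁ ∈ Γ) (hb₂ : b₂ ∈ Γ)
    (g h₁ h₂ : SL(2, ℝ))
    (hg : FenchelNielsen.IsOrientedAxis a g)
    (hh₁ : FenchelNielsen.IsOrientedAxis b₁ h₁)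
    (hh₂ : FenchelNielsen.IsOrientedAxis b₂ h₂)
    (hy : h₁ • UpperHalfPlane.I = h₂ • UpperHalfPlane.I)
    (hne : FenchelNielsen.line h₁ ≠ FenchelNielsen.line h₂)
    (hsimple : FenchelNielsen.IsSimple Γ g)
    (hα₁ : ∀ γ ∈ Γ, FenchelNielsen.line (γ * g) ≠ FenchelNielsen.line h₁)
    (hα₂ : ∀ γ ∈ Γ, FenchelNielsen.line (γ * g) ≠ FenchelNielsen.line h₂)
    (x : UpperHalfPlane) (hx : ∀ γ ∈ Γ, x ∉ FenchelNielsen.line (γ * g)) :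
    (FenchelNielsen.AngleBoundedAwayFromPi Γ g x b₁ b₂ ∨
      FenchelNielsen.AngleBoundedAwayFromPi Γ g x b₁ b₂⁻¹) ∧
    ((¬ ∃ k, FenchelNielsen.IsLift Γ g k ∧
        FenchelNielsen.CrossesToRight h₁ k ∧
        FenchelNielsen.CrossesToRight h₂ (k * FenchelNielsen.halfTurn)) →
      FenchelNielsen.AngleBoundedAwayFromPi Γ g x b₁ b₂) := by
  have hS : IsSimpleAxis Γ g := ⟨⟨a, ha, hg⟩, hsimple⟩
  have hα₁' : ∀ k, IsSignedLift Γ g k → line k ≠ line h₁ := fun k hk => by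
    obtain ⟨γ, hγ, e⟩ := hk.line_eq
    exact e ▸ hα₁ γ hγ
  have hα₂' : ∀ k, IsSignedLift Γ g k → line k ≠ line h₂ := fun k hk => by
    obtain ⟨γ, hγ, e⟩ := hk.line_eq
    exact e ▸ hα₂ γ hγ
  have hx' : OffLifts Γ g x := fun k hk => by
    obtain ⟨γ, hγ, e⟩ := hk.line_eq
    exact e ▸ hx γ hγ
  obtain ⟨u₁, w₁, u₂, w₂, hl₁, hl₂, hsame, hrev⟩ :=
    exists_limitPairs hS hfree hb₁ hb₂ hh₁ hh₂ hy hne hα₁' hα₂' hx'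
  have hwedge : ∀ {a' c k κ : SL(2, ℝ)}, a' ∈ Γ → c ∈ Γ → IsOrientedAxis a' k →
      IsOrientedAxis c κ → line k ≠ line κ → ∀ i j, wedge (column k i) (column κ j) ≠ 0 :=
    fun ha hc hk hκ hl => wedge_column_ne_zero (axes_ne_zero Γ ha hc hk hκ hl)
  suffices hmain : AngleBoundedAwayFromPi Γ g x b₁ b₂ ∨ (AngleBoundedAwayFromPi Γ g x b₁ b₂⁻¹ ∧
      ∃ k, IsLift Γ g k ∧ CrossesToRight h₁ k ∧ CrossesToRight h₂ (k * halfTurn)) by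
    rcases hmain with h | ⟨h, hk⟩
    · exact ⟨Or.inl h, fun _ => h⟩
    · exact ⟨Or.inr h, fun hn => absurd hk hn⟩
  rcases id hl₁ with hu₁ | ⟨k₁, κ₁, hk₁, hκ₁, hc₁, hd₁, hu₁⟩
  · refine Or.inl (hsame (fun i => ?_) fun i => ?_)
    · obtain ⟨-, c, hc, k, hk, hl, j, e⟩ := hl₂.exists_axes hS hb₂ hh₂ hα₁' hne.symm i
      rw [e, (hu₁ i).1]
      exact hwedge hb₁ hc hh₁ hk hl.symm _ _
    · obtain ⟨⟨c, hc, k, hk, hl, j, e⟩, -⟩ := hl₂.exists_axes hS hb₂ hh₂ hα₁' hne.symm i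
      rw [e, (hu₁ i).2]
      exact hwedge hc hb₁ hk hh₁ hl _ _
  rcases id hl₂ with hu₂ | ⟨k₂, κ₂, hk₂, hκ₂, hc₂, hd₂, hu₂⟩
  · refine Or.inl (hsame (fun i => ?_) fun i => ?_)
    · obtain ⟨⟨c, hc, k, hk, hl, j, e⟩, -⟩ := hl₁.exists_axes hS hb₁ hh₁ hα₂' hne i
      rw [e, (hu₂ i).2]
      exact hwedge hc hb₂ hk hh₂ hl _ _
    · obtain ⟨-, c, hc, k, hk, hl, j, e⟩ := hl₁.exists_axes hS hb₁ hh₁ hα₂' hne i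
      rw [e, (hu₂ i).1]
      exact hwedge hb₂ hc hh₂ hk hl.symm _ _
  -- Both holonomies now vary. An attracting limit of one meets a repelling limit of the other only
  -- if the corresponding lifts are the same line with opposite orientations.
  by_cases hcase : rightSide κ₂ ≠ leftSide k₁ ∧ rightSide κ₁ ≠ leftSide k₂
  · refine Or.inl (hsame (fun i => ?_) fun i => ?_)
    · rw [(hu₁ i).1, (hu₂ i).2]
      exact ((wedge_ne_zero_of_lifts hS hk₁ hκ₂ i).2 hcase.1).1
    · rw [(hu₂ i).1, (hu₁ i).2]
      exact ((wedge_ne_zero_of_lifts hS hk₂ hκ₁ i).2 hcase.2).1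
  rw [not_and_or, not_not, not_not] at hcase
  have hrev' : rightSide k₂ ≠ rightSide k₁ → rightSide κ₁ ≠ rightSide κ₂ →
      AngleBoundedAwayFromPi Γ g x b₁ b₂⁻¹ := fun hn hn' => by
    refine hrev (fun i => ?_) fun i => ?_
    · rw [(hu₁ i).1, (hu₂ i).1]
      exact (wedge_ne_zero_of_lifts hS hk₁ hk₂ i).1 hn
    · rw [(hu₁ i).2, (hu₂ i).2]
      exact (wedge_ne_zero_of_lifts hS hκ₂ hκ₁ (1 - i)).1 hn'
  -- When `κ₂` is `k₁` reversed, equality of `k₁` and `k₂` would make `h₂` cross one line in both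
  -- directions, and equality of `κ₁` and `κ₂` would do so for `h₁`. Hence reversing `b₂` leaves no
  -- coincidence, while `k₁` gives the lift crossed in opposite directions. The other case is
  -- symmetric.
  rcases hcase with e | e
  · have e' := leftSide_eq_of_opposite hS hk₁ hκ₂ e
    refine Or.inr ⟨hrev' (fun hk => ?_) fun hκ => ?_, exists_lift_of_opposite hk₁ hc₁ hd₂ e e'⟩
    · exact hc₂.not_opposite hd₂ (by rw [e, (same_of_rightSide_eq hS hk₁ hk₂ hk).1])
        (by rw [e', hk])
    · exact hc₁.not_opposite hd₁ (by rw [hκ, e])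
        (by rw [(same_of_rightSide_eq hS hκ₂ hκ₁ hκ).1, e'])
  · have e' := leftSide_eq_of_opposite hS hk₂ hκ₁ e
    refine Or.inr ⟨hrev' (fun hk => ?_) fun hκ => ?_,
      exists_lift_of_opposite hκ₁ hd₁ hc₂ e'.symm e.symm⟩
    · exact hc₁.not_opposite hd₁ (by rw [e, (same_of_rightSide_eq hS hk₁ hk₂ hk).1])
        (by rw [e', hk])
    · exact hc₂.not_opposite hd₂ (by rw [← hκ, e])
        (by rw [← (same_of_rightSide_eq hS hκ₂ hκ₁ hκ).1, e'])
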